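/- **Notation.** Points $r\in\mathbb R^2$ (position), $p\in\mathbb R^2$ (momentum), $t>0$; $\vec p=(p_1,p_2,0)$, $\vec\nabla=(\partial_{r_1},\partial_{r_2},0)$; $\langle f\rangle=\int_{\mathbb R^2}f\,dp$. Hermitian $2\times2$ matrix-valued functions are written $w=w_0\sigma_0+\vec w\cdot\vec\sigma$ with the Pauli matrices $\sigma_s$ and real components $w_0$, $\vec w=(w_1,w_2,w_3)$. Let $\varepsilon,\gamma>0$, $c=\gamma\varepsilon$, and let $V:\mathbb R^2\to\mathbb R$ be smooth with all derivatives polynomially bounded. Let $$(\Theta_\varepsilon[V]f)(r,p)=\frac{i}{\varepsilon(2\pi)^2}\int_{\mathbb R^2}\int_{\mathbb R^2}\Big[V\big(r+\tfrac\varepsilon2\eta\big)-V\big(r-\tfrac\varepsilon2\eta\big)\Big]f(r,p')\,e^{-i(p-p')\cdot\eta}\,dp'\,d\eta ,$$ $$(\mathrm{Op}_\varepsilon(a)\psi)(x)=(2\pi\varepsilon)^{-2}\int\int a\big(\tfrac{x+y}2,p\big)\psi(y)\,e^{i(x-y)\cdot p/\varepsilon}\,dy\,dp ,\qquad \mathcal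 E\mathrm{xp}_\varepsilon(a)=\mathrm{Op}_\varepsilon^{-1}\exp(\mathrm{Op}_\varepsilon(a)).$$ Given functions $n_0,\vec n,\vec J=(J_1,J_2,0)$ of $r$, the *equilibrium distribution* $g=g[n_0,\vec n,\vec J]$ is the quantum exponential $g=\mathcal E\mathrm{xp}_\varepsilon(-h_\xi)$, where $$h_\xi=\Big(\tfrac{|p|^2}2+p_k\xi_0^k+\xi_0^0\Big)\sigma_0+(\xi_s^0+c\,p_s)\sigma_s ,$$ with Lagrange multipliers $\xi=(\xi_0^0,(\xi^0_s)_{s=1,2,3},(\xi_0^k)_{k=1,2})$, smooth functions of $r$ with all derivatives polynomially bounded, such that $\langle g_0\rangle=n_0$, $\langle\vec g\rangle=\vec n$, $\langle\vec p\,g_0\rangle=\vec J$. A time-dependent phase-space function is called *regular* if it is smooth on $(0,\infty)\times\mathbb R^2\times\mathbb R^2$ and decreases rapidly in $(r,p)$ with all its derivatives, locally uniformly in $t\in(0,\infty)$. **Theorem.** For $\tau\in(0,\tau_0)$ let $w^\tau$ be a regular solution, for $t>0$, of $$\partial_tw_0+\frac{\vec p\cdot\vec\nabla}{2\gamma}w_0+\frac\varepsilon2\vec\nabla\cdot\vec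 w+\Theta_\varepsilon[V]w_0=\frac{g_0-w_0}\tau,$$ $$\partial_t\vec w+\frac{\vec p\cdot\vec\nabla}{2\gamma}\vec w+\frac\varepsilon2\vec\nabla w_0+\vec w\wedge\vec p+\Theta_\varepsilon[V]\vec w=\frac{\vec g-\vec w}\tau,$$ where at each time $g=g^\tau$ is the equilibrium distribution (with multipliers $\xi^\tau$) whose moments are those of $w^\tau$, $$n_0^\tau=\langle w_0^\tau\rangle,\qquad \vec n^\tau=\langle\vec w^\tau\rangle,\qquad \vec J^\tau=\langle\vec p\,w_0^\tau\rangle ,$$ and $g^\tau$ is regular. Assume that, for every $0<a<b$, $\int\!\!\int(1+|p|)^3(|w^\tau(t)|+|g^\tau(t)|)\,dr\,dp$ is bounded uniformly in $\tau\in(0,\tau_0)$ and $t\in[a,b]$, and that for every $t>0$ the multipliers $\xi^\tau(t,\cdot)$ are bounded by a polynomial in $|r|$ that does not depend on $\tau$. Suppose that for every $t>0$, as $\tau\to0$, $$n_0^\tau(t)\to n_0(t),\qquad \vec n^\tau(t)\to\vec n(t),\qquad \vec J^\tau(t)\to\vec J(t)$$ in $L^1(\mathbb R^2,(1+|r|)^m\,dr)$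 for all $m\in\mathbb N$, where $n_0>0$ and the limit moments have a regular equilibrium distribution $g=g[n_0,\vec n,\vec J]$. Then, for all $t>0$ and $r\in\mathbb R^2$, the limit moments satisfy (all the derivatives exist) $$\partial_tn_0+\frac{\vec\nabla}{2\gamma}\cdot\vec J+\frac\varepsilon2\vec\nabla\cdot\vec n=0,$$ $$\partial_tn_s+\frac1{2\gamma}\sum_{k=1}^2\partial_{r_k}\langle p_kg_s\rangle+\frac\varepsilon2(\vec\nabla n_0)_s+\langle\vec g\wedge\vec p\rangle_s=0\qquad(s=1,2,3),$$ $$\partial_tJ_i+\frac1{2\gamma}\sum_{k=1}^2\partial_{r_k}\Big(\frac{J_iJ_k}{n_0}+\mathscr P_{ik}\Big)+\frac\varepsilon2\sum_{k=1}^2\partial_{r_k}\langle p_ig_k\rangle+n_0\,\partial_{r_i}V=0\qquad(i=1,2),$$ with the quantum stress tensor $\mathscr P=\big\langle(\vec p-\vec J/n_0)\otimes(\vec p-\vec J/n_0)\,g_0\big\rangle$. -/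

import Mathlib

open MeasureTheory Set Filter Topology
open scoped ContDiff Matrix

noncomputable section

namespace Graphene

/-- The plane `ℝ²` with its Euclidean norm; both positions `r` and momenta `p` live in it. -/
abbrev Plane := EuclideanSpace ℝ (Fin 2)

/-- Two-component spinors. -/
abbrev Spinor := EuclideanSpace ℂ (Fin 2)

/-- A (time-independent) hermitian-matrix-valued phase-space function `a(r,p)`, given by its four
real Pauli components `a₀, a₁, a₂, a₃`. -/
abbrev PauliField := Plane → Plane → Fin 4 → ℝ

/-- The Pauli matrices `σ₀, σ₁, σ₂, σ₃`. -/
def pauli : Fin 4 → Matrix (Fin 2) (Fin 2) ℂ :=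
  ![!![1, 0; 0, 1], !![0, 1; 1, 0], !![0, -Complex.I; Complex.I, 0], !![1, 0; 0, -1]]

/-- The hermitian matrix `∑ₛ aₛ σₛ` with Pauli components `a`. -/
def pauliMatrix (a : Fin 4 → ℝ) : Matrix (Fin 2) (Fin 2) ℂ :=
  ∑ s, (a s : ℂ) • pauli s

/-- The vector part `(a₁, a₂, a₃)` of the Pauli components. -/
def vec (a : Fin 4 → ℝ) : Fin 3 → ℝ := fun s => a s.succ

/-- The plane vector `p = (p₁, p₂)` seen in space, `(p₁, p₂, 0)`. -/
def vec3 (p : Plane) : Fin 3 → ℝ := ![p 0, p 1, 0]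

/-- The partial derivative `∂f/∂r_k`. -/
def partialR (k : Fin 2) (f : Plane → ℝ) (r : Plane) : ℝ :=
  fderiv ℝ f r (EuclideanSpace.single k 1)

/-- The gradient `(∂f/∂r₁, ∂f/∂r₂, 0)`. -/
def grad3 (f : Plane → ℝ) (r : Plane) : Fin 3 → ℝ := ![partialR 0 f r, partialR 1 f r, 0]

/-- The divergence `∂F₁/∂r₁ + ∂F₂/∂r₂` of a space-vector field that depends on `r ∈ ℝ²`. -/
def div3 (F : Plane → Fin 3 → ℝ) (r : Plane) : ℝ :=
  partialR 0 (fun r' => F r' 0) r + partialR 1 (fun r' => F r' 1) r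

/-- The Weyl quantization
`(Op_ε(a)ψ)(x) = (2πε)⁻² ∫ a((x+y)/2, p) ψ(y) e^{i(x-y)·p/ε} dy dp`
of a matrix-valued symbol. The integral is iterated, first in `y` and then in `p`: for symbols
growing in `p` and Schwartz functions `ψ` it is an oscillatory integral. -/
def weylOp (ε : ℝ) (a : Plane → Plane → Matrix (Fin 2) (Fin 2) ℂ) (ψ : Plane → Spinor)
    (x : Plane) : Spinor :=
  ((((2 * Real.pi * ε) ^ 2)⁻¹ : ℝ) : ℂ) •
    ∫ p : Plane, ∫ y : Plane,
      Complex.exp (Complex.I * ((inner ℝ (x - y) p / ε : ℝ) : ℂ)) •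
        (WithLp.toLp 2 (a ((1 / 2 : ℝ) • (x + y)) p *ᵥ (ψ y).ofLp) : Spinor)

/-- `b` is the quantum exponential `Exp_ε(a) = Op_ε⁻¹(exp(Op_ε(a)))`, that is
`Op_ε(b) = exp(Op_ε(a))`. The exponential of the unbounded operator `Op_ε(a)` is taken in the sense
of the functional calculus: there is an orthonormal basis of `L²(ℝ²; ℂ²)`, made of Schwartz
functions `φ_j`, with `Op_ε(a) φ_j = μ_j φ_j` and `Op_ε(b) φ_j = e^{μ_j} φ_j`. When the symbol `b`
is a Schwartz function, the operator `Op_ε(b)` is compact and maps `L²` to Schwartz functions, so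
this loses no generality. -/
def IsQuantumExp (ε : ℝ) (a b : Plane → Plane → Matrix (Fin 2) (Fin 2) ℂ) : Prop :=
  ∃ (e : HilbertBasis ℕ ℂ (Lp Spinor 2 (volume : Measure Plane)))
    (φ : ℕ → SchwartzMap Plane Spinor) (μ : ℕ → ℝ), ∀ j,
      e j = (φ j).toLp 2 volume ∧
      (∀ x, weylOp ε a (φ j) x = (μ j : ℂ) • φ j x) ∧
      (∀ x, weylOp ε b (φ j) x = (Real.exp (μ j) : ℂ) • φ j x)

/-- The particle density `⟨w₀⟩`. -/
def density (w : PauliField) (r : Plane) : ℝ := ∫ p, w r p 0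

/-- The spin vector `⟨w⃗⟩`. -/
def spin (w : PauliField) (r : Plane) : Fin 3 → ℝ := fun s => ∫ p, vec (w r p) s

/-- The flow vector `⟨p w₀⟩` (its two nonzero components). -/
def flow (w : PauliField) (r : Plane) : Fin 2 → ℝ := fun k => ∫ p : Plane, p k * w r p 0

/-- Lagrange multipliers, functions of the position: `A = ξ₀⁰`, `B = (ξ₁⁰, ξ₂⁰, ξ₃⁰)` and
`U = (ξ₀¹, ξ₀²)`. -/
structure Multipliers where
  A : Plane → ℝ
  B : Plane → Fin 3 → ℝ
  U : Plane → Fin 2 → ℝ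

/-- Pauli components of the modified Hamiltonian
`h_ξ = (|p|²/2 + p_k ξ₀ᵏ + ξ₀⁰) σ₀ + (ξ_s⁰ + c p_s) σ_s`. -/
def modifiedHamiltonian (c : ℝ) (ξ : Multipliers) : PauliField := fun r p =>
  Fin.cons (‖p‖ ^ 2 / 2 + ∑ k, p k * ξ.U r k + ξ.A r) (fun s : Fin 3 => ξ.B r s + c * vec3 p s)

/-- `g` is the local equilibrium distribution `g[n₀, n⃗, J⃗]`, with Lagrange multipliers `ξ`: it is
the quantum exponential of `-h_ξ`, and it has the moments `n₀, n⃗, J⃗`. -/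
structure IsEquilibrium (ε c : ℝ) (n₀ : Plane → ℝ) (n : Plane → Fin 3 → ℝ)
    (J : Plane → Fin 2 → ℝ) (ξ : Multipliers) (g : PauliField) : Prop where
  temperate_A : Function.HasTemperateGrowth ξ.A
  temperate_B : Function.HasTemperateGrowth ξ.B
  temperate_U : Function.HasTemperateGrowth ξ.U
  exp_form : IsQuantumExp ε (fun r p => pauliMatrix (-modifiedHamiltonian c ξ r p))
    (fun r p => pauliMatrix (g r p))
  density_eq : ∀ r, density g r = n₀ r
  spin_eq : ∀ r, spin g r = n r
  flow_eq : ∀ r, flow g r = J r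

/-- The pseudo-differential operator
`(Θ_ε[V]f)(r,p) = (i/ε)(2π)⁻² ∫ (V(r+εη/2) - V(r-εη/2)) f(r,p') e^{-i(p-p')·η} dη dp'`,
as an iterated integral, first in `p'` and then in `η`. -/
def thetaOp (ε : ℝ) (V : Plane → ℝ) (f : Plane → Plane → ℝ) (r p : Plane) : ℂ :=
  Complex.I / ε * (((2 * Real.pi) ^ 2 : ℝ) : ℂ)⁻¹ *
    ∫ η : Plane, ∫ p' : Plane,
      ((V (r + (ε / 2) • η) - V (r - (ε / 2) • η) : ℝ) : ℂ) * (f r p' : ℂ) *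
        Complex.exp (-Complex.I * ((inner ℝ (p - p') η : ℝ) : ℂ))

/-- Smooth time-dependent phase-space functions on `(0,∞) × ℝ² × ℝ²` that decrease rapidly in
`(r,p)` together with all their derivatives, locally uniformly in `t`. -/
structure IsRegular (w : ℝ → PauliField) : Prop where
  smooth : ContDiffOn ℝ ∞ (fun z : ℝ × Plane × Plane => w z.1 z.2.1 z.2.2) (Ioi 0 ×ˢ univ)
  decay : ∀ a b : ℝ, 0 < a → ∀ k l : ℕ, ∃ C : ℝ, ∀ t ∈ Icc a b, ∀ r p : Plane,
    (1 + ‖r‖ + ‖p‖) ^ k *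
      ‖iteratedFDeriv ℝ l (fun z : ℝ × Plane × Plane => w z.1 z.2.1 z.2.2) (t, r, p)‖ ≤ C

/-- `w` satisfies, for `t > 0`, the Wigner-BGK system in hydrodynamic scaling with relaxation
towards `g`:
`∂ₜw₀ + (p·∇/2γ)w₀ + (ε/2)∇·w⃗ + Θ_ε[V]w₀ = (g₀ - w₀)/τ`,
`∂ₜw⃗ + (p·∇/2γ)w⃗ + (ε/2)∇w₀ + w⃗∧p⃗ + Θ_ε[V]w⃗ = (g⃗ - w⃗)/τ`. -/
structure SolvesWignerBGK (ε γ τ : ℝ) (V : Plane → ℝ) (w g : ℝ → PauliField) : Prop where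
  scalar_eq : ∀ t > 0, ∀ r p,
    ((deriv (fun t' => w t' r p 0) t
        + (∑ k, p k * partialR k (fun r' => w t r' p 0) r) / (2 * γ)
        + ε / 2 * div3 (fun r' => vec (w t r' p)) r : ℝ) : ℂ)
      + thetaOp ε V (fun r' p' => w t r' p' 0) r p
      = (((g t r p 0 - w t r p 0) / τ : ℝ) : ℂ)
  vector_eq : ∀ t > 0, ∀ r p, ∀ s : Fin 3,
    ((deriv (fun t' => vec (w t' r p) s) t
        + (∑ k, p k * partialR k (fun r' => vec (w t r' p) s) r) / (2 * γ)
        + ε / 2 * grad3 (fun r' => w t r' p 0) r s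
        + crossProduct (vec (w t r p)) (vec3 p) s : ℝ) : ℂ)
      + thetaOp ε V (fun r' p' => vec (w t r' p') s) r p
      = (((vec (g t r p) s - vec (w t r p) s) / τ : ℝ) : ℂ)

/-- The entries `⟨p_k g_s⟩` of the tensor `⟨p⃗ ⊗ g⃗⟩`. -/
def momentumSpin (g : PauliField) (r : Plane) (k : Fin 2) (s : Fin 3) : ℝ :=
  ∫ p : Plane, p k * vec (g r p) s

/-- The vector `⟨g⃗ ∧ p⃗⟩`. -/
def spinPrecession (g : PauliField) (r : Plane) (s : Fin 3) : ℝ :=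
  ∫ p : Plane, crossProduct (vec (g r p)) (vec3 p) s

/-- The quantum stress tensor `⟨(p⃗ - J⃗/n₀) ⊗ (p⃗ - J⃗/n₀) g₀⟩`. -/
def stressTensor (n₀ : Plane → ℝ) (J : Plane → Fin 2 → ℝ) (g : PauliField) (r : Plane)
    (i k : Fin 2) : ℝ :=
  ∫ p : Plane, (p i - J r i / n₀ r) * (p k - J r k / n₀ r) * g r p 0

/-- The momentum flux `J⃗ ⊗ J⃗ / n₀ + 𝒫`. -/
def momentumFlux (n₀ : Plane → ℝ) (J : Plane → Fin 2 → ℝ) (g : PauliField) (r : Plane)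
    (i k : Fin 2) : ℝ :=
  J r i * J r k / n₀ r + stressTensor n₀ J g r i k

/-- `n₀, n⃗, J⃗` satisfy, for `t > 0` and in the classical sense, the moment system closed by the
distributions `g(t)`. The first six fields say that all the derivatives in the three equations
exist. -/
structure SolvesHydrodynamic (ε γ : ℝ) (V : Plane → ℝ) (n₀ : ℝ → Plane → ℝ)
    (n : ℝ → Plane → Fin 3 → ℝ) (J : ℝ → Plane → Fin 2 → ℝ) (g : ℝ → PauliField) : Prop where
  time_diff : ∀ t > 0, ∀ r, DifferentiableAt ℝ (fun t' => n₀ t' r) t ∧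
    DifferentiableAt ℝ (fun t' => n t' r) t ∧ DifferentiableAt ℝ (fun t' => J t' r) t
  density_diff : ∀ t > 0, ∀ r, DifferentiableAt ℝ (n₀ t) r
  spin_diff : ∀ t > 0, ∀ r, DifferentiableAt ℝ (n t) r
  flow_diff : ∀ t > 0, ∀ r, DifferentiableAt ℝ (J t) r
  momentumSpin_diff : ∀ t > 0, ∀ r k s,
    DifferentiableAt ℝ (fun r' => momentumSpin (g t) r' k s) r
  momentumFlux_diff : ∀ t > 0, ∀ r i k,
    DifferentiableAt ℝ (fun r' => momentumFlux (n₀ t) (J t) (g t) r' i k) r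
  /-- `∂ₜn₀ + (∇/2γ)·J⃗ + (ε/2)∇·n⃗ = 0` -/
  density_eq : ∀ t > 0, ∀ r,
    deriv (fun t' => n₀ t' r) t
      + (∑ k, partialR k (fun r' => J t r' k) r) / (2 * γ)
      + ε / 2 * div3 (n t) r = 0
  /-- `∂ₜn_s + (1/2γ) ∑_k ∂_k⟨p_k g_s⟩ + (ε/2)∂_s n₀ + ⟨g⃗ ∧ p⃗⟩_s = 0` -/
  spin_eq : ∀ t > 0, ∀ r, ∀ s : Fin 3,
    deriv (fun t' => n t' r s) t
      + (∑ k, partialR k (fun r' => momentumSpin (g t) r' k s) r) / (2 * γ)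
      + ε / 2 * grad3 (n₀ t) r s
      + spinPrecession (g t) r s = 0
  /-- `∂ₜJ_i + (1/2γ) ∑_k ∂_k(J_i J_k/n₀ + 𝒫_ik) + (ε/2) ∑_k ∂_k⟨p_i g_k⟩ + n₀ ∂_iV = 0` -/
  flow_eq : ∀ t > 0, ∀ r, ∀ i : Fin 2,
    deriv (fun t' => J t' r i) t
      + (∑ k, partialR k (fun r' => momentumFlux (n₀ t) (J t) (g t) r' i k) r) / (2 * γ)
      + ε / 2 * div3 (fun r' s => momentumSpin (g t) r' i s) r
      + n₀ t r * partialR i V r = 0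

end Graphene

end

noncomputable section

set_option linter.unusedSectionVars false

namespace Graphene

open scoped SchwartzMap LineDeriv FourierTransform

/-! ### Scaled Fourier transform of Schwartz functions -/

section Fourier

variable {E : Type*} [NormedAddCommGroup E] [NormedSpace ℂ E]

/-! Collisions preserve `⟨w₀⟩`, `⟨w⃗⟩` and `⟨p⃗ w₀⟩`, because `g^τ` has the same such moments as
`w^τ`. Their balance laws therefore carry no factor `1/τ`, but they contain the moments `⟨p_k w_s⟩`
and `⟨p_i p_k w₀⟩`, which are not conserved. The theorem amounts to finding the limits of these, in
two steps: moments of `w^τ` of order at most two are compared with those of `g^τ`, and those of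
`g^τ` with those of the limit equilibrium `g`.

Relaxation. Moments of `Θ_ε[V] f` of order at most two are explicit: they are read off from the
Taylor expansion at `η = 0` of `V(r+εη/2) - V(r-εη/2)` times the Fourier transform of `f`. The
moment equation of order at most two, tested against a function of `r`, integrated over a time
interval and multiplied by `τ`, shows that the tested moments of `g^τ` and `w^τ` have time integrals
that differ by `O(τ)`; the third moments that appear as fluxes are bounded by assumption
(`tendsto_integral_relaxation`).

Stability of equilibria. Let `H`, `H'` be the quantizations of the modified Hamiltonians of `g^τ`
and `g`, with multipliers `ξ`, `ξ'`, and `ρ = exp(-H)`, `ρ' = exp(-H')`. The symmetrised relative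
entropy is `Tr (ρ - ρ')(H' - H)`. The kinetic parts cancel in `H' - H`, so this trace is a constant
times the integral over `r` of `ξ' - ξ` against the differences of exactly those moments that are
prescribed. It tends to zero, since the multipliers have a common polynomial bound and the moments
converge in every weighted `L¹`. Expanded in the eigenbases of both operators, with `μ_j` and `ν_k`
the eigenvalues of `-H` and `-H'`, it is the sum of `(e^{μ_j} - e^{ν_k})(μ_j - ν_k)|⟨e'_k, e_j⟩|²`.
The scalar inequality `(e^a - e^b)² ≤ M (e^a - e^b)(a - b)` makes it dominate the squared
Hilbert-Schmidt norm of `ρ - ρ'`, which by Plancherel is a multiple of the squared `L²` norm of `g^τ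
- g` (`tsum_sq_exp_sub_exp_le`, `exists_integral_sq_sub_le`). Convergence in `L²` and the bound on
third moments give convergence of the tested moments of order at most two
(`exists_moment_difference_bound`). The traces are computed from a trace formula for Schwartz
kernels, valid in any orthonormal basis of Schwartz functions (`hasSum_trace`).

Conclusion. The limit is taken in the equations tested in `r` and integrated in `t`. The weak
identity `hasDerivAt_pair_monoMom` holds for every regular family, in particular for `g`; comparison
of the two shows that the remainder in the moment equations of `g` vanishes when tested, hence
pointwise (`momentDefect_limit_eq_zero`). Written in components, these equations are the
hydrodynamic system. -/

/-- The coordinate vectors of the plane. -/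
def unitVec (k : Fin 2) : Plane := EuclideanSpace.single k 1

theorem inner_unitVec (p : Plane) (k : Fin 2) : inner ℝ p (unitVec k) = p k := by
  simp [unitVec, EuclideanSpace.inner_single_right]

theorem abs_coord_le (p : Plane) (k : Fin 2) : |p k| ≤ ‖p‖ := by
  simpa using PiLp.norm_apply_le p k

theorem hasTemperateGrowth_coord (k : Fin 2) :
    Function.HasTemperateGrowth (fun p : Plane => p k) := by
  simpa only [inner_unitVec] using
    (show Function.HasTemperateGrowth (fun p : Plane => inner ℝ p (unitVec k)) by fun_prop)

/-- The oscillating factor `e^{i c x·y}`. -/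
def phase (c : ℝ) (x y : Plane) : ℂ := Complex.exp (Complex.I * ((c * inner ℝ x y : ℝ) : ℂ))

@[simp] theorem norm_phase (c : ℝ) (x y : Plane) : ‖phase c x y‖ = 1 := by
  rw [phase, mul_comm, Complex.norm_exp_ofReal_mul_I]

theorem phase_comm (c : ℝ) (x y : Plane) : phase c x y = phase c y x := by
  rw [phase, phase, real_inner_comm]

theorem phase_sub_left (c : ℝ) (x x' y : Plane) :
    phase c (x - x') y = phase c x y * phase (-c) x' y := by
  simp only [phase, ← Complex.exp_add, inner_sub_left]
  push_cast; ring_nf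

@[simp] theorem phase_zero_left (c : ℝ) (y : Plane) : phase c 0 y = 1 := by simp [phase]

theorem continuous_phase (c : ℝ) : Continuous fun z : Plane × Plane => phase c z.1 z.2 := by
  unfold phase; fun_prop

theorem star_phase (c : ℝ) (x y : Plane) : (starRingEnd ℂ) (phase c x y) = phase (-c) x y := by
  simp only [phase, ← Complex.exp_conj, map_mul, Complex.conj_I, Complex.conj_ofReal]
  push_cast; ring_nf

/-- The scaled Fourier transform `p ↦ ∫ e^{i c y·p} f(y) dy`. -/
def ft (c : ℝ) (f : Plane → E) (p : Plane) : E := ∫ y, phase c y p • f y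

theorem ft_eq_fourier (c : ℝ) (f : Plane → E) (p : Plane) :
    ft c f p = 𝓕 f (-(c / (2 * Real.pi)) • p) := by
  rw [ft, Real.fourier_eq']
  congr 1; ext y; congr 1
  rw [phase, inner_smul_right]
  congr 1
  have : Real.pi ≠ 0 := Real.pi_ne_zero
  have h : (-2 * Real.pi * (-(c / (2 * Real.pi)) * inner ℝ y p)) = c * inner ℝ y p := by
    field_simp
  rw [h, mul_comm]

theorem scale_ne_zero {c : ℝ} (hc : c ≠ 0) : -(c / (2 * Real.pi)) ≠ 0 :=
  neg_ne_zero.2 (div_ne_zero hc (by positivity))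

/-- The dilation that turns the unitary Fourier transform into `ft c`. -/
def scaleEquiv (c : ℝ) (hc : c ≠ 0) : Plane ≃L[ℝ] Plane :=
  ContinuousLinearEquiv.smulLeft (Units.mk0 (-(c / (2 * Real.pi))) (scale_ne_zero hc))

theorem scaleEquiv_apply (c : ℝ) (hc : c ≠ 0) (p : Plane) :
    scaleEquiv c hc p = -(c / (2 * Real.pi)) • p := rfl

/-- The scaled Fourier transform of a Schwartz function, as a Schwartz function. -/
def ftSchwartz (c : ℝ) (hc : c ≠ 0) (f : 𝓢(Plane, E)) : 𝓢(Plane, E) :=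
  SchwartzMap.compCLMOfContinuousLinearEquiv ℂ (scaleEquiv c hc) (𝓕 f)

theorem ftSchwartz_apply (c : ℝ) (hc : c ≠ 0) (f : 𝓢(Plane, E)) (p : Plane) :
    ftSchwartz c hc f p = ft c f p := by
  rw [ft_eq_fourier, ftSchwartz, SchwartzMap.compCLMOfContinuousLinearEquiv_apply,
    Function.comp_apply, scaleEquiv_apply, SchwartzMap.fourier_coe]

theorem integrable_ft {c : ℝ} (hc : c ≠ 0) (f : 𝓢(Plane, E)) : Integrable (ft c f) := by
  rw [← (funext (ftSchwartz_apply c hc f) : _ = ft c f)]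
  exact (ftSchwartz c hc f).integrable

theorem integral_comp_scale {F : Type*} [NormedAddCommGroup F] [NormedSpace ℝ F] (c : ℝ)
    (f : Plane → F) :
    ∫ p, f (-(c / (2 * Real.pi)) • p) = ((2 * Real.pi / c) ^ 2) • ∫ p, f p := by
  rw [Measure.integral_comp_smul]
  simp only [finrank_euclideanSpace, Fintype.card_fin]
  congr 1
  rw [abs_of_nonneg (by positivity), neg_sq, div_pow, div_pow, inv_div]

/-- Fourier inversion. The dilation between `ft c` and the unitary transform has Jacobian `(2π/c)²`
in dimension two. At `x = 0` the formula says that the integral of a transform recovers the value of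
the function at the origin, which is how all momentum moments of `Θ_ε[V]` are obtained. -/
theorem integral_phase_ft [CompleteSpace E] {c : ℝ} (hc : c ≠ 0) (f : 𝓢(Plane, E)) (x : Plane) :
    ∫ p, phase (-c) x p • ft c f p = ((2 * Real.pi / c) ^ 2) • f x := by
  have h := integral_comp_scale c
    (fun q => Complex.exp (((2 * Real.pi * inner ℝ q x : ℝ) : ℂ) * Complex.I) • 𝓕 (f : Plane → E) q)
  rw [← Real.fourierInv_eq', ← SchwartzMap.fourier_coe, ← SchwartzMap.fourierInv_coe,
    FourierTransform.fourierInv_fourier_eq] at h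
  rw [← h]
  congr 1; ext p
  rw [ft_eq_fourier, phase, inner_smul_left, real_inner_comm, mul_comm Complex.I]
  congr 4
  have : Real.pi ≠ 0 := Real.pi_ne_zero
  simp; field_simp

/-- Integration by parts: each power of `p` becomes a derivative on the other side. -/
theorem coord_smul_ft {c : ℝ} (hc : c ≠ 0) (f : 𝓢(Plane, E)) (k : Fin 2) (p : Plane) :
    p k • ft c f p = ft c ((Complex.I / (c : ℂ)) • ∂_{unitVec k} f : 𝓢(Plane, E)) p := by
  have h := congrArg (fun F : 𝓢(Plane, E) => F (-(c / (2 * Real.pi)) • p))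
    (SchwartzMap.fourier_lineDerivOp_eq f (unitVec k))
  have h1 : ft c ((Complex.I / (c : ℂ)) • ∂_{unitVec k} f : 𝓢(Plane, E)) p
      = (Complex.I / (c : ℂ)) • ft c (∂_{unitVec k} f : 𝓢(Plane, E)) p := by
    simp only [ft, smul_apply]
    rw [← integral_smul]
    congr 1; ext y; rw [smul_comm]
  have ht : Function.HasTemperateGrowth fun p : Plane => inner ℝ p (unitVec k) := by fun_prop
  rw [h1, ft_eq_fourier c (∂_{unitVec k} f : 𝓢(Plane, E)), ← SchwartzMap.fourier_coe, h]
  rw [smul_apply, SchwartzMap.smulLeftCLM_apply_apply ht, inner_unitVec]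
  rw [ft_eq_fourier, ← SchwartzMap.fourier_coe, ← Complex.coe_smul, ← Complex.coe_smul, smul_smul,
    smul_smul]
  congr 1
  have : (Real.pi : ℂ) ≠ 0 := by exact_mod_cast Real.pi_ne_zero
  have : (c : ℂ) ≠ 0 := by exact_mod_cast hc
  simp
  field_simp
  simp

end Fourier

/-! ### Derivatives and moments of the Fourier transform -/

section Fourier

variable {E : Type*} [NormedAddCommGroup E] [NormedSpace ℂ E]

theorem lineDeriv_ftSchwartz (c : ℝ) (hc : c ≠ 0) (f : 𝓢(Plane, E)) (k : Fin 2) (p : Plane) :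
    (∂_{unitVec k} (ftSchwartz c hc f) : 𝓢(Plane, E)) p
      = (Complex.I * c) • ft c (fun y => y k • f y) p := by
  have ht : Function.HasTemperateGrowth fun p : Plane => inner ℝ p (unitVec k) := by fun_prop
  rw [ftSchwartz, SchwartzMap.lineDerivOp_compCLMOfContinuousLinearEquiv, scaleEquiv_apply,
    LineDeriv.lineDerivOp_left_smul, SchwartzMap.lineDerivOp_fourier_eq]
  rw [SchwartzMap.compCLMOfContinuousLinearEquiv_apply, Function.comp_apply, scaleEquiv_apply,
    smul_apply, SchwartzMap.fourier_coe, ← ft_eq_fourier]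
  simp only [ft]
  rw [← integral_smul, ← integral_smul]
  congr 1; ext y
  rw [smul_apply, SchwartzMap.smulLeftCLM_apply_apply ht, inner_unitVec]
  simp only [← Complex.coe_smul, smul_smul]
  congr 1
  have : (Real.pi : ℂ) ≠ 0 := by exact_mod_cast Real.pi_ne_zero
  push_cast
  field_simp

theorem integrable_coord_smul_ft {c : ℝ} (hc : c ≠ 0) (f : 𝓢(Plane, E)) (k : Fin 2) :
    Integrable fun p : Plane => p k • ft c f p := by
  simp_rw [coord_smul_ft hc f k]
  exact integrable_ft hc _

theorem integrable_coord_coord_smul_ft {c : ℝ} (hc : c ≠ 0) (f : 𝓢(Plane, E)) (k l : Fin 2) :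
    Integrable fun p : Plane => (p k * p l) • ft c f p := by
  simp_rw [mul_smul, coord_smul_ft hc f l, coord_smul_ft hc _ k]
  exact integrable_ft hc _

theorem integral_phase_coord_smul_ft [CompleteSpace E] {c : ℝ} (hc : c ≠ 0) (f : 𝓢(Plane, E))
    (k : Fin 2) (x : Plane) :
    ∫ p, phase (-c) x p • p k • ft c f p
      = ((2 * Real.pi / c) ^ 2) • (Complex.I / (c : ℂ)) • (∂_{unitVec k} f : 𝓢(Plane, E)) x := by
  simp_rw [coord_smul_ft hc f k]
  rw [integral_phase_ft hc, smul_apply]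

theorem integral_phase_coord_coord_smul_ft [CompleteSpace E] {c : ℝ} (hc : c ≠ 0)
    (f : 𝓢(Plane, E)) (k l : Fin 2) (x : Plane) :
    ∫ p, phase (-c) x p • (p k * p l) • ft c f p
      = ((2 * Real.pi / c) ^ 2) • (Complex.I / (c : ℂ)) ^ 2 •
          (∂_{unitVec k} (∂_{unitVec l} f : 𝓢(Plane, E)) : 𝓢(Plane, E)) x := by
  simp_rw [mul_smul, coord_smul_ft hc f l]
  rw [integral_phase_coord_smul_ft hc, LineDeriv.lineDerivOp_smul, smul_apply,
    smul_smul (Complex.I / (c : ℂ)), ← sq]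

end Fourier

/-! ### Momentum moments of the potential operator -/

section Theta

/-- The centred difference of the potential. -/
def centredDiff (ε : ℝ) (V : Plane → ℝ) (r η : Plane) : ℝ :=
  V (r + (ε / 2) • η) - V (r - (ε / 2) • η)

variable {ε : ℝ} {V : Plane → ℝ}

theorem hasTemperateGrowth_centredDiff (hV : Function.HasTemperateGrowth V) (r : Plane) :
    Function.HasTemperateGrowth (centredDiff ε V r) := by
  unfold centredDiff
  exact (hV.comp (by fun_prop)).sub (hV.comp (by fun_prop))

theorem hasTemperateGrowth_centredDiff_complex (hV : Function.HasTemperateGrowth V) (r : Plane) :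
    Function.HasTemperateGrowth (fun η => (centredDiff ε V r η : ℂ)) :=
  Function.Complex.hasTemperateGrowth_ofReal.comp (hasTemperateGrowth_centredDiff hV r)

/-- The Fourier side of `Θ_ε[V] f`. -/
def thetaSymbol (ε : ℝ) (V : Plane → ℝ) (r : Plane) (f : 𝓢(Plane, ℂ)) : 𝓢(Plane, ℂ) :=
  SchwartzMap.smulLeftCLM ℂ (fun η => (centredDiff ε V r η : ℂ)) (ftSchwartz 1 one_ne_zero f)

/-- The phase splits into a factor in `p'` and one in `p`: the inner integral is a Fourier
transform, multiplication by the centred difference follows, and the outer integral transforms back.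
-/
theorem thetaOp_eq_ft (hV : Function.HasTemperateGrowth V) (f : Plane → Plane → ℝ) (r p : Plane)
    (F : 𝓢(Plane, ℂ)) (hF : ∀ p, F p = f r p) :
    thetaOp ε V f r p = (Complex.I / ε * (((2 * Real.pi) ^ 2 : ℝ) : ℂ)⁻¹) *
      ft (-1) (thetaSymbol ε V r F) p := by
  rw [thetaOp, ft]
  congr 2; ext η
  rw [thetaSymbol, SchwartzMap.smulLeftCLM_apply_apply (hasTemperateGrowth_centredDiff_complex hV r),
    ftSchwartz_apply, ft, smul_eq_mul, smul_eq_mul, ← integral_const_mul, ← integral_const_mul]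
  congr 1; ext q
  have : Complex.exp (-Complex.I * ((inner ℝ (p - q) η : ℝ) : ℂ))
      = phase (-1) η p * phase 1 q η := by
    rw [phase_comm (-1), show phase 1 q η = phase (- -1) q η by norm_num, ← phase_sub_left, phase]
    congr 1; push_cast; ring
  rw [this, hF, centredDiff, smul_eq_mul]
  ring

theorem fderiv_centredDiff (hV : Differentiable ℝ V) (r η : Plane) :
    HasFDerivAt (centredDiff ε V r)
      ((ε / 2) • (fderiv ℝ V (r + (ε / 2) • η) + fderiv ℝ V (r - (ε / 2) • η))) η := by
  have h1 : HasFDerivAt (fun η : Plane => r + (ε / 2) • η)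
      ((ε / 2) • ContinuousLinearMap.id ℝ Plane) η :=
    ((hasFDerivAt_id η).const_smul (ε / 2)).const_add r
  have h2 : HasFDerivAt (fun η : Plane => r - (ε / 2) • η)
      (-((ε / 2) • ContinuousLinearMap.id ℝ Plane)) η :=
    ((hasFDerivAt_id η).const_smul (ε / 2)).const_sub r
  have h := ((hV _).hasFDerivAt.comp η h1).sub ((hV _).hasFDerivAt.comp η h2)
  refine h.congr_fderiv ?_
  ext v
  simp

theorem centredDiff_zero (r : Plane) : centredDiff ε V r 0 = 0 := by simp [centredDiff]

theorem thetaSymbol_apply (hV : Function.HasTemperateGrowth V) (r : Plane) (f : 𝓢(Plane, ℂ))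
    (η : Plane) : thetaSymbol ε V r f η = (centredDiff ε V r η : ℂ) * ft 1 f η := by
  rw [thetaSymbol, SchwartzMap.smulLeftCLM_apply_apply (hasTemperateGrowth_centredDiff_complex hV r),
    ftSchwartz_apply, smul_eq_mul]

theorem lineDeriv_thetaSymbol (hV : Function.HasTemperateGrowth V) (r : Plane) (f : 𝓢(Plane, ℂ))
    (k : Fin 2) (η : Plane) :
    (∂_{unitVec k} (thetaSymbol ε V r f) : 𝓢(Plane, ℂ)) η
      = ((ε / 2 * (partialR k V (r + (ε / 2) • η) + partialR k V (r - (ε / 2) • η)) : ℝ) : ℂ)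
          * ft 1 f η
        + (centredDiff ε V r η : ℂ)
          * (∂_{unitVec k} (ftSchwartz 1 one_ne_zero f) : 𝓢(Plane, ℂ)) η := by
  have hVd : Differentiable ℝ V := hV.1.differentiable (by simp)
  have h1 := (Complex.ofRealCLM.hasFDerivAt.comp η (fderiv_centredDiff (ε := ε) hVd r η))
  have h := h1.mul ((ftSchwartz 1 one_ne_zero f).hasFDerivAt η)
  have he : (thetaSymbol ε V r f : Plane → ℂ)
      = (Complex.ofRealCLM ∘ centredDiff ε V r) * (ftSchwartz 1 one_ne_zero f : Plane → ℂ) := by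
    ext η; simp [thetaSymbol_apply hV, ftSchwartz_apply]
  rw [SchwartzMap.lineDerivOp_apply_eq_fderiv, he, h.fderiv]
  simp [ftSchwartz_apply, SchwartzMap.lineDerivOp_apply_eq_fderiv, partialR, unitVec]
  ring

theorem lineDeriv_lineDeriv_thetaSymbol_zero (hV : Function.HasTemperateGrowth V) (r : Plane)
    (f : 𝓢(Plane, ℂ)) (k l : Fin 2) :
    (∂_{unitVec l} (∂_{unitVec k} (thetaSymbol ε V r f) : 𝓢(Plane, ℂ)) : 𝓢(Plane, ℂ)) 0
      = ((ε * partialR k V r : ℝ) : ℂ) * (∂_{unitVec l} (ftSchwartz 1 one_ne_zero f) : 𝓢(Plane, ℂ)) 0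
        + ((ε * partialR l V r : ℝ) : ℂ)
          * (∂_{unitVec k} (ftSchwartz 1 one_ne_zero f) : 𝓢(Plane, ℂ)) 0 := by
  have hVd : Differentiable ℝ V := hV.1.differentiable (by simp)
  have hpd : Differentiable ℝ (partialR k V) :=
    ((hV.1.fderiv_right (m := 1) (by norm_cast)).differentiable (by simp)).clm_apply
      (differentiable_const _)
  have hp : HasFDerivAt (fun η : Plane => r + (ε / 2) • η)
      ((ε / 2) • ContinuousLinearMap.id ℝ Plane) 0 :=
    ((hasFDerivAt_id _).const_smul (ε / 2)).const_add r
  have hm : HasFDerivAt (fun η : Plane => r - (ε / 2) • η)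
      (-((ε / 2) • ContinuousLinearMap.id ℝ Plane)) 0 :=
    ((hasFDerivAt_id _).const_smul (ε / 2)).const_sub r
  -- The gradient of `V` enters at `r + (ε/2)η` and `r - (ε/2)η` with the same sign, so the
  -- first-order terms in `η` cancel. This is why no second derivative of `V` appears in the moments
  -- of order two.
  have h0 : HasFDerivAt (fun η : Plane =>
      ε / 2 * (partialR k V (r + (ε / 2) • η) + partialR k V (r - (ε / 2) • η)))
      (0 : Plane →L[ℝ] ℝ) 0 := by
    have h := (((hpd _).hasFDerivAt.comp _ hp).add ((hpd _).hasFDerivAt.comp _ hm)).const_mul (ε / 2)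
    refine h.congr_fderiv ?_
    ext v
    simp
  have h1 := Complex.ofRealCLM.hasFDerivAt.comp _ h0
  have h2 := (Complex.ofRealCLM.hasFDerivAt.comp _ (fderiv_centredDiff (ε := ε) hVd r 0))
  have h := (h1.mul ((ftSchwartz 1 one_ne_zero f).hasFDerivAt 0)).add
    (h2.mul ((∂_{unitVec k} (ftSchwartz 1 one_ne_zero f) : 𝓢(Plane, ℂ)).hasFDerivAt 0))
  have he : ((∂_{unitVec k} (thetaSymbol ε V r f) : 𝓢(Plane, ℂ)) : Plane → ℂ)
      = (Complex.ofRealCLM ∘ fun η : Plane =>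
          ε / 2 * (partialR k V (r + (ε / 2) • η) + partialR k V (r - (ε / 2) • η)))
            * (ftSchwartz 1 one_ne_zero f : Plane → ℂ)
        + (Complex.ofRealCLM ∘ centredDiff ε V r)
            * ((∂_{unitVec k} (ftSchwartz 1 one_ne_zero f) : 𝓢(Plane, ℂ)) : Plane → ℂ) := by
    ext η; simp [lineDeriv_thetaSymbol hV, ftSchwartz_apply]
  rw [SchwartzMap.lineDerivOp_apply_eq_fderiv, he, h.fderiv]
  simp [SchwartzMap.lineDerivOp_apply_eq_fderiv, partialR, unitVec, centredDiff_zero]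
  ring

theorem ft_zero {E : Type*} [NormedAddCommGroup E] [NormedSpace ℂ E] (c : ℝ) (f : Plane → E) :
    ft c f 0 = ∫ p, f p := by
  simp [ft, phase]

/-- The centred difference vanishes at `η = 0`, so the potential neither creates nor destroys mass.
-/
theorem integral_thetaOp (hV : Function.HasTemperateGrowth V)
    (f : Plane → Plane → ℝ) (r : Plane) (F : 𝓢(Plane, ℂ)) (hF : ∀ p, F p = f r p) :
    Integrable (fun p => thetaOp ε V f r p) ∧ ∫ p, thetaOp ε V f r p = 0 := by
  simp_rw [thetaOp_eq_ft hV f r _ F hF]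
  refine ⟨(integrable_ft (by norm_num) _).const_mul _, ?_⟩
  have h := integral_phase_ft (c := -1) (by norm_num) (thetaSymbol ε V r F) 0
  simp only [phase_zero_left, one_smul] at h
  rw [integral_const_mul, h, thetaSymbol_apply hV, centredDiff_zero]
  simp

/-- A first moment is a first derivative at `η = 0`, and the centred difference has gradient
`ε∇V(r)` there: the classical force is exact at this order. -/
theorem integral_coord_mul_thetaOp (hε : ε ≠ 0) (hV : Function.HasTemperateGrowth V)
    (f : Plane → Plane → ℝ) (r : Plane) (F : 𝓢(Plane, ℂ)) (hF : ∀ p, F p = f r p) (k : Fin 2) :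
    Integrable (fun p : Plane => (p k : ℂ) * thetaOp ε V f r p) ∧
      ∫ p : Plane, (p k : ℂ) * thetaOp ε V f r p = ((partialR k V r * ∫ p, f r p : ℝ) : ℂ) := by
  have he : (fun p : Plane => (p k : ℂ) * thetaOp ε V f r p) = fun p : Plane =>
      (Complex.I / ε * (((2 * Real.pi) ^ 2 : ℝ) : ℂ)⁻¹) * (p k • ft (-1) (thetaSymbol ε V r F) p) := by
    ext p
    rw [thetaOp_eq_ft hV f r _ F hF, Complex.real_smul]; ring
  rw [he]
  refine ⟨(integrable_coord_smul_ft (by norm_num) _ k).const_mul _, ?_⟩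
  have h := integral_phase_coord_smul_ft (c := -1) (by norm_num) (thetaSymbol ε V r F) k 0
  simp only [phase_zero_left, one_smul] at h
  have hI : ∫ p, F p = ((∫ p, f r p : ℝ) : ℂ) := by
    rw [← integral_complex_ofReal]; simp_rw [hF]
  rw [integral_const_mul, h, lineDeriv_thetaSymbol hV, centredDiff_zero, ft_zero, hI,
    Complex.real_smul]
  have : (Real.pi : ℂ) ≠ 0 := by exact_mod_cast Real.pi_ne_zero
  have : (ε : ℂ) ≠ 0 := by exact_mod_cast hε
  simp only [smul_zero, add_zero, sub_zero]
  push_cast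
  simp only [smul_eq_mul]
  field_simp
  simp only [Complex.I_sq]
  ring

/-- A second moment is a second derivative at `η = 0`. Only mixed terms survive, as the centred
difference is odd in `η`. -/
theorem integral_coord_coord_mul_thetaOp (hε : ε ≠ 0) (hV : Function.HasTemperateGrowth V)
    (f : Plane → Plane → ℝ) (r : Plane) (F : 𝓢(Plane, ℂ)) (hF : ∀ p, F p = f r p) (k l : Fin 2) :
    Integrable (fun p : Plane => ((p k * p l : ℝ) : ℂ) * thetaOp ε V f r p) ∧
      ∫ p : Plane, ((p k * p l : ℝ) : ℂ) * thetaOp ε V f r p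
        = ((partialR k V r * ∫ p : Plane, p l * f r p : ℝ) : ℂ)
          + ((partialR l V r * ∫ p : Plane, p k * f r p : ℝ) : ℂ) := by
  have he : (fun p : Plane => ((p k * p l : ℝ) : ℂ) * thetaOp ε V f r p) = fun p : Plane =>
      (Complex.I / ε * (((2 * Real.pi) ^ 2 : ℝ) : ℂ)⁻¹) *
        ((p k * p l) • ft (-1) (thetaSymbol ε V r F) p) := by
    ext p
    rw [thetaOp_eq_ft hV f r _ F hF, Complex.real_smul]; ring
  rw [he]
  refine ⟨(integrable_coord_coord_smul_ft (by norm_num) _ k l).const_mul _, ?_⟩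
  have h := integral_phase_coord_coord_smul_ft (c := -1) (by norm_num) (thetaSymbol ε V r F) k l 0
  simp only [phase_zero_left, one_smul] at h
  have hI (j : Fin 2) : (∂_{unitVec j} (ftSchwartz 1 one_ne_zero F) : 𝓢(Plane, ℂ)) 0
      = Complex.I * ((∫ p : Plane, p j * f r p : ℝ) : ℂ) := by
    rw [lineDeriv_ftSchwartz, ft_zero, ← integral_complex_ofReal]
    simp [hF]
  rw [integral_const_mul, h, lineDeriv_lineDeriv_thetaSymbol_zero hV, hI, hI, Complex.real_smul]
  have : (Real.pi : ℂ) ≠ 0 := by exact_mod_cast Real.pi_ne_zero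
  have : (ε : ℂ) ≠ 0 := by exact_mod_cast hε
  push_cast
  simp only [smul_eq_mul]
  field_simp
  have hI4 : Complex.I ^ 4 = 1 := Complex.I_pow_four
  simp only [hI4]
  ring

end Theta

/-! ### Rapidly decreasing functions and differentiation of moments -/

section Rapid

variable {E : Type*} [NormedAddCommGroup E] [NormedSpace ℝ E]

/-- Three is the least integer above the dimension of the plane; hence the exponent 3 in all later
dominations. -/
theorem integrable_inv_pow {k : ℕ} (hk : 3 ≤ k) :
    Integrable fun p : Plane => ((1 + ‖p‖) ^ k)⁻¹ := by
  have h := integrable_one_add_norm (E := Plane) (μ := volume) (r := k)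
    (by simp only [finrank_euclideanSpace, Fintype.card_fin]; norm_cast)
  refine h.congr (Eventually.of_forall fun p => ?_)
  simp only
  rw [Real.rpow_neg (by positivity), Real.rpow_natCast]

/-- Continuous time-dependent phase-space functions that decrease rapidly in `(r,p)`, locally
uniformly in `t > 0`. -/
structure RapidC0 (f : ℝ × Plane × Plane → E) : Prop where
  cont : ContinuousOn f (Ioi 0 ×ˢ univ)
  decay : ∀ a b : ℝ, 0 < a → ∀ k : ℕ, ∃ C : ℝ, ∀ t ∈ Icc a b, ∀ r p : Plane,
    (1 + ‖r‖ + ‖p‖) ^ k * ‖f (t, r, p)‖ ≤ C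

/-- Continuously differentiable time-dependent phase-space functions that decrease rapidly in
`(r,p)` together with their first derivatives, locally uniformly in `t > 0`. -/
structure RapidC1 (f : ℝ × Plane × Plane → E) : Prop where
  diff : ∀ t > 0, ∀ r p, DifferentiableAt ℝ f (t, r, p)
  rapid : RapidC0 f
  rapid_fderiv : RapidC0 (fderiv ℝ f)

theorem RapidC0.le_mul {f : ℝ × Plane × Plane → E} (hf : RapidC0 f) {a : ℝ} (b : ℝ) (ha : 0 < a)
    (k l : ℕ) : ∃ C : ℝ, 0 ≤ C ∧ ∀ t ∈ Icc a b, ∀ r p : Plane,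
      ‖f (t, r, p)‖ ≤ C * (((1 + ‖r‖) ^ k)⁻¹ * ((1 + ‖p‖) ^ l)⁻¹) := by
  obtain ⟨C, hC⟩ := hf.decay a b ha (k + l)
  refine ⟨max C 0, le_max_right _ _, fun t ht r p => ?_⟩
  rw [← mul_inv, ← div_eq_mul_inv, le_div_iff₀ (by positivity), mul_comm]
  refine le_trans ?_ ((hC t ht r p).trans (le_max_left _ _))
  rw [pow_add]
  have h1 : 1 + ‖r‖ ≤ 1 + ‖r‖ + ‖p‖ := by linarith [norm_nonneg p]
  have h2 : 1 + ‖p‖ ≤ 1 + ‖r‖ + ‖p‖ := by linarith [norm_nonneg r]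
  gcongr

theorem RapidC0.continuous_slice {f : ℝ × Plane × Plane → E} (hf : RapidC0 f) {t : ℝ}
    (ht : 0 < t) : Continuous fun z : Plane × Plane => f (t, z.1, z.2) := by
  refine hf.cont.comp_continuous (by fun_prop) fun z => ?_
  simpa using ht

theorem RapidC0.continuous_momentum {f : ℝ × Plane × Plane → E} (hf : RapidC0 f) {t : ℝ}
    (ht : 0 < t) (r : Plane) : Continuous fun p : Plane => f (t, r, p) :=
  (hf.continuous_slice ht).comp (by fun_prop : Continuous fun p : Plane => (r, p))

theorem RapidC0.integrable_momentum {f : ℝ × Plane × Plane → E} (hf : RapidC0 f) {t : ℝ}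
    (ht : 0 < t) (r : Plane) : Integrable fun p : Plane => f (t, r, p) := by
  obtain ⟨C, -, hC⟩ := hf.le_mul t ht 0 3
  refine ((integrable_inv_pow le_rfl).const_mul C).mono'
    (hf.continuous_momentum ht r).aestronglyMeasurable (Eventually.of_forall fun p => ?_)
  simpa using hC t (by simp) r p

/-- The zeroth moment in `p`. -/
def mom (f : ℝ × Plane × Plane → E) (y : ℝ × Plane) : E := ∫ p, f (y.1, y.2, p)

theorem exists_nhds_Icc {t : ℝ} (ht : 0 < t) : Icc (t / 2) (2 * t) ∈ 𝓝 t :=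
  Icc_mem_nhds (by linarith) (by linarith)

theorem RapidC0.continuousOn_mom {f : ℝ × Plane × Plane → E} (hf : RapidC0 f) :
    ContinuousOn (mom f) (Ioi 0 ×ˢ univ) := by
  rintro ⟨t, r⟩ ⟨ht, -⟩
  simp only [mem_Ioi] at ht
  obtain ⟨C, -, hC⟩ := hf.le_mul (2 * t) (half_pos ht) 0 3
  have hn : ∀ᶠ y : ℝ × Plane in 𝓝 (t, r), y.1 ∈ Icc (t / 2) (2 * t) :=
    continuous_fst.continuousAt.eventually (exists_nhds_Icc ht)
  refine ContinuousAt.continuousWithinAt ?_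
  refine continuousAt_of_dominated (bound := fun p => C * ((1 + ‖p‖) ^ 3)⁻¹) ?_ ?_
    ((integrable_inv_pow le_rfl).const_mul C) (Eventually.of_forall fun p => ?_)
  · filter_upwards [hn] with y hy
    exact (hf.continuous_momentum (by linarith [hy.1]) y.2).aestronglyMeasurable
  · filter_upwards [hn] with y hy
    refine Eventually.of_forall fun p => ?_
    simpa using hC y.1 hy y.2 p
  · have h1 : ContinuousAt f (t, r, p) :=
      hf.cont.continuousAt ((isOpen_Ioi.prod isOpen_univ).mem_nhds (by simpa using ht))
    exact ContinuousAt.comp (f := fun y : ℝ × Plane => (y.1, y.2, p)) h1 (by fun_prop)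

/-- The inclusion of `(t,r)`-directions. -/
def inclTR : ℝ × Plane →L[ℝ] ℝ × Plane × Plane :=
  (ContinuousLinearMap.fst ℝ ℝ Plane).prod
    ((ContinuousLinearMap.snd ℝ ℝ Plane).prod (0 : ℝ × Plane →L[ℝ] Plane))

@[simp] theorem inclTR_apply (y : ℝ × Plane) : inclTR y = (y.1, y.2, 0) := rfl

theorem hasFDerivAt_insert (p : Plane) (y : ℝ × Plane) :
    HasFDerivAt (fun y : ℝ × Plane => (y.1, y.2, p)) inclTR y :=
  hasFDerivAt_fst.prodMk (hasFDerivAt_snd.prodMk (hasFDerivAt_const p y))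

theorem RapidC0.comp_clm {F : Type*} [NormedAddCommGroup F] [NormedSpace ℝ F]
    {f : ℝ × Plane × Plane → E} (hf : RapidC0 f) (L : E →L[ℝ] F) : RapidC0 fun z => L (f z) where
  cont := L.continuous.comp_continuousOn hf.cont
  decay a b ha k := by
    obtain ⟨C, hC⟩ := hf.decay a b ha k
    refine ⟨‖L‖ * C, fun t ht r p => ?_⟩
    calc (1 + ‖r‖ + ‖p‖) ^ k * ‖L (f (t, r, p))‖
        ≤ (1 + ‖r‖ + ‖p‖) ^ k * (‖L‖ * ‖f (t, r, p)‖) := by gcongr; exact L.le_opNorm _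
      _ = ‖L‖ * ((1 + ‖r‖ + ‖p‖) ^ k * ‖f (t, r, p)‖) := by ring
      _ ≤ ‖L‖ * C := by gcongr; exact hC t ht r p

/-- Differentiation under the integral, dominated on the time window `[t/2, 2t]`, which stays away
from `t = 0`. -/
theorem RapidC1.hasFDerivAt_mom [CompleteSpace E] {f : ℝ × Plane × Plane → E} (hf : RapidC1 f)
    {t : ℝ} (ht : 0 < t) (r : Plane) :
    HasFDerivAt (mom f) (mom (fun z => (fderiv ℝ f z).comp inclTR) (t, r)) (t, r) := by
  have hD : RapidC0 fun z => (fderiv ℝ f z).comp inclTR :=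
    hf.rapid_fderiv.comp_clm ((ContinuousLinearMap.compL ℝ (ℝ × Plane) (ℝ × Plane × Plane) E).flip
      inclTR)
  obtain ⟨C, -, hC⟩ := hD.le_mul (2 * t) (half_pos ht) 0 3
  have hmem : {y : ℝ × Plane | y.1 ∈ Icc (t / 2) (2 * t)} ∈ 𝓝 (t, r) :=
    continuous_fst.continuousAt.eventually (exists_nhds_Icc ht)
  refine hasFDerivAt_integral_of_dominated_of_fderiv_le
    (F := fun (y : ℝ × Plane) p => f (y.1, y.2, p))
    (F' := fun y p => (fderiv ℝ f (y.1, y.2, p)).comp inclTR)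
    (bound := fun p => C * ((1 + ‖p‖) ^ 3)⁻¹) hmem ?_
    (hf.rapid.integrable_momentum ht r)
    (hD.continuous_momentum ht r).aestronglyMeasurable
    (Eventually.of_forall fun p y hy => ?_) ((integrable_inv_pow le_rfl).const_mul C)
    (Eventually.of_forall fun p y hy => ?_)
  · filter_upwards [hmem] with y hy
    exact (hf.rapid.continuous_momentum (by linarith [hy.1]) y.2).aestronglyMeasurable
  · simpa using hC y.1 hy y.2 p
  · exact (hf.diff y.1 (by linarith [hy.1]) y.2 p).hasFDerivAt.comp y (hasFDerivAt_insert p y)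

theorem RapidC0.add {f g : ℝ × Plane × Plane → E} (hf : RapidC0 f) (hg : RapidC0 g) :
    RapidC0 fun z => f z + g z where
  cont := hf.cont.add hg.cont
  decay a b ha k := by
    obtain ⟨C, hC⟩ := hf.decay a b ha k
    obtain ⟨D, hD⟩ := hg.decay a b ha k
    refine ⟨C + D, fun t ht r p => ?_⟩
    calc (1 + ‖r‖ + ‖p‖) ^ k * ‖f (t, r, p) + g (t, r, p)‖
        ≤ (1 + ‖r‖ + ‖p‖) ^ k * (‖f (t, r, p)‖ + ‖g (t, r, p)‖) := by gcongr; exact norm_add_le _ _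
      _ ≤ C + D := by rw [mul_add]; exact add_le_add (hC t ht r p) (hD t ht r p)

theorem RapidC0.coord_smul {f : ℝ × Plane × Plane → E} (hf : RapidC0 f) (k : Fin 2) :
    RapidC0 fun z => z.2.2 k • f z where
  cont := (by fun_prop : Continuous fun z : ℝ × Plane × Plane => z.2.2 k).continuousOn.smul hf.cont
  decay a b ha j := by
    obtain ⟨C, hC⟩ := hf.decay a b ha (j + 1)
    refine ⟨C, fun t ht r p => le_trans ?_ (hC t ht r p)⟩
    have h1 : |p k| ≤ 1 + ‖r‖ + ‖p‖ := by
      linarith [abs_coord_le p k, norm_nonneg r]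
    rw [norm_smul, Real.norm_eq_abs, pow_succ, mul_assoc]
    gcongr

theorem RapidC0.congr {f g : ℝ × Plane × Plane → E} (hf : RapidC0 f)
    (h : ∀ t > 0, ∀ r p, g (t, r, p) = f (t, r, p)) : RapidC0 g where
  cont := hf.cont.congr fun z hz => h z.1 hz.1 z.2.1 z.2.2
  decay a b ha k := by
    obtain ⟨C, hC⟩ := hf.decay a b ha k
    exact ⟨C, fun t ht r p => by rw [h t (by linarith [ht.1])]; exact hC t ht r p⟩

/-- The momentum coordinate `p_k` as a functional on `(t,r,p)`. -/
def coordCLM (k : Fin 2) : ℝ × Plane × Plane →L[ℝ] ℝ :=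
  (EuclideanSpace.proj k : Plane →L[ℝ] ℝ).comp
    ((ContinuousLinearMap.snd ℝ Plane Plane).comp (ContinuousLinearMap.snd ℝ ℝ (Plane × Plane)))

@[simp] theorem coordCLM_apply (k : Fin 2) (z : ℝ × Plane × Plane) : coordCLM k z = z.2.2 k := rfl

theorem RapidC1.coord_mul {f : ℝ × Plane × Plane → ℝ} (hf : RapidC1 f) (k : Fin 2) :
    RapidC1 fun z => z.2.2 k * f z := by
  have hd (t : ℝ) (ht : 0 < t) (r p : Plane) : HasFDerivAt (fun z : ℝ × Plane × Plane => z.2.2 k * f z)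
      (p k • fderiv ℝ f (t, r, p) + f (t, r, p) • coordCLM k) (t, r, p) :=
    (coordCLM k).hasFDerivAt.mul (hf.diff t ht r p).hasFDerivAt
  refine ⟨fun t ht r p => (hd t ht r p).differentiableAt, hf.rapid.coord_smul k, ?_⟩
  refine ((hf.rapid_fderiv.coord_smul k).add (hf.rapid.comp_clm
    (ContinuousLinearMap.smulRight (1 : ℝ →L[ℝ] ℝ) (coordCLM k)))).congr fun t ht r p => ?_
  rw [(hd t ht r p).fderiv]
  simp

theorem IsRegular.rapidC1 {w : ℝ → PauliField} (hw : IsRegular w) (s : Fin 4) :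
    RapidC1 fun z : ℝ × Plane × Plane => w z.1 z.2.1 z.2.2 s := by
  set W : ℝ × Plane × Plane → Fin 4 → ℝ := fun z => w z.1 z.2.1 z.2.2 with hW
  have hopen : IsOpen (Ioi (0 : ℝ) ×ˢ (univ : Set (Plane × Plane))) := isOpen_Ioi.prod isOpen_univ
  have hc (t : ℝ) (ht : 0 < t) (r p : Plane) : ContDiffAt ℝ ∞ W (t, r, p) :=
    hw.smooth.contDiffAt (hopen.mem_nhds (by simpa using ht))
  have h0 : RapidC0 W := ⟨hw.smooth.continuousOn, fun a b ha k => by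
    simpa using hw.decay a b ha k 0⟩
  have h1 : RapidC0 (fderiv ℝ W) := by
    refine ⟨hw.smooth.continuousOn_fderiv_of_isOpen hopen (by simp), fun a b ha k => ?_⟩
    obtain ⟨C, hC⟩ := hw.decay a b ha k 1
    refine ⟨C, fun t ht r p => ?_⟩
    rw [← norm_iteratedFDeriv_one]
    exact hC t ht r p
  have hd (t : ℝ) (ht : 0 < t) (r p : Plane) :
      HasFDerivAt (fun z : ℝ × Plane × Plane => w z.1 z.2.1 z.2.2 s)
        ((ContinuousLinearMap.proj s).comp (fderiv ℝ W (t, r, p))) (t, r, p) :=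
    (ContinuousLinearMap.proj (R := ℝ) (φ := fun _ : Fin 4 => ℝ) s).hasFDerivAt.comp (t, r, p)
      ((hc t ht r p).differentiableAt (by simp)).hasFDerivAt
  refine ⟨fun t ht r p => (hd t ht r p).differentiableAt,
    h0.comp_clm (ContinuousLinearMap.proj (R := ℝ) (φ := fun _ : Fin 4 => ℝ) s), ?_⟩
  refine (h1.comp_clm (ContinuousLinearMap.compL ℝ (ℝ × Plane × Plane) (Fin 4 → ℝ) ℝ
    (ContinuousLinearMap.proj s))).congr fun t ht r p => ?_
  rw [(hd t ht r p).fderiv]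
  rfl

end Rapid

/-! ### Time slices as Schwartz functions -/

section Slices

theorem IsRegular.contDiff_slice {w : ℝ → PauliField} (hw : IsRegular w) {t : ℝ} (ht : 0 < t) :
    ContDiff ℝ ∞ fun z : Plane × Plane => w t z.1 z.2 := by
  have h1 : ContDiffOn ℝ ∞ (fun z : Plane × Plane => ((t, z.1, z.2) : ℝ × Plane × Plane)) univ :=
    (contDiff_const.prodMk (contDiff_fst.prodMk contDiff_snd)).contDiffOn
  exact contDiffOn_univ.1 (ContDiffOn.comp hw.smooth h1 (fun z _ => ⟨ht, mem_univ _⟩))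

theorem IsRegular.slice_decay {w : ℝ → PauliField} (hw : IsRegular w) {t : ℝ} (ht : 0 < t)
    (k l : ℕ) : ∃ C : ℝ, ∀ z : Plane × Plane,
      ‖z‖ ^ k * ‖iteratedFDeriv ℝ l (fun z : Plane × Plane => w t z.1 z.2) z‖ ≤ C := by
  obtain ⟨C, hC⟩ := hw.decay t t ht k l
  set W : ℝ × Plane × Plane → Fin 4 → ℝ := fun z => w z.1 z.2.1 z.2.2 with hW
  set L : Plane × Plane →L[ℝ] ℝ × Plane × Plane := ContinuousLinearMap.inr ℝ ℝ (Plane × Plane)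
  -- Translating by `(t,0,0)` makes the inclusion of the slice linear, so that iterated derivatives
  -- can be pulled back along it. Smoothness is known only for positive times, hence the derivatives
  -- within `S`.
  set S : Set (ℝ × Plane × Plane) := (fun z => z + (t, 0, 0)) ⁻¹' (Ioi 0 ×ˢ univ)
  have hS : IsOpen S := (isOpen_Ioi.prod isOpen_univ).preimage (by fun_prop)
  have hcd : ContDiffOn ℝ ∞ (fun z => W (z + (t, 0, 0))) S :=
    hw.smooth.comp (contDiff_id.add contDiff_const).contDiffOn (fun z hz => hz)
  have hLS : L ⁻¹' S = univ := by
    ext z; simpa [S, L] using ht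
  refine ⟨C * ‖L‖ ^ l, fun z => ?_⟩
  have hz : L z ∈ S := by
    have : z ∈ L ⁻¹' S := by rw [hLS]; trivial
    exact this
  have h1 := L.iteratedFDerivWithin_comp_right hcd hS.uniqueDiffOn
    (by rw [hLS]; exact uniqueDiffOn_univ) hz (i := l) (by exact_mod_cast le_top)
  rw [hLS, iteratedFDerivWithin_univ, iteratedFDerivWithin_of_isOpen l hS hz,
    iteratedFDeriv_comp_add_right] at h1
  have h2 : ((fun z => W (z + (t, 0, 0))) ∘ L) = fun z : Plane × Plane => w t z.1 z.2 := by
    ext z; simp [hW, L]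
  rw [h2] at h1
  rw [h1]
  have h3 : L z + (t, 0, 0) = (t, z.1, z.2) := by simp [L]
  rw [h3]
  have h4 := hC t (by simp) z.1 z.2
  have h5 : ‖z‖ ≤ 1 + ‖z.1‖ + ‖z.2‖ := by
    rw [Prod.norm_def]
    exact max_le (by linarith [norm_nonneg z.2]) (by linarith [norm_nonneg z.1])
  calc _ ≤ (1 + ‖z.1‖ + ‖z.2‖) ^ k * (‖iteratedFDeriv ℝ l W (t, z.1, z.2)‖ * ∏ _i : Fin l, ‖L‖) := by
        gcongr
        exact ContinuousMultilinearMap.norm_compContinuousLinearMap_le _ _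
    _ = ((1 + ‖z.1‖ + ‖z.2‖) ^ k * ‖iteratedFDeriv ℝ l W (t, z.1, z.2)‖) * ‖L‖ ^ l := by
        simp; ring
    _ ≤ C * ‖L‖ ^ l := by gcongr

/-- A time slice of a regular field, as a Schwartz function. -/
def IsRegular.slice {w : ℝ → PauliField} (hw : IsRegular w) {t : ℝ} (ht : 0 < t) :
    𝓢(Plane × Plane, Fin 4 → ℝ) where
  toFun z := w t z.1 z.2
  smooth' := hw.contDiff_slice ht
  decay' := hw.slice_decay ht

theorem temperate_pair (r : Plane) : Function.HasTemperateGrowth fun p : Plane => (r, p) := by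
  have h : (fun p : Plane => (r, p)) = (fun _ => (r, (0 : Plane))) + fun p : Plane =>
      ContinuousLinearMap.inr ℝ Plane Plane p := by
    ext p <;> simp
  rw [h]
  exact (Function.HasTemperateGrowth.const _).add (ContinuousLinearMap.hasTemperateGrowth _)

/-- Restriction of a Schwartz function on phase space to a given position. -/
def restrictFst {E : Type*} [NormedAddCommGroup E] [NormedSpace ℝ E] (r : Plane)
    (f : 𝓢(Plane × Plane, E)) : 𝓢(Plane, E) :=
  SchwartzMap.compCLM ℝ (temperate_pair r) ⟨1, 1, fun p => by
    rw [Prod.norm_def]; simp only [pow_one, one_mul]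
    linarith [le_max_right ‖r‖ ‖p‖]⟩ f

@[simp] theorem restrictFst_apply {E : Type*} [NormedAddCommGroup E] [NormedSpace ℝ E] (r : Plane)
    (f : 𝓢(Plane × Plane, E)) (p : Plane) : restrictFst r f p = f (r, p) := rfl

/-- The `s`-th Pauli component of a Schwartz field, with complex values. -/
def complexComp {D : Type*} [NormedAddCommGroup D] [NormedSpace ℝ D] (f : 𝓢(D, Fin 4 → ℝ))
    (s : Fin 4) : 𝓢(D, ℂ) :=
  SchwartzMap.postcompCLM (𝕜 := ℝ)
    (Complex.ofRealCLM.comp (ContinuousLinearMap.proj (R := ℝ) (φ := fun _ : Fin 4 => ℝ) s)) f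

@[simp] theorem complexComp_apply {D : Type*} [NormedAddCommGroup D] [NormedSpace ℝ D]
    (f : 𝓢(D, Fin 4 → ℝ)) (s : Fin 4) (x : D) : complexComp f s x = (f x s : ℂ) := rfl

end Slices

/-! ### Moments against monomials in the momentum -/

section Moments

/-- The monomial `p_{i₁} ⋯ p_{iₙ}` in the momentum. -/
def mono (l : List (Fin 2)) (p : Plane) : ℝ := (l.map fun i => p i).prod

@[simp] theorem mono_nil (p : Plane) : mono [] p = 1 := rfl

@[simp] theorem mono_cons (i : Fin 2) (l : List (Fin 2)) (p : Plane) :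
    mono (i :: l) p = p i * mono l p := by simp [mono]

theorem abs_mono_le (l : List (Fin 2)) (p : Plane) : |mono l p| ≤ (1 + ‖p‖) ^ l.length := by
  induction l with
  | nil => simp
  | cons i l ih =>
    rw [mono_cons, abs_mul, List.length_cons, pow_succ']
    have := abs_coord_le p i
    gcongr
    linarith

theorem continuous_mono (l : List (Fin 2)) : Continuous (mono l) := by
  induction l with
  | nil => exact continuous_const
  | cons i l ih =>
    have : mono (i :: l) = fun p => p i * mono l p := by ext p; simp
    rw [this]; fun_prop

theorem RapidC1.mono_mul {f : ℝ × Plane × Plane → ℝ} (hf : RapidC1 f) (l : List (Fin 2)) :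
    RapidC1 fun z => mono l z.2.2 * f z := by
  induction l with
  | nil => simpa using hf
  | cons i l ih => simpa [mul_assoc] using ih.coord_mul i

theorem RapidC0.mono_mul {f : ℝ × Plane × Plane → ℝ} (hf : RapidC0 f) (l : List (Fin 2)) :
    RapidC0 fun z => mono l z.2.2 * f z := by
  induction l with
  | nil => simpa using hf
  | cons i l ih => simpa [mul_assoc] using ih.coord_smul i

/-- The moment `∫ p_{i₁} ⋯ p_{iₙ} f dp`. -/
def monoMom (l : List (Fin 2)) (f : ℝ × Plane × Plane → ℝ) : ℝ × Plane → ℝ :=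
  mom fun z => mono l z.2.2 * f z

theorem monoMom_apply (l : List (Fin 2)) (f : ℝ × Plane × Plane → ℝ) (t : ℝ) (r : Plane) :
    monoMom l f (t, r) = ∫ p, mono l p * f (t, r, p) := rfl

theorem RapidC1.differentiableAt_monoMom {f : ℝ × Plane × Plane → ℝ} (hf : RapidC1 f)
    (l : List (Fin 2)) {t : ℝ} (ht : 0 < t) (r : Plane) :
    DifferentiableAt ℝ (monoMom l f) (t, r) :=
  ((hf.mono_mul l).hasFDerivAt_mom ht r).differentiableAt

theorem RapidC1.hasFDerivAt_insert {f : ℝ × Plane × Plane → ℝ} (hf : RapidC1 f) {t : ℝ}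
    (ht : 0 < t) (r p : Plane) :
    HasFDerivAt (fun y : ℝ × Plane => f (y.1, y.2, p)) ((fderiv ℝ f (t, r, p)).comp inclTR) (t, r) :=
  (hf.diff t ht r p).hasFDerivAt.comp (t, r) (Graphene.hasFDerivAt_insert p (t, r))

/-- The directions `inclTR v` leave `p` fixed, so the monomial behaves as a constant. -/
theorem RapidC1.fderiv_mono_mul {f : ℝ × Plane × Plane → ℝ} (hf : RapidC1 f) (l : List (Fin 2))
    {t : ℝ} (ht : 0 < t) (r p : Plane) (v : ℝ × Plane) :
    fderiv ℝ (fun z : ℝ × Plane × Plane => mono l z.2.2 * f z) (t, r, p) (inclTR v)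
      = mono l p * fderiv ℝ f (t, r, p) (inclTR v) := by
  have h1 := (hf.mono_mul l).hasFDerivAt_insert ht r p
  have h2 := (hf.hasFDerivAt_insert ht r p).const_mul (mono l p)
  have h3 := congrArg (fun L => L v) (h1.unique h2)
  simpa using h3

theorem RapidC1.rapid_fderiv_apply {f : ℝ × Plane × Plane → ℝ} (hf : RapidC1 f)
    (v : ℝ × Plane × Plane) : RapidC0 fun z => fderiv ℝ f z v :=
  hf.rapid_fderiv.comp_clm (ContinuousLinearMap.apply ℝ ℝ v)

theorem RapidC1.fderiv_monoMom {f : ℝ × Plane × Plane → ℝ} (hf : RapidC1 f) (l : List (Fin 2))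
    {t : ℝ} (ht : 0 < t) (r : Plane) (v : ℝ × Plane) :
    fderiv ℝ (monoMom l f) (t, r) v = monoMom l (fun z => fderiv ℝ f z (inclTR v)) (t, r) := by
  have hD : RapidC0 fun z => (fderiv ℝ (fun z : ℝ × Plane × Plane => mono l z.2.2 * f z) z).comp
      inclTR :=
    (hf.mono_mul l).rapid_fderiv.comp_clm
      ((ContinuousLinearMap.compL ℝ (ℝ × Plane) (ℝ × Plane × Plane) ℝ).flip inclTR)
  rw [monoMom, ((hf.mono_mul l).hasFDerivAt_mom ht r).fderiv, mom,
    ContinuousLinearMap.integral_apply (hD.integrable_momentum ht r)]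
  simp only [ContinuousLinearMap.comp_apply]
  simp_rw [hf.fderiv_mono_mul l ht]
  rfl

end Moments

/-! ### The Wigner system in uniform component form -/

section Balance

/-- The `s`-th Pauli component as a function of `(t,r,p)`. -/
def field (w : ℝ → PauliField) (s : Fin 4) : ℝ × Plane × Plane → ℝ :=
  fun z => w z.1 z.2.1 z.2.2 s

/-- The coefficients of the gradient coupling of the Pauli components. -/
def gradCoef : Fin 4 → Fin 2 → Fin 4 → ℝ :=
  ![![![0, 1, 0, 0], ![0, 0, 1, 0]], ![![1, 0, 0, 0], 0], ![0, ![1, 0, 0, 0]], 0]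

/-- The coefficients of the spin precession `w⃗ ∧ p⃗`. -/
def spinCoef : Fin 4 → Fin 2 → Fin 4 → ℝ :=
  ![0, ![0, ![0, 0, 0, -1]], ![![0, 0, 0, 1], 0], ![![0, 0, -1, 0], ![0, 1, 0, 0]]]

/-- The direction `∂/∂t` in `(t,r)`-space. -/
def dirT : ℝ × Plane := (1, 0)

/-- The direction `∂/∂r_k` in `(t,r)`-space. -/
def dirR (k : Fin 2) : ℝ × Plane := (0, unitVec k)

theorem deriv_eq_fderiv_dirT {f : ℝ × Plane → ℝ} {t : ℝ} {r : Plane}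
    (hf : DifferentiableAt ℝ f (t, r)) : deriv (fun t' => f (t', r)) t = fderiv ℝ f (t, r) dirT := by
  have h : HasDerivAt (fun t' : ℝ => (t', r)) (1, 0) t :=
    (hasDerivAt_id t).prodMk (hasDerivAt_const t r)
  exact (hf.hasFDerivAt.comp_hasDerivAt t h).deriv

theorem partialR_eq_fderiv_dirR {f : ℝ × Plane → ℝ} {t : ℝ} {r : Plane}
    (hf : DifferentiableAt ℝ f (t, r)) (k : Fin 2) :
    partialR k (fun r' => f (t, r')) r = fderiv ℝ f (t, r) (dirR k) := by
  have h : HasFDerivAt (fun r' : Plane => (t, r')) (ContinuousLinearMap.inr ℝ ℝ Plane) r :=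
    hasFDerivAt_prodMk_right t r
  have h2 : HasFDerivAt (fun r' => f (t, r')) _ r := hf.hasFDerivAt.comp r h
  rw [partialR, h2.fderiv]
  rfl

theorem RapidC1.deriv_eq {f : ℝ × Plane × Plane → ℝ} (hf : RapidC1 f) {t : ℝ} (ht : 0 < t)
    (r p : Plane) : deriv (fun t' => f (t', r, p)) t = fderiv ℝ f (t, r, p) (inclTR dirT) := by
  have h := hf.hasFDerivAt_insert ht r p
  rw [deriv_eq_fderiv_dirT (f := fun y : ℝ × Plane => f (y.1, y.2, p)) h.differentiableAt, h.fderiv]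
  rfl

theorem RapidC1.partialR_eq {f : ℝ × Plane × Plane → ℝ} (hf : RapidC1 f) {t : ℝ} (ht : 0 < t)
    (r p : Plane) (k : Fin 2) :
    partialR k (fun r' => f (t, r', p)) r = fderiv ℝ f (t, r, p) (inclTR (dirR k)) := by
  have h := hf.hasFDerivAt_insert ht r p
  rw [partialR_eq_fderiv_dirR (f := fun y : ℝ × Plane => f (y.1, y.2, p)) h.differentiableAt,
    h.fderiv]
  rfl

variable {ε γ τ : ℝ} {V : Plane → ℝ} {w g : ℝ → PauliField}

/-- The free transport part of the Wigner equation for the `s`-th Pauli component. -/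
def transportTerm (ε γ : ℝ) (f : Fin 4 → ℝ × Plane × Plane → ℝ) (s : Fin 4)
    (z : ℝ × Plane × Plane) : ℝ :=
  fderiv ℝ (f s) z (inclTR dirT)
    + (∑ k, z.2.2 k * fderiv ℝ (f s) z (inclTR (dirR k))) / (2 * γ)
    + ε / 2 * (∑ k, ∑ s', gradCoef s k s' * fderiv ℝ (f s') z (inclTR (dirR k)))
    + ∑ k, ∑ s', spinCoef s k s' * (z.2.2 k * f s' z)

/-- With the coefficient tables `gradCoef` and `spinCoef` the scalar and the vector equations become
one equation indexed by `s : Fin 4`, so that everything later is proved once. -/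
theorem SolvesWignerBGK.thetaOp_eq (hsol : SolvesWignerBGK ε γ τ V w g) (hw : IsRegular w)
    (s : Fin 4) {t : ℝ} (ht : 0 < t) (r p : Plane) :
    thetaOp ε V (fun r' p' => w t r' p' s) r p
      = (((g t r p s - w t r p s) / τ - transportTerm ε γ (field w) s (t, r, p) : ℝ) : ℂ) := by
  have hd (s : Fin 4) : deriv (fun t' => w t' r p s) t
      = fderiv ℝ (field w s) (t, r, p) (inclTR dirT) := (hw.rapidC1 s).deriv_eq ht r p
  have hp (s : Fin 4) (k : Fin 2) : partialR k (fun r' => w t r' p s) r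
      = fderiv ℝ (field w s) (t, r, p) (inclTR (dirR k)) := (hw.rapidC1 s).partialR_eq ht r p k
  have hv (s : Fin 4) : field w s (t, r, p) = w t r p s := rfl
  have h0 := hsol.scalar_eq t ht r p
  have h1 := hsol.vector_eq t ht r p
  rw [Complex.ofReal_sub, eq_sub_iff_add_eq, add_comm]
  refine Fin.cases ?_ (fun j => ?_) s
  · rw [← h0]
    simp only [transportTerm, hd, hp, div3, vec]
    congr 2
    simp [gradCoef, spinCoef, Fin.sum_univ_succ]
  · have h1j := h1 j
    simp only [vec] at h1j
    rw [← h1j]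
    congr 2
    simp only [transportTerm, hd, hp, hv, grad3]
    fin_cases j
    all_goals simp [gradCoef, spinCoef, Fin.sum_univ_succ, crossProduct, vec3, vec]
    all_goals ring

end Balance

/-! ### Moment equations of order at most two -/

section MomentEquation

theorem RapidC0.const_mul {f : ℝ × Plane × Plane → ℝ} (hf : RapidC0 f) (c : ℝ) :
    RapidC0 fun z => c * f z := by
  simpa using hf.comp_clm (ContinuousLinearMap.mul ℝ ℝ c)

theorem RapidC0.zero : RapidC0 (fun _ : ℝ × Plane × Plane => (0 : ℝ)) :=
  ⟨continuousOn_const, fun a b _ k => ⟨0, by simp⟩⟩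

theorem RapidC0.sum {ι : Type*} (S : Finset ι) {f : ι → ℝ × Plane × Plane → ℝ}
    (hf : ∀ i ∈ S, RapidC0 (f i)) : RapidC0 fun z => ∑ i ∈ S, f i z := by
  classical
  induction S using Finset.induction_on with
  | empty => simpa using RapidC0.zero
  | insert i S hi ih =>
    simp only [Finset.sum_insert hi]
    exact (hf i (by simp)).add (ih fun j hj => hf j (by simp [hj]))

variable {t : ℝ} {r : Plane} {l : List (Fin 2)}

theorem monoMom_add {f g : ℝ × Plane × Plane → ℝ} (hf : RapidC0 f) (hg : RapidC0 g) (ht : 0 < t) :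
    monoMom l (fun z => f z + g z) (t, r) = monoMom l f (t, r) + monoMom l g (t, r) := by
  simp only [monoMom_apply, mul_add]
  exact integral_add ((hf.mono_mul l).integrable_momentum ht r)
    ((hg.mono_mul l).integrable_momentum ht r)

theorem monoMom_const_mul (c : ℝ) (f : ℝ × Plane × Plane → ℝ) :
    monoMom l (fun z => c * f z) (t, r) = c * monoMom l f (t, r) := by
  simp only [monoMom_apply, ← integral_const_mul]
  congr 1; ext p; ring

theorem monoMom_coord_mul (k : Fin 2) (f : ℝ × Plane × Plane → ℝ) :
    monoMom l (fun z => z.2.2 k * f z) (t, r) = monoMom (k :: l) f (t, r) := by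
  simp only [monoMom_apply, mono_cons]
  congr 1; ext p; ring

theorem monoMom_sum {ι : Type*} (S : Finset ι) {f : ι → ℝ × Plane × Plane → ℝ}
    (hf : ∀ i ∈ S, RapidC0 (f i)) (ht : 0 < t) :
    monoMom l (fun z => ∑ i ∈ S, f i z) (t, r) = ∑ i ∈ S, monoMom l (f i) (t, r) := by
  simp only [monoMom_apply, Finset.mul_sum]
  exact integral_finsetSum S fun i hi => ((hf i hi).mono_mul l).integrable_momentum ht r

/-- The moments of the free transport part. -/
def momentBalance (ε γ : ℝ) (f : Fin 4 → ℝ × Plane × Plane → ℝ) (l : List (Fin 2)) (s : Fin 4)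
    (y : ℝ × Plane) : ℝ :=
  fderiv ℝ (monoMom l (f s)) y dirT
    + (∑ k, fderiv ℝ (monoMom (k :: l) (f s)) y (dirR k)) / (2 * γ)
    + ε / 2 * (∑ k, ∑ s', gradCoef s k s' * fderiv ℝ (monoMom l (f s')) y (dirR k))
    + ∑ k, ∑ s', spinCoef s k s' * monoMom (k :: l) (f s') y

theorem rapidC0_transportTerm {f : Fin 4 → ℝ × Plane × Plane → ℝ} (hf : ∀ s, RapidC1 (f s))
    (ε γ : ℝ) (s : Fin 4) : RapidC0 (transportTerm ε γ f s) := by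
  refine (((hf s).rapid_fderiv_apply _).add ?_ |>.add ?_).add ?_
  · simp only [div_eq_inv_mul]
    exact (RapidC0.sum _ fun k _ => ((hf s).rapid_fderiv_apply _).coord_smul k).const_mul _
  · exact (RapidC0.sum _ fun k _ => RapidC0.sum _ fun s' _ =>
      ((hf s').rapid_fderiv_apply _).const_mul _).const_mul _
  · exact RapidC0.sum _ fun k _ => RapidC0.sum _ fun s' _ =>
      ((hf s').rapid.coord_smul k).const_mul _

/-- Derivatives in `t` and `r` commute with the `p`-integral, and each factor `p_k` lengthens the
monomial by one index; the hierarchy of moments is therefore not closed. -/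
theorem monoMom_transportTerm {f : Fin 4 → ℝ × Plane × Plane → ℝ} (hf : ∀ s, RapidC1 (f s))
    (ε γ : ℝ) (s : Fin 4) (ht : 0 < t) :
    monoMom l (transportTerm ε γ f s) (t, r) = momentBalance ε γ f l s (t, r) := by
  have h1 : RapidC0 fun z => fderiv ℝ (f s) z (inclTR dirT) := (hf s).rapid_fderiv_apply _
  have h2 (k : Fin 2) : RapidC0 fun z : ℝ × Plane × Plane =>
      z.2.2 k * fderiv ℝ (f s) z (inclTR (dirR k)) :=
    ((hf s).rapid_fderiv_apply _).coord_smul k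
  have h3 (k : Fin 2) (s' : Fin 4) : RapidC0 fun z =>
      gradCoef s k s' * fderiv ℝ (f s') z (inclTR (dirR k)) :=
    ((hf s').rapid_fderiv_apply _).const_mul _
  have h4 (k : Fin 2) (s' : Fin 4) : RapidC0 fun z : ℝ × Plane × Plane =>
      spinCoef s k s' * (z.2.2 k * f s' z) := ((hf s').rapid.coord_smul k).const_mul _
  have h2' := (RapidC0.sum Finset.univ fun k _ => h2 k).const_mul (2 * γ)⁻¹
  have h3' := (RapidC0.sum Finset.univ fun k _ => RapidC0.sum Finset.univ fun s' _ =>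
    h3 k s').const_mul (ε / 2)
  have h4' := RapidC0.sum Finset.univ fun k _ => RapidC0.sum Finset.univ fun s' _ => h4 k s'
  have key : transportTerm ε γ f s = fun z => fderiv ℝ (f s) z (inclTR dirT)
      + (2 * γ)⁻¹ * (∑ k, z.2.2 k * fderiv ℝ (f s) z (inclTR (dirR k)))
      + ε / 2 * (∑ k, ∑ s', gradCoef s k s' * fderiv ℝ (f s') z (inclTR (dirR k)))
      + ∑ k, ∑ s', spinCoef s k s' * (z.2.2 k * f s' z) := by
    ext z; rw [transportTerm, div_eq_inv_mul]
  rw [key, monoMom_add ((h1.add h2').add h3') h4' ht, monoMom_add (h1.add h2') h3' ht,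
    monoMom_add h1 h2' ht, monoMom_const_mul, monoMom_const_mul,
    monoMom_sum _ (fun k _ => h2 k) ht, monoMom_sum _ (fun k _ => RapidC0.sum Finset.univ fun s' _ =>
    h3 k s') ht, monoMom_sum _ (fun k _ => RapidC0.sum Finset.univ fun s' _ => h4 k s') ht]
  simp only [monoMom_sum _ (fun s' _ => h3 _ s') ht, monoMom_sum _ (fun s' _ => h4 _ s') ht,
    monoMom_const_mul, monoMom_coord_mul]
  simp only [momentBalance, (hf _).fderiv_monoMom _ ht, div_eq_inv_mul]

/-- The moments of `Θ_ε[V] f` of order at most two. -/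
def potentialTerm (V : Plane → ℝ) (M : List (Fin 2) → ℝ) (r : Plane) : List (Fin 2) → ℝ
  | [] => 0
  | [i] => partialR i V r * M []
  | [i, j] => partialR i V r * M [j] + partialR j V r * M [i]
  | _ => 0

variable {ε γ τ : ℝ} {V : Plane → ℝ} {w g : ℝ → PauliField}

theorem IsRegular.integral_mono_mul_thetaOp (hε : ε ≠ 0) (hV : Function.HasTemperateGrowth V)
    (hw : IsRegular w) (ht : 0 < t) (s : Fin 4) (hl : l.length ≤ 2) :
    ∫ p : Plane, (mono l p : ℂ) * thetaOp ε V (fun r' p' => w t r' p' s) r p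
      = ((potentialTerm V (fun l => monoMom l (field w s) (t, r)) r l : ℝ) : ℂ) := by
  have hF (p : Plane) : restrictFst r (complexComp (hw.slice ht) s) p = ((w t r p s : ℝ) : ℂ) := rfl
  match l, hl with
  | [], _ => simpa [potentialTerm] using (integral_thetaOp (ε := ε) hV _ r _ hF).2
  | [i], _ =>
    simpa [potentialTerm, monoMom_apply, field] using
      (integral_coord_mul_thetaOp (ε := ε) hε hV _ r _ hF i).2
  | [i, j], _ =>
    simpa [potentialTerm, monoMom_apply, field] using
      (integral_coord_coord_mul_thetaOp (ε := ε) hε hV _ r _ hF i j).2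

theorem IsRegular.rapidC1_field (hw : IsRegular w) (s : Fin 4) : RapidC1 (field w s) :=
  hw.rapidC1 s

theorem SolvesWignerBGK.momentBalance_eq (hε : ε ≠ 0) (hV : Function.HasTemperateGrowth V)
    (hsol : SolvesWignerBGK ε γ τ V w g) (hw : IsRegular w) (hg : IsRegular g) (s : Fin 4)
    (ht : 0 < t) (hl : l.length ≤ 2) :
    momentBalance ε γ (field w) l s (t, r)
        + potentialTerm V (fun l => monoMom l (field w s) (t, r)) r l
      = τ⁻¹ * (monoMom l (field g s) (t, r) - monoMom l (field w s) (t, r)) := by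
  have h := hw.integral_mono_mul_thetaOp (r := r) hε hV ht s hl
  -- The Wigner equation expresses the complex quantity `Θ_ε[V] w_s` by real ones, so its moments
  -- may be compared as real numbers.
  simp_rw [hsol.thetaOp_eq hw s ht r, ← Complex.ofReal_mul] at h
  rw [integral_complex_ofReal, Complex.ofReal_inj] at h
  have hT := rapidC0_transportTerm hw.rapidC1_field ε γ s
  have hgs := (hg.rapidC1_field s).rapid
  have hws := (hw.rapidC1_field s).rapid
  rw [← h, ← monoMom_transportTerm hw.rapidC1_field ε γ s ht, monoMom_apply, monoMom_apply,
    monoMom_apply, ← integral_sub, ← integral_const_mul, ← integral_add]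
  · congr 1; ext p; simp only [field]; ring
  · exact (hT.mono_mul l).integrable_momentum ht r
  · have h1 := ((hgs.add (hws.const_mul (-1))).const_mul τ⁻¹).add (hT.const_mul (-1))
    refine ((h1.mono_mul l).integrable_momentum ht r).congr (Eventually.of_forall fun p => ?_)
    simp only [field]; ring
  · exact (hgs.mono_mul l).integrable_momentum ht r
  · exact (hws.mono_mul l).integrable_momentum ht r

end MomentEquation

/-! ### Moment equations tested in position -/

section WeakForm

/-- Test functions of the position. -/
structure IsTest (χ : Plane → ℝ) : Prop where
  smooth : ContDiff ℝ ∞ χ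
  supp : HasCompactSupport χ

theorem IsTest.continuous {χ : Plane → ℝ} (hχ : IsTest χ) : Continuous χ := hχ.smooth.continuous

theorem contDiff_partialR {V : Plane → ℝ} (hV : ContDiff ℝ ∞ V) (k : Fin 2) :
    ContDiff ℝ ∞ (partialR k V) :=
  (hV.fderiv_right (m := ∞) (by norm_cast)).clm_apply contDiff_const

theorem IsTest.partialR {χ : Plane → ℝ} (hχ : IsTest χ) (k : Fin 2) :
    IsTest (Graphene.partialR k χ) :=
  ⟨contDiff_partialR hχ.smooth k, hχ.supp.fderiv_apply ℝ _⟩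

theorem IsTest.mul {χ V : Plane → ℝ} (hχ : IsTest χ) (hV : ContDiff ℝ ∞ V) :
    IsTest fun r => χ r * V r :=
  ⟨hχ.smooth.mul hV, hχ.supp.mul_right⟩

/-- Integration against a function of the position. -/
def pair (χ : Plane → ℝ) (F : ℝ × Plane → ℝ) (t : ℝ) : ℝ := ∫ r, χ r * F (t, r)

/-- Continuity in `(t,r)` for `t > 0`. -/
abbrev TimeCont (F : ℝ × Plane → ℝ) : Prop := ContinuousOn F (Ioi 0 ×ˢ univ)

variable {χ : Plane → ℝ} {F G : ℝ × Plane → ℝ} {t : ℝ}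

theorem TimeCont.continuous_slice (hF : TimeCont F) (ht : 0 < t) :
    Continuous fun r => F (t, r) :=
  hF.comp_continuous (by fun_prop) fun r => ⟨ht, mem_univ _⟩

theorem TimeCont.integrable (hχ : Continuous χ) (hs : HasCompactSupport χ) (hF : TimeCont F)
    (ht : 0 < t) : Integrable fun r => χ r * F (t, r) :=
  (hχ.mul (hF.continuous_slice ht)).integrable_of_hasCompactSupport hs.mul_right

theorem TimeCont.add (hF : TimeCont F) (hG : TimeCont G) : TimeCont fun y => F y + G y :=
  ContinuousOn.add hF hG

theorem pair_add (hχ : IsTest χ) (hF : TimeCont F) (hG : TimeCont G) (ht : 0 < t) :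
    pair χ (fun y => F y + G y) t = pair χ F t + pair χ G t := by
  simp only [pair, mul_add]
  exact integral_add (hF.integrable hχ.continuous hχ.supp ht)
    (hG.integrable hχ.continuous hχ.supp ht)

theorem pair_const_mul (c : ℝ) : pair χ (fun y => c * F y) t = c * pair χ F t := by
  simp only [pair, ← integral_const_mul]
  congr 1; ext r; ring

theorem pair_sum {ι : Type*} (S : Finset ι) {F : ι → ℝ × Plane → ℝ} (hχ : IsTest χ)
    (hF : ∀ i ∈ S, TimeCont (F i)) (ht : 0 < t) :
    pair χ (fun y => ∑ i ∈ S, F i y) t = ∑ i ∈ S, pair χ (F i) t := by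
  simp only [pair, Finset.mul_sum]
  exact integral_finsetSum S fun i hi => (hF i hi).integrable hχ.continuous hχ.supp ht

theorem TimeCont.continuousOn_pair (hχ : IsTest χ) (hF : TimeCont F) :
    ContinuousOn (pair χ F) (Ioi 0) := by
  refine continuousOn_integral_of_compact_support (k := tsupport χ) hχ.supp ?_ ?_
  · exact (hχ.continuous.comp continuous_snd).continuousOn.mul hF
  · intro t r _ hr
    rw [image_eq_zero_of_notMem_tsupport hr, zero_mul]

/-- Continuous differentiability in `(t,r)` for `t > 0`. -/
structure TimeC1 (F : ℝ × Plane → ℝ) : Prop where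
  diff : ∀ t > 0, ∀ r, DifferentiableAt ℝ F (t, r)
  cont_fderiv : ∀ v, TimeCont fun y => fderiv ℝ F y v

theorem TimeC1.timeCont (hF : TimeC1 F) : TimeCont F := fun y hy =>
  (hF.diff y.1 hy.1 y.2).continuousAt.continuousWithinAt

theorem RapidC1.timeC1 {f : ℝ × Plane × Plane → ℝ} (hf : RapidC1 f) (l : List (Fin 2)) :
    TimeC1 (monoMom l f) where
  diff t ht r := hf.differentiableAt_monoMom l ht r
  cont_fderiv v := by
    refine (((hf.rapid_fderiv_apply (inclTR v)).mono_mul l).continuousOn_mom).congr ?_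
    rintro ⟨t, r⟩ ⟨ht, -⟩
    exact hf.fderiv_monoMom l ht r v

theorem RapidC0.timeCont {f : ℝ × Plane × Plane → ℝ} (hf : RapidC0 f) (l : List (Fin 2)) :
    TimeCont (monoMom l f) := (hf.mono_mul l).continuousOn_mom

/-- Integration by parts in `r`, without boundary term because the test function has compact
support. -/
theorem TimeC1.pair_fderiv_dirR (hχ : IsTest χ) (hF : TimeC1 F) (ht : 0 < t) (k : Fin 2) :
    pair χ (fun y => fderiv ℝ F y (dirR k)) t = -pair (partialR k χ) F t := by
  have hd (r : Plane) : HasFDerivAt (fun r' : Plane => F (t, r'))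
      ((fderiv ℝ F (t, r)).comp (ContinuousLinearMap.inr ℝ ℝ Plane)) r :=
    (hF.diff t ht r).hasFDerivAt.comp r (hasFDerivAt_prodMk_right t r)
  have he (r : Plane) : fderiv ℝ (fun r' : Plane => F (t, r')) r (unitVec k)
      = fderiv ℝ F (t, r) (dirR k) := by
    rw [(hd r).fderiv]; rfl
  have hχk := hχ.partialR k
  simp only [pair, ← he]
  refine integral_mul_fderiv_eq_neg_fderiv_mul_of_integrable
    (hF.timeCont.integrable hχk.continuous hχk.supp ht) ?_
    (hF.timeCont.integrable hχ.continuous hχ.supp ht)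
    (fun r _ => (hχ.smooth.differentiable (by simp)) r)
    (fun r _ => (hd r).differentiableAt)
  simp only [he]
  exact (hF.cont_fderiv (dirR k)).integrable hχ.continuous hχ.supp ht

theorem TimeC1.hasDerivAt_pair (hχ : IsTest χ) (hF : TimeC1 F) (ht : 0 < t) :
    HasDerivAt (pair χ F) (pair χ (fun y => fderiv ℝ F y dirT) t) t := by
  have hD := hF.cont_fderiv dirT
  -- The support of the test function times a closed time window is compact, so continuity of the
  -- derivative already provides a dominating constant.
  obtain ⟨C, hC⟩ := (isCompact_Icc (a := t / 2) (b := 2 * t)).prod hχ.supp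
    |>.exists_bound_of_continuousOn (hD.mono (by
      rintro ⟨u, r⟩ ⟨hu, -⟩
      exact ⟨lt_of_lt_of_le (half_pos ht) hu.1, mem_univ _⟩))
  refine (hasDerivAt_integral_of_dominated_loc_of_deriv_le
    (F := fun t r => χ r * F (t, r)) (F' := fun t r => χ r * fderiv ℝ F (t, r) dirT)
    (bound := fun r => |χ r| * C) (exists_nhds_Icc ht) ?_
    (hF.timeCont.integrable hχ.continuous hχ.supp ht)
    (hD.integrable hχ.continuous hχ.supp ht).aestronglyMeasurable
    (Eventually.of_forall fun r u hu => ?_) ?_ (Eventually.of_forall fun r u hu => ?_)).2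
  · filter_upwards [lt_mem_nhds ht] with u hu
    exact (hF.timeCont.integrable hχ.continuous hχ.supp hu).aestronglyMeasurable
  · rw [norm_mul, Real.norm_eq_abs]
    by_cases hr : r ∈ tsupport χ
    · gcongr; exact hC (u, r) ⟨hu, hr⟩
    · simp [image_eq_zero_of_notMem_tsupport hr]
  · exact ((hχ.continuous.abs).integrable_of_hasCompactSupport hχ.supp.abs).mul_const C
  · have hu0 : 0 < u := lt_of_lt_of_le (half_pos ht) hu.1
    have h : HasDerivAt (fun u : ℝ => (u, r)) (1, 0) u :=
      (hasDerivAt_id u).prodMk (hasDerivAt_const u r)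
    exact ((hF.diff u hu0 r).hasFDerivAt.comp_hasDerivAt u h).const_mul _

/-- The terms of the potential in the weak form of the moment equations. -/
def potentialPair (V χ : Plane → ℝ) (M : (Plane → ℝ) → List (Fin 2) → ℝ) : List (Fin 2) → ℝ
  | [] => 0
  | [i] => M (fun r => χ r * partialR i V r) []
  | [i, j] => M (fun r => χ r * partialR i V r) [j] + M (fun r => χ r * partialR j V r) [i]
  | _ => 0

/-- The right-hand side of the weak form of the moment equations without collisions. -/
def weakFlux (ε γ : ℝ) (V χ : Plane → ℝ) (f : Fin 4 → ℝ × Plane × Plane → ℝ) (l : List (Fin 2))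
    (s : Fin 4) (t : ℝ) : ℝ :=
  (∑ k, pair (partialR k χ) (monoMom (k :: l) (f s)) t) / (2 * γ)
    + ε / 2 * (∑ k, ∑ s', gradCoef s k s' * pair (partialR k χ) (monoMom l (f s')) t)
    - (∑ k, ∑ s', spinCoef s k s' * pair χ (monoMom (k :: l) (f s')) t)
    - potentialPair V χ (fun ψ l => pair ψ (monoMom l (f s)) t) l

theorem pair_potentialTerm {V : Plane → ℝ} (hV : ContDiff ℝ ∞ V) (hχ : IsTest χ)
    {f : ℝ × Plane × Plane → ℝ} (hf : RapidC0 f) (ht : 0 < t) (l : List (Fin 2)) :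
    pair χ (fun y => potentialTerm V (fun l => monoMom l f y) y.2 l) t
      = potentialPair V χ (fun ψ l => pair ψ (monoMom l f) t) l := by
  have hc (i : Fin 2) (l : List (Fin 2)) :
      TimeCont fun y => partialR i V y.2 * monoMom l f y :=
    ((contDiff_partialR hV i).continuous.comp continuous_snd).continuousOn.mul (hf.timeCont l)
  match l with
  | [] => simp [potentialTerm, potentialPair, pair]
  | [i] => simp [potentialTerm, potentialPair, pair, mul_assoc]
  | [i, j] =>
    simp only [potentialTerm, potentialPair]
    rw [pair_add hχ (hc i [j]) (hc j [i]) ht]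
    simp [pair, mul_assoc]
  | _ :: _ :: _ :: _ => simp [potentialTerm, potentialPair, pair]

theorem timeCont_potentialTerm {V : Plane → ℝ} (hV : ContDiff ℝ ∞ V)
    {f : ℝ × Plane × Plane → ℝ} (hf : RapidC0 f) (l : List (Fin 2)) :
    TimeCont fun y => potentialTerm V (fun l => monoMom l f y) y.2 l := by
  have hc (i : Fin 2) (l : List (Fin 2)) :
      TimeCont fun y => partialR i V y.2 * monoMom l f y :=
    ((contDiff_partialR hV i).continuous.comp continuous_snd).continuousOn.mul (hf.timeCont l)
  match l with
  | [] => exact continuousOn_const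
  | [i] => exact hc i []
  | [i, j] => exact (hc i [j]).add (hc j [i])
  | _ :: _ :: _ :: _ => exact continuousOn_const

theorem timeCont_momentBalance {f : Fin 4 → ℝ × Plane × Plane → ℝ} (hf : ∀ s, RapidC1 (f s))
    (ε γ : ℝ) (l : List (Fin 2)) (s : Fin 4) : TimeCont (momentBalance ε γ f l s) := by
  refine (((rapidC0_transportTerm hf ε γ s).timeCont l)).congr ?_
  rintro ⟨t, r⟩ ⟨ht, -⟩
  exact (monoMom_transportTerm hf ε γ s ht).symm

theorem pair_momentBalance {f : Fin 4 → ℝ × Plane × Plane → ℝ} (hf : ∀ s, RapidC1 (f s))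
    (ε γ : ℝ) (hχ : IsTest χ) (l : List (Fin 2)) (s : Fin 4) (ht : 0 < t) :
    pair χ (momentBalance ε γ f l s) t = pair χ (fun y => fderiv ℝ (monoMom l (f s)) y dirT) t
      - (∑ k, pair (partialR k χ) (monoMom (k :: l) (f s)) t) / (2 * γ)
      - ε / 2 * (∑ k, ∑ s', gradCoef s k s' * pair (partialR k χ) (monoMom l (f s')) t)
      + ∑ k, ∑ s', spinCoef s k s' * pair χ (monoMom (k :: l) (f s')) t := by
  have h1 (l : List (Fin 2)) (s : Fin 4) := (hf s).timeC1 l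
  have hc1 := (h1 l s).cont_fderiv dirT
  have hc2 (k : Fin 2) := (h1 (k :: l) s).cont_fderiv (dirR k)
  have hc3 (k : Fin 2) (s' : Fin 4) : TimeCont fun y =>
      gradCoef s k s' * fderiv ℝ (monoMom l (f s')) y (dirR k) :=
    continuousOn_const.mul ((h1 l s').cont_fderiv (dirR k))
  have hc4 (k : Fin 2) (s' : Fin 4) : TimeCont fun y =>
      spinCoef s k s' * monoMom (k :: l) (f s') y :=
    continuousOn_const.mul (h1 (k :: l) s').timeCont
  have hs3 (k : Fin 2) := continuousOn_finsetSum Finset.univ fun s' _ => hc3 k s'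
  have hs4 (k : Fin 2) := continuousOn_finsetSum Finset.univ fun s' _ => hc4 k s'
  have hS2 : TimeCont fun y => (2 * γ)⁻¹ * ∑ k, fderiv ℝ (monoMom (k :: l) (f s)) y (dirR k) :=
    continuousOn_const.mul (continuousOn_finsetSum Finset.univ fun k _ => hc2 k)
  have hS3 : TimeCont fun y => ε / 2 *
      ∑ k, ∑ s', gradCoef s k s' * fderiv ℝ (monoMom l (f s')) y (dirR k) :=
    continuousOn_const.mul (continuousOn_finsetSum Finset.univ fun k _ => hs3 k)
  have hS4 : TimeCont fun y => ∑ k, ∑ s', spinCoef s k s' * monoMom (k :: l) (f s') y :=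
    continuousOn_finsetSum Finset.univ fun k _ => hs4 k
  have key : momentBalance ε γ f l s = fun y => fderiv ℝ (monoMom l (f s)) y dirT
      + (2 * γ)⁻¹ * (∑ k, fderiv ℝ (monoMom (k :: l) (f s)) y (dirR k))
      + ε / 2 * (∑ k, ∑ s', gradCoef s k s' * fderiv ℝ (monoMom l (f s')) y (dirR k))
      + ∑ k, ∑ s', spinCoef s k s' * monoMom (k :: l) (f s') y := by
    ext y; rw [momentBalance, div_eq_inv_mul]
  rw [key, pair_add hχ ((hc1.add hS2).add hS3) hS4 ht, pair_add hχ (hc1.add hS2) hS3 ht,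
    pair_add hχ hc1 hS2 ht, pair_const_mul, pair_const_mul, pair_sum _ hχ (fun k _ => hc2 k) ht,
    pair_sum _ hχ (fun k _ => hs3 k) ht, pair_sum _ hχ (fun k _ => hs4 k) ht]
  simp only [pair_sum _ hχ (fun s' _ => hc3 _ s') ht, pair_sum _ hχ (fun s' _ => hc4 _ s') ht,
    pair_const_mul, (h1 _ _).pair_fderiv_dirR hχ ht, mul_neg, Finset.sum_neg_distrib,
    div_eq_inv_mul]
  ring

/-- An identity for arbitrary `f`, in which the balance is added and subtracted and derivatives in
`r` are moved to the test function. It serves both for `w^τ`, where the second term is the collision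
term, and for the limit, where that term is to be shown to vanish. -/
theorem hasDerivAt_pair_monoMom {V : Plane → ℝ} (hV : ContDiff ℝ ∞ V)
    {f : Fin 4 → ℝ × Plane × Plane → ℝ} (hf : ∀ s, RapidC1 (f s))
    (ε γ : ℝ) (hχ : IsTest χ) (l : List (Fin 2)) (s : Fin 4) (ht : 0 < t) :
    HasDerivAt (pair χ (monoMom l (f s))) (weakFlux ε γ V χ f l s t
      + pair χ (fun y => momentBalance ε γ f l s y
          + potentialTerm V (fun l => monoMom l (f s) y) y.2 l) t) t := by
  convert! ((hf s).timeC1 l).hasDerivAt_pair hχ ht using 1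
  rw [pair_add hχ (timeCont_momentBalance hf ε γ l s) (timeCont_potentialTerm hV (hf s).rapid l) ht,
    pair_momentBalance hf ε γ hχ l s ht, pair_potentialTerm hV hχ (hf s).rapid ht, weakFlux]
  ring

end WeakForm

/-! ### Partial Fourier transform on phase space -/

section PartialFourier

variable {E : Type*} [NormedAddCommGroup E]

theorem schwartz_le_mul [NormedSpace ℝ E] (f : 𝓢(Plane × Plane, E)) (k l : ℕ) :
    ∃ C : ℝ, 0 ≤ C ∧ ∀ x p : Plane,
      ‖f (x, p)‖ ≤ C * (((1 + ‖x‖) ^ k)⁻¹ * ((1 + ‖p‖) ^ l)⁻¹) := by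
  set C : ℝ := 2 ^ (k + l) * ((Finset.Iic (k + l, 0)).sup fun m => SchwartzMap.seminorm ℝ m.1 m.2) f
  have hC (z : Plane × Plane) : (1 + ‖z‖) ^ (k + l) * ‖f z‖ ≤ C := by
    simpa using SchwartzMap.one_add_le_sup_seminorm_apply (𝕜 := ℝ) (m := (k + l, 0)) le_rfl le_rfl
      f z
  refine ⟨C, by positivity, fun x p => ?_⟩
  rw [← mul_inv, ← div_eq_mul_inv, le_div_iff₀ (by positivity), mul_comm]
  refine le_trans ?_ (hC (x, p))
  rw [pow_add]
  have h1 : ‖x‖ ≤ ‖(x, p)‖ := norm_fst_le (x, p)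
  have h2 : ‖p‖ ≤ ‖(x, p)‖ := norm_snd_le (x, p)
  gcongr

variable [NormedSpace ℂ E]

/-- The Fourier transform in the second variable. -/
def pft (c : ℝ) (f : Plane × Plane → E) (z : Plane × Plane) : E := ft c (fun p => f (z.1, p)) z.2

theorem pft_eq (c : ℝ) (f : Plane × Plane → E) (z : Plane × Plane) :
    pft c f z = ∫ p, phase c p z.2 • f (z.1, p) := rfl

theorem pft_eq_ft_restrict (c : ℝ) (f : 𝓢(Plane × Plane, E)) (z : Plane × Plane) :
    pft c f z = ft c (restrictFst z.1 f) z.2 := rfl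

/-- Weights in the first variable pass through the integral over the second. -/
theorem pft_decay_fst (c : ℝ) (f : 𝓢(Plane × Plane, E)) (k : ℕ) :
    ∃ C : ℝ, ∀ z : Plane × Plane, ‖z.1‖ ^ k * ‖pft c f z‖ ≤ C := by
  obtain ⟨C, hC0, hC⟩ := schwartz_le_mul f k 3
  refine ⟨C * ∫ p : Plane, ((1 + ‖p‖) ^ 3)⁻¹, fun z => ?_⟩
  have h1 : ‖pft c f z‖ ≤ (C * ((1 + ‖z.1‖) ^ k)⁻¹) * ∫ p : Plane, ((1 + ‖p‖) ^ 3)⁻¹ := by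
    rw [← integral_const_mul]
    refine norm_integral_le_of_norm_le ((integrable_inv_pow le_rfl).const_mul _)
      (Eventually.of_forall fun p => ?_)
    rw [norm_smul, norm_phase, one_mul, mul_assoc]
    exact hC z.1 p
  have h2 : ‖z.1‖ ^ k * ((1 + ‖z.1‖) ^ k)⁻¹ ≤ 1 := by
    rw [← div_eq_mul_inv, div_le_one (by positivity)]
    gcongr
    linarith
  have h3 : 0 ≤ ∫ p : Plane, ((1 + ‖p‖) ^ 3)⁻¹ := integral_nonneg fun p => by positivity
  calc ‖z.1‖ ^ k * ‖pft c f z‖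
      ≤ ‖z.1‖ ^ k * ((C * ((1 + ‖z.1‖) ^ k)⁻¹) * ∫ p : Plane, ((1 + ‖p‖) ^ 3)⁻¹) := by gcongr
    _ = (‖z.1‖ ^ k * ((1 + ‖z.1‖) ^ k)⁻¹) * (C * ∫ p : Plane, ((1 + ‖p‖) ^ 3)⁻¹) := by ring
    _ ≤ 1 * (C * ∫ p : Plane, ((1 + ‖p‖) ^ 3)⁻¹) := by gcongr
    _ = _ := one_mul _

theorem lineDeriv_restrictFst (f : 𝓢(Plane × Plane, E)) (x v : Plane) :
    (∂_{v} (restrictFst x f) : 𝓢(Plane, E))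
      = restrictFst x (∂_{((0, v) : Plane × Plane)} f : 𝓢(Plane × Plane, E)) := by
  ext p
  rw [restrictFst_apply, SchwartzMap.lineDerivOp_apply_eq_fderiv,
    SchwartzMap.lineDerivOp_apply_eq_fderiv]
  have h : HasFDerivAt (fun p : Plane => f (x, p))
      ((fderiv ℝ f (x, p)).comp (ContinuousLinearMap.inr ℝ Plane Plane)) p :=
    (f.hasFDerivAt (x, p)).comp p (hasFDerivAt_prodMk_right x p)
  have he : (restrictFst x f : Plane → E) = fun p => f (x, p) := rfl
  rw [he, h.fderiv]
  rfl

theorem coord_smul_pft {c : ℝ} (hc : c ≠ 0) (f : 𝓢(Plane × Plane, E)) (k : Fin 2)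
    (z : Plane × Plane) :
    z.2 k • pft c f z = pft c ((Complex.I / (c : ℂ)) •
      ∂_{((0, unitVec k) : Plane × Plane)} f : 𝓢(Plane × Plane, E)) z := by
  rw [pft_eq_ft_restrict, coord_smul_ft hc, lineDeriv_restrictFst, pft_eq_ft_restrict]
  rfl

theorem norm_plane_le (p : Plane) : ‖p‖ ≤ |p 0| + |p 1| := by
  rw [EuclideanSpace.norm_eq, Fin.sum_univ_two, Real.norm_eq_abs, Real.norm_eq_abs]
  refine Real.sqrt_le_iff.2 ⟨by positivity, ?_⟩
  nlinarith [abs_nonneg (p 0), abs_nonneg (p 1)]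

/-- Each power of the frequency costs one derivative of `f` by integration by parts; hence the
induction over all Schwartz `f`. -/
theorem pft_decay_snd {c : ℝ} (hc : c ≠ 0) (k : ℕ) : ∀ f : 𝓢(Plane × Plane, E),
    ∃ C : ℝ, ∀ z : Plane × Plane, ‖z.2‖ ^ k * ‖pft c f z‖ ≤ C := by
  induction k with
  | zero =>
    intro f
    simpa using pft_decay_fst c f 0
  | succ k ih =>
    intro f
    obtain ⟨C, hC⟩ := ih ((Complex.I / (c : ℂ)) •
      ∂_{((0, unitVec 0) : Plane × Plane)} f : 𝓢(Plane × Plane, E))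
    obtain ⟨D, hD⟩ := ih ((Complex.I / (c : ℂ)) •
      ∂_{((0, unitVec 1) : Plane × Plane)} f : 𝓢(Plane × Plane, E))
    refine ⟨C + D, fun z => ?_⟩
    have h1 := hC z
    have h2 := hD z
    rw [← coord_smul_pft hc, norm_smul, Real.norm_eq_abs] at h1 h2
    calc ‖z.2‖ ^ (k + 1) * ‖pft c f z‖ = ‖z.2‖ ^ k * (‖z.2‖ * ‖pft c f z‖) := by ring
      _ ≤ ‖z.2‖ ^ k * ((|z.2 0| + |z.2 1|) * ‖pft c f z‖) := by
          gcongr; exact norm_plane_le _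
      _ ≤ C + D := by linarith

theorem pft_decay {c : ℝ} (hc : c ≠ 0) (k : ℕ) (f : 𝓢(Plane × Plane, E)) :
    ∃ C : ℝ, ∀ z : Plane × Plane, ‖z‖ ^ k * ‖pft c f z‖ ≤ C := by
  obtain ⟨C, hC⟩ := pft_decay_fst c f k
  obtain ⟨D, hD⟩ := pft_decay_snd hc k f
  refine ⟨max C D, fun z => ?_⟩
  rcases le_total ‖z.1‖ ‖z.2‖ with h | h
  · rw [Prod.norm_def, max_eq_right h]; exact (hD z).trans (le_max_right _ _)
  · rw [Prod.norm_def, max_eq_left h]; exact (hC z).trans (le_max_left _ _)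

/-- The bilinear form `(x,p), (x',ξ') ↦ p·ξ'`. -/
def innerSnd : Plane × Plane →L[ℝ] Plane × Plane →L[ℝ] ℝ :=
  (((innerSL ℝ : Plane →L[ℝ] Plane →L[ℝ] ℝ).flip.comp (ContinuousLinearMap.snd ℝ Plane Plane)).flip).comp
    (ContinuousLinearMap.snd ℝ Plane Plane)

@[simp] theorem innerSnd_apply (z v : Plane × Plane) : innerSnd z v = inner ℝ z.2 v.2 := by
  rfl

/-- The symbol of the derivative of a partial Fourier transform. -/
def pftDeriv (c : ℝ) (f : 𝓢(Plane × Plane, E)) : 𝓢(Plane × Plane, Plane × Plane →L[ℝ] E) :=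
  SchwartzMap.postcompCLM (𝕜 := ℝ)
      ((ContinuousLinearMap.compL ℝ (Plane × Plane) (Plane × Plane) E).flip
        ((ContinuousLinearMap.inl ℝ Plane Plane).comp (ContinuousLinearMap.fst ℝ Plane Plane)))
      (SchwartzMap.fderivCLM ℝ (Plane × Plane) E f)
    + SchwartzMap.smulRightCLM ℂ E innerSnd ((Complex.I * c) • f)

theorem pftDeriv_apply (c : ℝ) (f : 𝓢(Plane × Plane, E)) (z v : Plane × Plane) :
    pftDeriv c f z v = fderiv ℝ f z (v.1, 0) + inner ℝ z.2 v.2 • (Complex.I * c) • f z := by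
  rw [smul_comm]
  simp [pftDeriv]

/-- The derivative is again a partial transform of a Schwartz function, with values in linear maps,
so that smoothness and decay propagate by induction. -/
theorem hasFDerivAt_pft (c : ℝ) (f : 𝓢(Plane × Plane, E)) (z : Plane × Plane) :
    HasFDerivAt (pft c f) (pft c (pftDeriv c f) z) z := by
  obtain ⟨C, -, hC⟩ := schwartz_le_mul (pftDeriv c f) 0 3
  have hcont {F : Type _} [NormedAddCommGroup F] [NormedSpace ℂ F] (h : 𝓢(Plane × Plane, F))
      (z : Plane × Plane) : Continuous fun p => phase c p z.2 • h (z.1, p) :=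
    ((continuous_phase c).comp (by fun_prop : Continuous fun p : Plane => (p, z.2))).smul
      (h.continuous.comp (by fun_prop))
  refine hasFDerivAt_integral_of_dominated_of_fderiv_le
    (F := fun (z : Plane × Plane) p => phase c p z.2 • f (z.1, p))
    (F' := fun z p => phase c p z.2 • pftDeriv c f (z.1, p))
    (bound := fun p => C * ((1 + ‖p‖) ^ 3)⁻¹) univ_mem
    (Eventually.of_forall fun z => (hcont f z).aestronglyMeasurable) ?_
    (hcont _ z).aestronglyMeasurable
    (Eventually.of_forall fun p z _ => ?_) ((integrable_inv_pow le_rfl).const_mul C)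
    (Eventually.of_forall fun p z _ => ?_)
  · obtain ⟨D, -, hD⟩ := schwartz_le_mul f 0 3
    refine ((integrable_inv_pow le_rfl).const_mul D).mono' (hcont f z).aestronglyMeasurable
      (Eventually.of_forall fun p => ?_)
    rw [norm_smul, norm_phase, one_mul]
    simpa using hD z.1 p
  · rw [norm_smul, norm_phase, one_mul]
    simpa using hC z.1 p
  · have h1 : HasFDerivAt (fun z : Plane × Plane => f (z.1, p))
        ((fderiv ℝ f (z.1, p)).comp
          ((ContinuousLinearMap.inl ℝ Plane Plane).comp (ContinuousLinearMap.fst ℝ Plane Plane))) z :=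
      HasFDerivAt.comp (f := fun z : Plane × Plane => (z.1, p)) z (f.hasFDerivAt (z.1, p))
        (HasFDerivAt.comp (f := Prod.fst) (g := fun x : Plane => (x, p)) z
          (hasFDerivAt_prodMk_left z.1 p) hasFDerivAt_fst)
    have h2 : HasFDerivAt (fun z : Plane × Plane => phase c p z.2)
        ((phase c p z.2 * (Complex.I * c)) •
          (Complex.ofRealCLM.comp ((innerSL ℝ p).comp (ContinuousLinearMap.snd ℝ Plane Plane)))) z := by
      have h3 : HasFDerivAt (fun z : Plane × Plane => inner ℝ p z.2)
          ((innerSL ℝ p).comp (ContinuousLinearMap.snd ℝ Plane Plane)) z :=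
        ((innerSL ℝ p).comp (ContinuousLinearMap.snd ℝ Plane Plane)).hasFDerivAt
      have h4 := ((Complex.ofRealCLM.hasFDerivAt.comp z (h3.const_mul c)).const_mul Complex.I).cexp
      refine h4.congr_fderiv ?_
      ext v
      · simp [phase]
      · simp [phase]; ring
    refine (h2.smul h1).congr_fderiv ?_
    ext v
    · simp [pftDeriv_apply]
    · simp [pftDeriv_apply, mul_smul]
      rw [smul_comm c, smul_comm Complex.I]

/-- The target space is quantified inside the induction, since each derivative replaces `E` by a
space of linear maps into `E`. -/
theorem pft_iterated {c : ℝ} (hc : c ≠ 0) (n : ℕ) :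
    ∀ {E : Type*} [NormedAddCommGroup E] [NormedSpace ℂ E] (f : 𝓢(Plane × Plane, E)),
      ContDiff ℝ n (pft c f) ∧
        ∀ k : ℕ, ∃ C : ℝ, ∀ z, ‖z‖ ^ k * ‖iteratedFDeriv ℝ n (pft c f) z‖ ≤ C := by
  induction n with
  | zero =>
    intro E _ _ f
    refine ⟨contDiff_zero.2 (continuous_iff_continuousAt.2 fun z =>
      (hasFDerivAt_pft c f z).continuousAt), fun k => ?_⟩
    simpa using pft_decay hc k f
  | succ n ih =>
    intro E _ _ f
    have hf : fderiv ℝ (pft c f) = pft c (pftDeriv c f) :=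
      funext fun z => (hasFDerivAt_pft c f z).fderiv
    obtain ⟨h1, h2⟩ := ih (pftDeriv c f)
    refine ⟨?_, fun k => ?_⟩
    · push_cast
      refine contDiff_succ_iff_fderiv.2 ⟨fun z => (hasFDerivAt_pft c f z).differentiableAt, by simp, ?_⟩
      rw [hf]; exact h1
    · obtain ⟨C, hC⟩ := h2 k
      refine ⟨C, fun z => ?_⟩
      rw [← norm_iteratedFDeriv_fderiv, hf]
      exact hC z

/-- The Fourier transform in the second variable of a Schwartz function, as a Schwartz function. -/
def pftSchwartz (c : ℝ) (hc : c ≠ 0) (f : 𝓢(Plane × Plane, E)) : 𝓢(Plane × Plane, E) where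
  toFun := pft c f
  smooth' := contDiff_infty.2 fun n => (pft_iterated hc n f).1
  decay' k n := (pft_iterated hc n f).2 k

@[simp] theorem pftSchwartz_apply (c : ℝ) (hc : c ≠ 0) (f : 𝓢(Plane × Plane, E))
    (z : Plane × Plane) : pftSchwartz c hc f z = pft c f z := rfl

end PartialFourier

/-! ### Parseval's identity under an integral -/

section Parseval

local notation "⟪" x ", " y "⟫" => inner ℂ x y

/-- Parseval's identity pointwise in `x`, then dominated convergence: the terms are bounded by half
the sum of the squared coefficients of `u x` and `v x`, and these bounds sum to `(‖u x‖² + ‖v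
x‖²)/2`, which is integrable. -/
theorem hasSum_integral_inner_mul_inner {X H : Type*} [MeasurableSpace X] {μ : Measure X}
    [NormedAddCommGroup H] [InnerProductSpace ℂ H] (e : HilbertBasis ℕ ℂ H) {u v : X → H}
    (hu : ∀ j, AEStronglyMeasurable (fun x => ⟪u x, e j⟫) μ)
    (hv : ∀ j, AEStronglyMeasurable (fun x => ⟪e j, v x⟫) μ)
    (hu2 : Integrable (fun x => ‖u x‖ ^ 2) μ) (hv2 : Integrable (fun x => ‖v x‖ ^ 2) μ) :
    HasSum (fun j => ∫ x, ⟪u x, e j⟫ * ⟪e j, v x⟫ ∂μ) (∫ x, ⟪u x, v x⟫ ∂μ) := by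
  have hsum (w : H) : HasSum (fun j => ‖⟪w, e j⟫‖ ^ 2) (‖w‖ ^ 2) := by
    have h := (e.hasSum_inner_mul_inner w w).mapL Complex.reCLM
    convert! h using 1
    · ext j
      rw [← inner_conj_symm (e j) w, Complex.mul_conj]
      simp [Complex.normSq_eq_norm_sq]; norm_cast
    · simp [inner_self_eq_norm_sq_to_K, ← Complex.ofReal_pow]
  have hb (x : X) : HasSum (fun j => 2⁻¹ * (‖⟪u x, e j⟫‖ ^ 2 + ‖⟪v x, e j⟫‖ ^ 2))
      (2⁻¹ * (‖u x‖ ^ 2 + ‖v x‖ ^ 2)) := ((hsum (u x)).add (hsum (v x))).mul_left _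
  refine hasSum_integral_of_dominated_convergence
    (fun j x => 2⁻¹ * (‖⟪u x, e j⟫‖ ^ 2 + ‖⟪v x, e j⟫‖ ^ 2))
    (fun j => (hu j).mul (hv j)) (fun j => Eventually.of_forall fun x => ?_)
    (Eventually.of_forall fun x => (hb x).summable) ?_
    (Eventually.of_forall fun x => e.hasSum_inner_mul_inner _ _)
  · rw [norm_mul, norm_inner_symm (e j) (v x)]
    nlinarith [sq_nonneg (‖⟪u x, e j⟫‖ - ‖⟪v x, e j⟫‖)]
  · simp_rw [fun x => (hb x).tsum_eq]
    exact (hu2.add hv2).const_mul _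

/-- Square-integrable spinors. -/
abbrev SpinorL2 := Lp Spinor 2 (volume : Measure Plane)

theorem inner_toLp_toLp {f g : Plane → Spinor} (hf : MemLp f 2 volume) (hg : MemLp g 2 volume) :
    ⟪hf.toLp f, hg.toLp g⟫ = ∫ x, ⟪f x, g x⟫ := by
  rw [L2.inner_def]
  refine integral_congr_ae ?_
  filter_upwards [hf.coeFn_toLp, hg.coeFn_toLp] with x h1 h2
  rw [h1, h2]

theorem norm_toLp_sq {f : Plane → Spinor} (hf : MemLp f 2 volume) :
    ‖hf.toLp f‖ ^ 2 = ∫ x, ‖f x‖ ^ 2 := by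
  have h := inner_toLp_toLp hf hf
  rw [inner_self_eq_norm_sq_to_K] at h
  simp_rw [inner_self_eq_norm_sq_to_K] at h
  apply Complex.ofReal_injective
  rw [← integral_complex_ofReal]
  exact_mod_cast h

end Parseval

/-! ### Trace formula for Schwartz kernels -/

section TraceFormula

local notation "⟪" x ", " y "⟫" => inner ℂ x y

/-- An integrable-square weight on the plane. -/
def weight (x : Plane) : ℝ := (1 + ‖x‖ ^ 2)⁻¹

theorem weight_pos (x : Plane) : 0 < weight x := by unfold weight; positivity

theorem weight_le_one (x : Plane) : weight x ≤ 1 :=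
  inv_le_one_of_one_le₀ (by nlinarith [sq_nonneg ‖x‖])

theorem continuous_weight : Continuous weight := by
  unfold weight
  exact (by fun_prop : Continuous fun x : Plane => 1 + ‖x‖ ^ 2).inv₀ fun x => by positivity

theorem integrable_weight_sq : Integrable fun x : Plane => weight x ^ 2 := by
  refine ((integrable_inv_pow (k := 4) (by norm_num)).const_mul 4).mono'
    (continuous_weight.pow 2).aestronglyMeasurable (Eventually.of_forall fun x => ?_)
  rw [Real.norm_of_nonneg (by positivity), weight, inv_pow, ← div_eq_mul_inv,
    inv_eq_one_div, div_le_div_iff₀ (by positivity) (by positivity)]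
  have h : (1 + ‖x‖) ^ 2 ≤ 2 * (1 + ‖x‖ ^ 2) := by nlinarith [sq_nonneg (1 - ‖x‖)]
  nlinarith [pow_le_pow_left₀ (by positivity) h 2]

/-- The kernel that factors Schwartz kernels. -/
def factorKernel (x ξ : Plane) : ℂ := phase (-1) x ξ * ((weight x * weight ξ : ℝ) : ℂ)

theorem norm_factorKernel (x ξ : Plane) : ‖factorKernel x ξ‖ = weight x * weight ξ := by
  rw [factorKernel, norm_mul, norm_phase, one_mul, Complex.norm_real,
    Real.norm_of_nonneg (mul_nonneg (weight_pos x).le (weight_pos ξ).le)]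

theorem norm_factorKernel_le_one (x ξ : Plane) : ‖factorKernel x ξ‖ ≤ 1 := by
  rw [norm_factorKernel]
  exact mul_le_one₀ (weight_le_one x) (weight_pos ξ).le (weight_le_one ξ)

theorem continuous_factorKernel : Continuous fun z : Plane × Plane => factorKernel z.1 z.2 :=
  (continuous_phase (-1)).mul (Complex.continuous_ofReal.comp
    ((continuous_weight.comp continuous_fst).mul (continuous_weight.comp continuous_snd)))

theorem continuous_factorKernel_comp {X : Type*} [TopologicalSpace X] {f g : X → Plane}
    (hf : Continuous f) (hg : Continuous g) : Continuous fun x => factorKernel (f x) (g x) := by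
  unfold factorKernel phase
  have h1 := continuous_weight.comp hf
  have h2 := continuous_weight.comp hg
  have h3 : Continuous fun x => inner ℝ (f x) (g x) := hf.inner hg
  refine Continuous.mul (Complex.continuous_exp.comp ?_)
    (Complex.continuous_ofReal.comp (h1.mul h2))
  exact continuous_const.mul (Complex.continuous_ofReal.comp (continuous_const.mul h3))

/-- Exchange of the two variables. -/
def swapSchwartz {E : Type*} [NormedAddCommGroup E] [NormedSpace ℝ E] (f : 𝓢(Plane × Plane, E)) :
    𝓢(Plane × Plane, E) :=
  SchwartzMap.compCLMOfContinuousLinearEquiv ℝ (ContinuousLinearEquiv.prodComm ℝ Plane Plane) f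

@[simp] theorem swapSchwartz_apply {E : Type*} [NormedAddCommGroup E] [NormedSpace ℝ E]
    (f : 𝓢(Plane × Plane, E)) (z : Plane × Plane) : swapSchwartz f z = f (z.2, z.1) := rfl

theorem temperate_weight_inv {D : Type*} [NormedAddCommGroup D] [NormedSpace ℝ D]
    (L : D →L[ℝ] Plane) : Function.HasTemperateGrowth fun z : D => ((1 + ‖L z‖ ^ 2 : ℝ) : ℂ) := by
  have h : Function.HasTemperateGrowth fun x : Plane => (1 + ‖x‖ ^ 2 : ℝ) :=
    (Function.HasTemperateGrowth.const 1).add (Function.hasTemperateGrowth_norm_sq Plane)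
  exact Function.Complex.hasTemperateGrowth_ofReal.comp (h.comp L.hasTemperateGrowth)

/-- An operator with a Schwartz kernel is a product of two Hilbert-Schmidt operators; its trace then
reduces to a pairing of square-integrable kernels. The factorisation is Fourier inversion in `x`,
with polynomial weights inserted to make `factorKernel` square integrable. -/
theorem exists_factor (S : 𝓢(Plane × Plane, ℂ)) : ∃ T : 𝓢(Plane × Plane, ℂ), ∀ x y : Plane,
    S (x, y) = ∫ ξ, factorKernel x ξ * T (y, ξ) := by
  have h1 := temperate_weight_inv (ContinuousLinearMap.fst ℝ Plane Plane)
  have h2 := temperate_weight_inv (ContinuousLinearMap.snd ℝ Plane Plane)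
  set u := SchwartzMap.smulLeftCLM ℂ
    (fun z => ((1 + ‖ContinuousLinearMap.fst ℝ Plane Plane z‖ ^ 2 : ℝ) : ℂ)) S with hu
  set û := pftSchwartz 1 one_ne_zero (swapSchwartz u) with hû
  -- The constant comes from Fourier inversion; the factors `1 + ‖x‖²`, already in `u`, and `1 +
  -- ‖ξ‖²` undo the two weights of `factorKernel`.
  refine ⟨((((2 * Real.pi) ^ 2)⁻¹ : ℝ) : ℂ) • SchwartzMap.smulLeftCLM ℂ
    (fun z => ((1 + ‖ContinuousLinearMap.snd ℝ Plane Plane z‖ ^ 2 : ℝ) : ℂ)) û, fun x y => ?_⟩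
  have h3 := integral_phase_ft (c := 1) one_ne_zero (restrictFst y (swapSchwartz u)) x
  have h4 : restrictFst y (swapSchwartz u) x = ((1 + ‖x‖ ^ 2 : ℝ) : ℂ) * S (x, y) := by
    rw [restrictFst_apply, swapSchwartz_apply, hu, SchwartzMap.smulLeftCLM_apply_apply h1]
    rfl
  have h5 (ξ : Plane) : factorKernel x ξ * (((((2 * Real.pi) ^ 2)⁻¹ : ℝ) : ℂ) •
      SchwartzMap.smulLeftCLM ℂ
        (fun z => ((1 + ‖ContinuousLinearMap.snd ℝ Plane Plane z‖ ^ 2 : ℝ) : ℂ)) û) (y, ξ)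
      = (((((2 * Real.pi) ^ 2)⁻¹ : ℝ) : ℂ) * weight x) *
        (phase (-1) x ξ • ft 1 (restrictFst y (swapSchwartz u)) ξ) := by
    rw [smul_apply, SchwartzMap.smulLeftCLM_apply_apply h2, hû, pftSchwartz_apply,
      pft_eq_ft_restrict, factorKernel, weight, weight]
    simp only [smul_eq_mul, ContinuousLinearMap.coe_snd']
    have : ((1 + ‖ξ‖ ^ 2 : ℝ) : ℂ) ≠ 0 := by
      exact_mod_cast (by positivity : (1 + ‖ξ‖ ^ 2 : ℝ) ≠ 0)
    rw [Complex.ofReal_mul, Complex.ofReal_inv (1 + ‖ξ‖ ^ 2)]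
    field_simp
  simp_rw [h5]
  rw [integral_const_mul, h3, h4, weight, Complex.real_smul]
  have : ((1 + ‖x‖ ^ 2 : ℝ) : ℂ) ≠ 0 := by
    exact_mod_cast (by positivity : (1 + ‖x‖ ^ 2 : ℝ) ≠ 0)
  have hpi : (Real.pi : ℂ) ≠ 0 := by exact_mod_cast Real.pi_ne_zero
  rw [Complex.ofReal_inv (1 + ‖x‖ ^ 2)]
  field_simp
  push_cast
  field_simp

theorem memLp_single {f : Plane → ℂ} (hf : Continuous f) (h2 : Integrable fun x => ‖f x‖ ^ 2)
    (α : Fin 2) : MemLp (fun x => (EuclideanSpace.single α (f x) : Spinor)) 2 volume := by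
  have hc : Continuous fun x => (EuclideanSpace.single α (f x) : Spinor) := by
    have : (fun x => (EuclideanSpace.single α (f x) : Spinor))
        = fun x => f x • EuclideanSpace.single α (1 : ℂ) := by
      ext x i; simp
    rw [this]; fun_prop
  rw [memLp_two_iff_integrable_sq_norm hc.aestronglyMeasurable]
  simpa using h2

theorem norm_coord_le_norm (v : Spinor) (α : Fin 2) : ‖v α‖ ≤ ‖v‖ := PiLp.norm_apply_le v α

theorem continuous_comp_coord (f : 𝓢(Plane, Spinor)) (α : Fin 2) : Continuous fun x => f x α :=
  (EuclideanSpace.proj α : Spinor →L[ℂ] ℂ).continuous.comp f.continuous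

theorem integrable_comp_coord (f : 𝓢(Plane, Spinor)) (α : Fin 2) : Integrable fun x => f x α :=
  (EuclideanSpace.proj α : Spinor →L[ℂ] ℂ).integrable_comp f.integrable

theorem integrable_inv_pow_prod : Integrable fun z : Plane × Plane =>
    ((1 + ‖z.1‖) ^ 3)⁻¹ * ((1 + ‖z.2‖) ^ 3)⁻¹ :=
  (integrable_inv_pow le_rfl).mul_prod (integrable_inv_pow le_rfl)

theorem schwartz_sq_le (T : 𝓢(Plane × Plane, ℂ)) : ∃ C : ℝ, ∀ x y : Plane,
    ‖T (x, y)‖ ^ 2 ≤ C * (((1 + ‖x‖) ^ 3)⁻¹ * ((1 + ‖y‖) ^ 3)⁻¹) := by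
  obtain ⟨C, hC0, hC⟩ := schwartz_le_mul T 3 3
  refine ⟨C ^ 2, fun y ξ => ?_⟩
  have h1 := hC y ξ
  have h2 : ((1 + ‖y‖) ^ 3)⁻¹ * ((1 + ‖ξ‖) ^ 3)⁻¹ ≤ 1 :=
    mul_le_one₀ (inv_le_one_of_one_le₀ (one_le_pow₀ (by linarith [norm_nonneg y])))
      (by positivity) (inv_le_one_of_one_le₀ (one_le_pow₀ (by linarith [norm_nonneg ξ])))
  have h3 : 0 ≤ ((1 + ‖y‖) ^ 3)⁻¹ * ((1 + ‖ξ‖) ^ 3)⁻¹ := by positivity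
  calc ‖T (y, ξ)‖ ^ 2 ≤ (C * (((1 + ‖y‖) ^ 3)⁻¹ * ((1 + ‖ξ‖) ^ 3)⁻¹)) ^ 2 := by gcongr
    _ ≤ _ := by rw [mul_pow]; gcongr; nlinarith

theorem continuous_conj_slice (T : 𝓢(Plane × Plane, ℂ)) (ξ : Plane) :
    Continuous fun y => (starRingEnd ℂ) (T (y, ξ)) :=
  Complex.continuous_conj.comp (T.continuous.comp (by fun_prop))

theorem integrable_conj_slice_sq (T : 𝓢(Plane × Plane, ℂ)) (ξ : Plane) :
    Integrable fun y => ‖(starRingEnd ℂ) (T (y, ξ))‖ ^ 2 := by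
  obtain ⟨C, hC⟩ := schwartz_sq_le T
  refine ((integrable_inv_pow (k := 3) le_rfl).mul_const ((1 + ‖ξ‖) ^ 3)⁻¹ |>.const_mul
    C).mono' ((continuous_conj_slice T ξ).norm.pow 2).aestronglyMeasurable
    (Eventually.of_forall fun y => ?_)
  rw [Real.norm_of_nonneg (by positivity), RCLike.norm_conj]
  exact hC y ξ

/-- The conjugate of a slice of a kernel, as a spinor in the direction `β`. -/
def sliceL2 (T : 𝓢(Plane × Plane, ℂ)) (β : Fin 2) (ξ : Plane) : SpinorL2 :=
  (memLp_single (continuous_conj_slice T ξ) (integrable_conj_slice_sq T ξ) β).toLp _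

theorem norm_sliceL2_sq (T : 𝓢(Plane × Plane, ℂ)) (β : Fin 2) (ξ : Plane) :
    ‖sliceL2 T β ξ‖ ^ 2 = ∫ y, ‖T (y, ξ)‖ ^ 2 := by
  rw [sliceL2, norm_toLp_sq]
  simp_rw [PiLp.norm_single, RCLike.norm_conj]

theorem integrable_swap_sq (T : 𝓢(Plane × Plane, ℂ)) :
    Integrable fun z : Plane × Plane => ‖T (z.2, z.1)‖ ^ 2 := by
  obtain ⟨C, hC⟩ := schwartz_sq_le T
  refine (integrable_inv_pow_prod.swap.const_mul C).mono' (Continuous.aestronglyMeasurable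
    ((T.continuous.comp (by fun_prop)).norm.pow 2)) (Eventually.of_forall fun z => ?_)
  rw [Real.norm_of_nonneg (by positivity)]
  exact hC z.2 z.1

theorem integrable_norm_sliceL2_sq (T : 𝓢(Plane × Plane, ℂ)) (β : Fin 2) :
    Integrable fun ξ => ‖sliceL2 T β ξ‖ ^ 2 := by
  simp_rw [norm_sliceL2_sq]
  exact (integrable_swap_sq T).integral_prod_left

theorem inner_sliceL2 (T : 𝓢(Plane × Plane, ℂ)) (β : Fin 2) (ξ : Plane) (f : 𝓢(Plane, Spinor)) :
    ⟪sliceL2 T β ξ, f.toLp 2 volume⟫ = ∫ y, f y β * T (y, ξ) := by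
  rw [sliceL2, SchwartzMap.toLp, inner_toLp_toLp]
  congr 1; ext y
  simp [EuclideanSpace.inner_single_left, mul_comm]

theorem aestronglyMeasurable_inner_sliceL2 (T : 𝓢(Plane × Plane, ℂ)) (β : Fin 2)
    (f : 𝓢(Plane, Spinor)) :
    AEStronglyMeasurable (fun ξ => ⟪sliceL2 T β ξ, f.toLp 2 volume⟫) volume := by
  simp_rw [inner_sliceL2]
  refine AEStronglyMeasurable.integral_prod_right'
    (f := fun z : Plane × Plane => f z.2 β * T (z.2, z.1)) (Continuous.aestronglyMeasurable ?_)
  exact ((continuous_comp_coord f β).comp continuous_snd).mul (T.continuous.comp (by fun_prop))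

theorem continuous_factorKernel_slice (ξ : Plane) : Continuous fun x => factorKernel x ξ :=
  continuous_factorKernel_comp continuous_id continuous_const

theorem integrable_factorKernel_sq (ξ : Plane) : Integrable fun x => ‖factorKernel x ξ‖ ^ 2 := by
  simp_rw [norm_factorKernel, mul_pow]
  exact integrable_weight_sq.mul_const _

/-- A slice of the factorising kernel, as a spinor in the direction `α`. -/
def factorL2 (α : Fin 2) (ξ : Plane) : SpinorL2 :=
  (memLp_single (continuous_factorKernel_slice ξ) (integrable_factorKernel_sq ξ) α).toLp _

theorem integrable_norm_factorL2_sq (α : Fin 2) : Integrable fun ξ => ‖factorL2 α ξ‖ ^ 2 := by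
  simp_rw [factorL2, norm_toLp_sq, PiLp.norm_single, norm_factorKernel, mul_pow]
  simp_rw [integral_mul_const]
  exact integrable_weight_sq.const_mul _

theorem inner_factorL2 (α : Fin 2) (ξ : Plane) (f : 𝓢(Plane, Spinor)) :
    ⟪f.toLp 2 volume, factorL2 α ξ⟫ = ∫ x, (starRingEnd ℂ) (f x α) * factorKernel x ξ := by
  rw [factorL2, SchwartzMap.toLp, inner_toLp_toLp]
  congr 1; ext y
  simp [EuclideanSpace.inner_single_right, mul_comm]

theorem aestronglyMeasurable_inner_factorL2 (α : Fin 2) (f : 𝓢(Plane, Spinor)) :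
    AEStronglyMeasurable (fun ξ => ⟪f.toLp 2 volume, factorL2 α ξ⟫) volume := by
  simp_rw [inner_factorL2]
  refine AEStronglyMeasurable.integral_prod_right' (f := fun z : Plane × Plane =>
    (starRingEnd ℂ) (f z.2 α) * factorKernel z.2 z.1) (Continuous.aestronglyMeasurable ?_)
  exact (Complex.continuous_conj.comp ((continuous_comp_coord f α).comp continuous_snd)).mul
    (continuous_factorKernel_comp continuous_snd continuous_fst)

theorem inner_sliceL2_factorL2 (T : 𝓢(Plane × Plane, ℂ)) (α β : Fin 2) (ξ : Plane) :
    ⟪sliceL2 T β ξ, factorL2 α ξ⟫ = if α = β then ∫ x, factorKernel x ξ * T (x, ξ) else 0 := by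
  rw [sliceL2, factorL2, inner_toLp_toLp]
  split_ifs with h
  · subst h
    congr 1; ext x
    simp [EuclideanSpace.inner_single_left, mul_comm]
  · simp [EuclideanSpace.inner_single_left, Ne.symm h]

theorem norm_factorKernel_mul_le {T : Plane × Plane → ℂ} {B : ℝ} (x y ξ : Plane)
    (h : ‖T (y, ξ)‖ ≤ B) : ‖factorKernel x ξ * T (y, ξ)‖ ≤ B := by
  rw [norm_mul]
  have h2 := norm_factorKernel_le_one x ξ
  nlinarith [norm_nonneg (factorKernel x ξ), norm_nonneg (T (y, ξ))]

theorem integral_factor_diag (T : 𝓢(Plane × Plane, ℂ)) :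
    ∫ ξ, ∫ x, factorKernel x ξ * T (x, ξ) = ∫ x, ∫ ξ, factorKernel x ξ * T (x, ξ) := by
  obtain ⟨C, -, hC⟩ := schwartz_le_mul T 3 3
  symm
  refine integral_integral_swap ((integrable_inv_pow_prod.const_mul C).mono'
    (continuous_factorKernel.mul T.continuous).aestronglyMeasurable
    (Eventually.of_forall fun z => ?_))
  exact norm_factorKernel_mul_le (T := T) z.1 z.1 z.2 (hC z.1 z.2)

theorem schwartz_coord_bound (f : 𝓢(Plane, Spinor)) (β : Fin 2) :
    ∃ D : ℝ, 0 ≤ D ∧ ∀ y, ‖f y β‖ ≤ D :=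
  ⟨SchwartzMap.seminorm ℝ 0 0 f, by positivity, fun y =>
    (norm_coord_le_norm _ _).trans (SchwartzMap.norm_le_seminorm ℝ f y)⟩

theorem integrable_slice_pairing (T : 𝓢(Plane × Plane, ℂ)) (f : 𝓢(Plane, Spinor)) (β : Fin 2) :
    Integrable fun ξ => ∫ y, f y β * T (y, ξ) := by
  obtain ⟨C, -, hC⟩ := schwartz_le_mul T 3 3
  obtain ⟨D, hD0, hD⟩ := schwartz_coord_bound f β
  have : Integrable fun z : Plane × Plane => f z.2 β * T (z.2, z.1) := by
    refine ((integrable_inv_pow_prod.swap.const_mul C).const_mul D).mono'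
      (Continuous.aestronglyMeasurable
      (((continuous_comp_coord f β).comp continuous_snd).mul (T.continuous.comp (by fun_prop))))
      (Eventually.of_forall fun z => ?_)
    rw [norm_mul]
    exact mul_le_mul (hD _) (hC z.2 z.1) (norm_nonneg _) hD0
  exact this.integral_prod_left

theorem integral_kernel_eq_factor {S T : 𝓢(Plane × Plane, ℂ)}
    (hT : ∀ x y : Plane, S (x, y) = ∫ ξ, factorKernel x ξ * T (y, ξ)) (f : 𝓢(Plane, Spinor))
    (β : Fin 2) (x : Plane) :
    ∫ y, f y β * S (x, y) = ∫ ξ, factorKernel x ξ * ∫ y, f y β * T (y, ξ) := by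
  obtain ⟨C, -, hC⟩ := schwartz_le_mul T 3 3
  obtain ⟨D, hD0, hD⟩ := schwartz_coord_bound f β
  simp_rw [hT, ← integral_const_mul]
  rw [integral_integral_swap]
  · congr 1; ext ξ; congr 1; ext y; ring
  · refine ((integrable_inv_pow_prod.const_mul C).const_mul D).mono' (Continuous.aestronglyMeasurable
      (((continuous_comp_coord f β).comp continuous_fst).mul
        ((continuous_factorKernel_comp continuous_const continuous_snd).mul T.continuous)))
      (Eventually.of_forall fun z => ?_)
    simp only [Function.uncurry]
    rw [norm_mul]
    exact mul_le_mul (hD _) (norm_factorKernel_mul_le (T := T) x z.1 z.2 (hC z.1 z.2))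
      (norm_nonneg _) hD0

theorem integral_conj_mul_factor {b : Plane → ℂ} (hb : Integrable b) (f : 𝓢(Plane, Spinor))
    (α : Fin 2) : ∫ x, (starRingEnd ℂ) (f x α) * ∫ ξ, factorKernel x ξ * b ξ
      = ∫ ξ, b ξ * ∫ x, (starRingEnd ℂ) (f x α) * factorKernel x ξ := by
  simp_rw [← integral_const_mul]
  rw [integral_integral_swap]
  · congr 1; ext ξ; congr 1; ext x; ring
  · refine ((integrable_comp_coord f α).norm.mul_prod hb.norm).mono'
      (AEStronglyMeasurable.mul (Continuous.aestronglyMeasurable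
        (Complex.continuous_conj.comp ((continuous_comp_coord f α).comp continuous_fst)))
        (continuous_factorKernel.aestronglyMeasurable.mul hb.aestronglyMeasurable.comp_snd))
      (Eventually.of_forall fun z => ?_)
    simp only [Function.uncurry]
    rw [norm_mul, RCLike.norm_conj]
    exact mul_le_mul_of_nonneg_left
      (norm_factorKernel_mul_le (T := fun z => b z.2) z.1 z.1 z.2 le_rfl) (norm_nonneg _)

/-- After factorisation each term is an integral over `ξ` of a product of two coefficients in the
basis `e`, so the integrated Parseval identity sums the series. The right side is the diagonal of
the composed kernel; distinct spinor directions are orthogonal. -/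
theorem hasSum_trace_entry (e : HilbertBasis ℕ ℂ SpinorL2) (φ : ℕ → 𝓢(Plane, Spinor))
    (he : ∀ j, e j = (φ j).toLp 2 volume) (S : 𝓢(Plane × Plane, ℂ)) (α β : Fin 2) :
    HasSum (fun j => ∫ x, (starRingEnd ℂ) (φ j x α) * ∫ y, φ j y β * S (x, y))
      (if α = β then ∫ x, S (x, x) else 0) := by
  obtain ⟨T, hT⟩ := exists_factor S
  have key := hasSum_integral_inner_mul_inner (μ := volume) e (u := sliceL2 T β) (v := factorL2 α)
    (fun j => he j ▸ aestronglyMeasurable_inner_sliceL2 T β (φ j))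
    (fun j => he j ▸ aestronglyMeasurable_inner_factorL2 α (φ j))
    (integrable_norm_sliceL2_sq T β) (integrable_norm_factorL2_sq α)
  simp_rw [he, inner_sliceL2, inner_factorL2, inner_sliceL2_factorL2] at key
  convert! key using 1
  · ext j
    simp_rw [integral_kernel_eq_factor hT]
    exact integral_conj_mul_factor (integrable_slice_pairing T (φ j) β) (φ j) α
  · split_ifs with h
    · rw [integral_factor_diag]
      simp_rw [hT]
    · simp

end TraceFormula

/-! ### Position, momentum and spin operators -/

section Operators

variable {D : Type*} [NormedAddCommGroup D] [NormedSpace ℝ D]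

/-- The momentum operator `-iε∂_v`. -/
def momentumOp (ε : ℝ) (v : D) (F : 𝓢(D, Spinor)) : 𝓢(D, Spinor) :=
  (-(Complex.I * ε)) • (∂_{v} F : 𝓢(D, Spinor))

/-- Multiplication by a function of the position. -/
def mulOp (π : D →L[ℝ] Plane) (f : Plane → ℝ) (F : 𝓢(D, Spinor)) : 𝓢(D, Spinor) :=
  SchwartzMap.smulLeftCLM Spinor (fun z => f (π z)) F

/-- The Pauli matrices as operators on spinors. -/
def pauliCLM (s : Fin 4) : Spinor →L[ℂ] Spinor :=
  Matrix.toEuclideanCLM (n := Fin 2) (𝕜 := ℂ) (pauli s)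

/-- The pointwise action of a Pauli matrix. -/
def spinOp (s : Fin 4) (F : 𝓢(D, Spinor)) : 𝓢(D, Spinor) := SchwartzMap.postcompCLM (pauliCLM s) F

theorem momentumOp_apply (ε : ℝ) (v : D) (F : 𝓢(D, Spinor)) (z : D) :
    momentumOp ε v F z = (-(Complex.I * ε)) • fderiv ℝ F z v := by
  rw [momentumOp, smul_apply, SchwartzMap.lineDerivOp_apply_eq_fderiv]

theorem mulOp_apply (π : D →L[ℝ] Plane) {f : Plane → ℝ} (hf : Function.HasTemperateGrowth f)
    (F : 𝓢(D, Spinor)) (z : D) : mulOp π f F z = f (π z) • F z := by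
  exact SchwartzMap.smulLeftCLM_apply_apply (hf.comp π.hasTemperateGrowth) F z

@[simp] theorem spinOp_apply (s : Fin 4) (F : 𝓢(D, Spinor)) (z : D) :
    spinOp s F z = pauliCLM s (F z) := rfl

/-- The commutator of momentum and position. Its term `-iε ∂f` later falls out of traces because it
contributes only an imaginary part. -/
theorem momentumOp_mulOp_apply (ε : ℝ) (v : D) (π : D →L[ℝ] Plane) {f : Plane → ℝ}
    (hf : Function.HasTemperateGrowth f) (F : 𝓢(D, Spinor)) (z : D) :
    momentumOp ε v (mulOp π f F) z
      = f (π z) • momentumOp ε v F z + (-(Complex.I * ε)) • fderiv ℝ f (π z) (π v) • F z := by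
  have hfd : HasFDerivAt (fun z => f (π z)) ((fderiv ℝ f (π z)).comp (π : D →L[ℝ] Plane)) z :=
    (((hf.1.differentiable (by simp)) _).hasFDerivAt).comp z π.hasFDerivAt
  have h := hfd.smul (F.hasFDerivAt z)
  have he : (mulOp π f F : D → Spinor) = (fun z => f (π z)) • (F : D → Spinor) :=
    funext fun z => mulOp_apply π hf F z
  rw [momentumOp_apply, momentumOp_apply, he, h.fderiv]
  simp only [_root_.add_apply, smul_apply, ContinuousLinearMap.smulRight_apply,
    ContinuousLinearMap.comp_apply, smul_add]
  rw [smul_comm]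

/-- Multipliers of temperate growth. -/
structure Multipliers.Temperate (ξ : Multipliers) : Prop where
  A : Function.HasTemperateGrowth ξ.A
  B : Function.HasTemperateGrowth ξ.B
  U : Function.HasTemperateGrowth ξ.U

theorem temperate_coord {ι : Type*} [Fintype ι] {f : Plane → ι → ℝ}
    (hf : Function.HasTemperateGrowth f) (i : ι) :
    Function.HasTemperateGrowth fun r => f r i :=
  (ContinuousLinearMap.proj (R := ℝ) (φ := fun _ : ι => ℝ) i).hasTemperateGrowth.comp hf

/-- The quantization of the part of the modified Hamiltonian that depends on the multipliers. -/
def driftOp (ε : ℝ) (π : D →L[ℝ] Plane) (v : Fin 2 → D) (ξ : Multipliers) (F : 𝓢(D, Spinor)) :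
    𝓢(D, Spinor) :=
  mulOp π ξ.A F + ∑ s : Fin 3, mulOp π (fun r => ξ.B r s) (spinOp s.succ F)
    + ∑ k, (1 / 2 : ℝ) • (mulOp π (fun r => ξ.U r k) (momentumOp ε (v k) F)
        + momentumOp ε (v k) (mulOp π (fun r => ξ.U r k) F))

/-- The quantization of the part of the modified Hamiltonian common to all multipliers. -/
def kineticOp (ε c : ℝ) (F : 𝓢(Plane, Spinor)) : 𝓢(Plane, Spinor) :=
  ∑ k, (1 / 2 : ℝ) • momentumOp ε (unitVec k) (momentumOp ε (unitVec k) F)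
    + ∑ k : Fin 2, c • momentumOp ε (unitVec k) (spinOp k.castSucc.succ F)

end Operators

/-! ### Symmetry of the operators on Schwartz spinors -/

section Symmetry

local notation "⟪" x ", " y "⟫" => inner ℂ x y

/-- Schwartz spinors as elements of `L²`. -/
def toL2 : 𝓢(Plane, Spinor) →L[ℂ] SpinorL2 := SchwartzMap.toLpCLM ℂ Spinor 2 volume

theorem inner_toL2 (f g : 𝓢(Plane, Spinor)) : ⟪toL2 f, toL2 g⟫ = ∫ x, ⟪f x, g x⟫ :=
  inner_toLp_toLp (f.memLp 2 volume) (g.memLp 2 volume)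

theorem toL2_real_smul (a : ℝ) (f : 𝓢(Plane, Spinor)) : toL2 (a • f) = (a : ℂ) • toL2 f := by
  rw [← map_smul]; rfl

/-- Symmetric operators on Schwartz spinors. -/
def IsSymm (T : 𝓢(Plane, Spinor) → 𝓢(Plane, Spinor)) : Prop :=
  ∀ f g, ⟪toL2 f, toL2 (T g)⟫ = ⟪toL2 (T f), toL2 g⟫

variable {S T : 𝓢(Plane, Spinor) → 𝓢(Plane, Spinor)}

theorem IsSymm.add (hS : IsSymm S) (hT : IsSymm T) : IsSymm fun f => S f + T f := fun f g => by
  rw [map_add, map_add, inner_add_left, inner_add_right, hS, hT]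

theorem IsSymm.sub (hS : IsSymm S) (hT : IsSymm T) : IsSymm fun f => S f - T f := fun f g => by
  rw [map_sub, map_sub, inner_sub_left, inner_sub_right, hS, hT]

theorem IsSymm.real_smul (hS : IsSymm S) (a : ℝ) : IsSymm fun f => a • S f := fun f g => by
  rw [toL2_real_smul, toL2_real_smul, inner_smul_left, inner_smul_right, hS, Complex.conj_ofReal]

theorem IsSymm.sum {ι : Type*} (s : Finset ι) {S : ι → 𝓢(Plane, Spinor) → 𝓢(Plane, Spinor)}
    (hS : ∀ i, IsSymm (S i)) : IsSymm fun f => ∑ i ∈ s, S i f := fun f g => by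
  rw [map_sum, map_sum, sum_inner, inner_sum]
  exact Finset.sum_congr rfl fun i _ => hS i f g

theorem IsSymm.anticommutator (hS : IsSymm S) (hT : IsSymm T) :
    IsSymm fun f => S (T f) + T (S f) := fun f g => by
  rw [map_add, map_add, inner_add_left, inner_add_right, hS, hT, hT, hS, add_comm]

theorem IsSymm.comp_self (hS : IsSymm S) : IsSymm fun f => S (S f) := fun f g => by
  rw [hS, hS]

theorem IsSymm.comp_of_commute (hS : IsSymm S) (hT : IsSymm T) (h : ∀ f, S (T f) = T (S f)) :
    IsSymm fun f => S (T f) := fun f g => by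
  rw [hS, hT, ← h]

theorem isSymm_mulOp {f : Plane → ℝ} (hf : Function.HasTemperateGrowth f) :
    IsSymm (mulOp (ContinuousLinearMap.id ℝ Plane) f) := fun φ ψ => by
  rw [inner_toL2, inner_toL2]
  congr 1; ext x
  rw [mulOp_apply _ hf, mulOp_apply _ hf, ← Complex.coe_smul, ← Complex.coe_smul, inner_smul_left,
    inner_smul_right, Complex.conj_ofReal]

theorem isSymm_momentumOp (ε : ℝ) (v : Plane) : IsSymm (momentumOp ε v) := fun φ ψ => by
  have h := SchwartzMap.integral_bilinear_lineDerivOp_right_eq_neg_left (μ := volume) φ ψ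
    (isBoundedBilinearMap_inner (𝕜 := ℂ) (E := Spinor)).toContinuousLinearMap v
  simp only [IsBoundedBilinearMap.toContinuousLinearMap_apply] at h
  rw [momentumOp, momentumOp, map_smul, map_smul, inner_smul_left, inner_smul_right, inner_toL2,
    inner_toL2, h]
  simp

theorem inner_pauliCLM (s : Fin 4) (u v : Spinor) :
    ⟪u, pauliCLM s v⟫ = ⟪pauliCLM s u, v⟫ := by
  have h : ContinuousLinearMap.adjoint (pauliCLM s) = pauliCLM s := by
    have h1 : (pauli s).conjTranspose = pauli s := by
      ext i j
      fin_cases s <;> fin_cases i <;> fin_cases j <;> simp [pauli]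
    rw [← ContinuousLinearMap.star_eq_adjoint, pauliCLM, ← map_star, Matrix.star_eq_conjTranspose,
      h1]
  rw [← ContinuousLinearMap.adjoint_inner_left, h]

theorem isSymm_spinOp (s : Fin 4) : IsSymm (spinOp (D := Plane) s) := fun φ ψ => by
  rw [inner_toL2, inner_toL2]
  simp_rw [spinOp_apply, inner_pauliCLM]

theorem mulOp_spinOp {D : Type*} [NormedAddCommGroup D] [NormedSpace ℝ D] (π : D →L[ℝ] Plane)
    {f : Plane → ℝ} (hf : Function.HasTemperateGrowth f) (s : Fin 4)
    (F : 𝓢(D, Spinor)) : mulOp π f (spinOp s F) = spinOp s (mulOp π f F) := by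
  ext1 z
  rw [mulOp_apply π hf, spinOp_apply, spinOp_apply, mulOp_apply π hf, ← Complex.coe_smul,
    ← Complex.coe_smul, map_smul]

theorem momentumOp_spinOp {D : Type*} [NormedAddCommGroup D] [NormedSpace ℝ D] (ε : ℝ) (v : D)
    (s : Fin 4) (F : 𝓢(D, Spinor)) : momentumOp ε v (spinOp s F) = spinOp s (momentumOp ε v F) := by
  ext1 z
  have h := ((pauliCLM s).restrictScalars ℝ).hasFDerivAt.comp z (F.hasFDerivAt z)
  have he : (spinOp s F : D → Spinor) = (pauliCLM s).restrictScalars ℝ ∘ F := rfl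
  rw [momentumOp_apply, spinOp_apply, momentumOp_apply, he, h.fderiv, map_smul]
  rfl

theorem isSymm_driftOp (ε : ℝ) {ξ : Multipliers} (hξ : ξ.Temperate) :
    IsSymm (driftOp ε (ContinuousLinearMap.id ℝ Plane) unitVec ξ) := by
  unfold driftOp
  refine ((isSymm_mulOp hξ.A).add (IsSymm.sum _ fun s => ?_)).add (IsSymm.sum _ fun k => ?_)
  · exact (isSymm_mulOp (temperate_coord hξ.B s)).comp_of_commute (isSymm_spinOp _)
      fun f => mulOp_spinOp _ (temperate_coord hξ.B s) _ f
  · exact ((isSymm_mulOp (temperate_coord hξ.U k)).anticommutator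
      (isSymm_momentumOp ε (unitVec k))).real_smul _

theorem isSymm_kineticOp (ε c : ℝ) : IsSymm (kineticOp ε c) := by
  unfold kineticOp
  refine (IsSymm.sum _ fun k => ?_).add (IsSymm.sum _ fun k => ?_)
  · exact (isSymm_momentumOp ε (unitVec k)).comp_self.real_smul _
  · exact ((isSymm_momentumOp ε (unitVec k)).comp_of_commute (isSymm_spinOp _)
      fun f => momentumOp_spinOp _ _ _ f).real_smul _

end Symmetry

/-! ### Weyl quantization of the modified Hamiltonian -/

section WeylSymbol

/-- Iterated momentum operators. -/
def momentumList (ε : ℝ) : List (Fin 2) → 𝓢(Plane, Spinor) → 𝓢(Plane, Spinor)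
  | [], F => F
  | k :: l, F => momentumOp ε (unitVec k) (momentumList ε l F)

variable {ε : ℝ}

theorem neg_inv_ne_zero' (hε : ε ≠ 0) : -ε⁻¹ ≠ 0 := neg_ne_zero.2 (inv_ne_zero hε)

theorem mono_smul_ft (hε : ε ≠ 0) (l : List (Fin 2)) (F : 𝓢(Plane, Spinor)) (p : Plane) :
    mono l p • ft (-ε⁻¹) F p = ft (-ε⁻¹) (momentumList ε l F) p := by
  induction l with
  | nil => simp [momentumList]
  | cons k l ih =>
    rw [mono_cons, mul_smul, ih, coord_smul_ft (neg_inv_ne_zero' hε), momentumList, momentumOp]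
    congr 3
    have : (ε : ℂ) ≠ 0 := by exact_mod_cast hε
    push_cast
    field_simp

theorem integral_phase_mono_smul_ft (hε : ε ≠ 0) (l : List (Fin 2)) (F : 𝓢(Plane, Spinor))
    (x : Plane) : ∫ p, phase ε⁻¹ x p • mono l p • ft (-ε⁻¹) F p
      = ((2 * Real.pi * ε) ^ 2) • momentumList ε l F x := by
  simp_rw [mono_smul_ft hε]
  have h := integral_phase_ft (neg_inv_ne_zero' hε) (momentumList ε l F) x
  rw [neg_neg] at h
  rw [h]
  congr 1
  field_simp

theorem continuous_phase_right (c : ℝ) (x : Plane) : Continuous fun p => phase c x p :=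
  (continuous_phase c).comp (continuous_const.prodMk continuous_id)

theorem continuous_phase_left (c : ℝ) (p : Plane) : Continuous fun x => phase c x p :=
  (continuous_phase c).comp (continuous_id.prodMk continuous_const)

theorem integrable_unimodular_smul {E : Type*} [NormedAddCommGroup E] [NormedSpace ℂ E]
    {u : Plane → ℂ} (hu : Continuous u) (h1 : ∀ x, ‖u x‖ = 1) {F : Plane → E}
    (hF : Integrable F) : Integrable fun x => u x • F x :=
  hF.norm.mono' (hu.aestronglyMeasurable.smul hF.aestronglyMeasurable)
    (Eventually.of_forall fun x => by rw [norm_smul, h1, one_mul])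

/-- For a symbol polynomial in `p` the integral over `y` is a Fourier transform and the integral
over `p` inverts it. The `Ψ i` may depend on `x` through the midpoint: momentum operators act on
them with `x` frozen, and evaluation at `x` comes last. -/
theorem weylOp_eq_sum (hε : ε ≠ 0) {ι : Type*} [Fintype ι]
    {a : Plane → Plane → Matrix (Fin 2) (Fin 2) ℂ} {ψ : Plane → Spinor} {x : Plane}
    (l : ι → List (Fin 2)) (Ψ : ι → 𝓢(Plane, Spinor))
    (h : ∀ y p, (WithLp.toLp 2 (a ((1 / 2 : ℝ) • (x + y)) p *ᵥ (ψ y).ofLp) : Spinor)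
      = ∑ i, mono (l i) p • Ψ i y) :
    weylOp ε a ψ x = ∑ i, momentumList ε (l i) (Ψ i) x := by
  have h1 (p : Plane) : ∫ y : Plane, Complex.exp (Complex.I * ((inner ℝ (x - y) p / ε : ℝ) : ℂ)) •
        (WithLp.toLp 2 (a ((1 / 2 : ℝ) • (x + y)) p *ᵥ (ψ y).ofLp) : Spinor)
      = ∑ i, phase ε⁻¹ x p • mono (l i) p • ft (-ε⁻¹) (Ψ i) p := by
    have h2 (y : Plane) : Complex.exp (Complex.I * ((inner ℝ (x - y) p / ε : ℝ) : ℂ))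
        = phase ε⁻¹ x p * phase (-ε⁻¹) y p := by
      rw [← phase_sub_left, phase, div_eq_inv_mul]
    simp_rw [h, h2, Finset.smul_sum]
    rw [integral_finsetSum]
    · refine Finset.sum_congr rfl fun i _ => ?_
      rw [ft, ← integral_smul, ← integral_smul]
      congr 1; ext1 y
      rw [mul_smul, smul_comm (mono (l i) p)]
    · intro i _
      refine integrable_unimodular_smul ?_ (fun y => by simp)
        ((Ψ i).integrable.smul (mono (l i) p))
      exact continuous_const.mul (continuous_phase_left _ _)
  rw [weylOp]
  simp_rw [h1]
  rw [integral_finsetSum, Finset.smul_sum]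
  · refine Finset.sum_congr rfl fun i _ => ?_
    rw [integral_phase_mono_smul_ft hε, Complex.coe_smul, smul_smul, inv_mul_cancel₀, one_smul]
    have := Real.pi_ne_zero
    positivity
  · intro i _
    simp_rw [mono_smul_ft hε]
    exact integrable_unimodular_smul (continuous_phase_right _ _) (fun y => by simp)
      (integrable_ft (neg_inv_ne_zero' hε) _)

theorem toLp_pauliMatrix_mulVec (a : Fin 4 → ℝ) (v : Spinor) :
    (WithLp.toLp 2 (pauliMatrix a *ᵥ v.ofLp) : Spinor) = ∑ s, a s • pauliCLM s v := by
  ext i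
  rw [pauliMatrix, Matrix.sum_mulVec]
  simp only [Finset.sum_apply, Matrix.smul_mulVec, Pi.smul_apply, WithLp.ofLp_sum, WithLp.ofLp_smul]
  rfl

theorem temperate_midpoint {f : Plane → ℝ} (hf : Function.HasTemperateGrowth f) (x : Plane) :
    Function.HasTemperateGrowth fun y => f ((1 / 2 : ℝ) • (x + y)) :=
  hf.comp (by fun_prop)

/-- Multiplication by a function of the midpoint with `x`. -/
def midOp (x : Plane) (f : Plane → ℝ) (F : 𝓢(Plane, Spinor)) : 𝓢(Plane, Spinor) :=
  SchwartzMap.smulLeftCLM Spinor (fun y => f ((1 / 2 : ℝ) • (x + y))) F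

theorem midOp_apply (x : Plane) {f : Plane → ℝ} (hf : Function.HasTemperateGrowth f)
    (F : 𝓢(Plane, Spinor)) (y : Plane) : midOp x f F y = f ((1 / 2 : ℝ) • (x + y)) • F y :=
  SchwartzMap.smulLeftCLM_apply_apply (temperate_midpoint hf x) F y

theorem midOp_apply_self (x : Plane) {f : Plane → ℝ} (hf : Function.HasTemperateGrowth f)
    (F : 𝓢(Plane, Spinor)) : midOp x f F x = mulOp (ContinuousLinearMap.id ℝ Plane) f F x := by
  rw [midOp_apply x hf, mulOp_apply _ hf, ← two_smul ℝ x, smul_smul]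
  norm_num

/-- A function of the midpoint is differentiated with a factor `1/2`, while `f P + P f` contains the
full derivative once, halved by the prefactor: this is the symmetric ordering of Weyl quantization.
-/
theorem momentumOp_midOp_apply_self (x : Plane) {f : Plane → ℝ}
    (hf : Function.HasTemperateGrowth f) (F : 𝓢(Plane, Spinor)) (v : Plane) :
    momentumOp ε v (midOp x f F) x = (1 / 2 : ℝ) •
      (mulOp (ContinuousLinearMap.id ℝ Plane) f (momentumOp ε v F) x
        + momentumOp ε v (mulOp (ContinuousLinearMap.id ℝ Plane) f F) x) := by
  have hx : (1 / 2 : ℝ) • (x + x) = x := by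
    rw [← two_smul ℝ x, smul_smul]; norm_num
  have hm : HasFDerivAt (fun y : Plane => (1 / 2 : ℝ) • (x + y))
      ((1 / 2 : ℝ) • ContinuousLinearMap.id ℝ Plane) x :=
    ((hasFDerivAt_id x).const_add x).const_smul (1 / 2 : ℝ)
  have hfd : HasFDerivAt (fun y => f ((1 / 2 : ℝ) • (x + y)))
      ((fderiv ℝ f ((1 / 2 : ℝ) • (x + x))).comp ((1 / 2 : ℝ) • ContinuousLinearMap.id ℝ Plane)) x :=
    HasFDerivAt.comp (f := fun y : Plane => (1 / 2 : ℝ) • (x + y)) x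
      (((hf.1.differentiable (by simp)) _).hasFDerivAt) hm
  have h := hfd.smul (F.hasFDerivAt x)
  have he : (midOp x f F : Plane → Spinor)
      = (fun y => f ((1 / 2 : ℝ) • (x + y))) • (F : Plane → Spinor) :=
    funext fun z => midOp_apply x hf F z
  rw [momentumOp_mulOp_apply ε v _ hf, mulOp_apply _ hf, momentumOp_apply, momentumOp_apply, he,
    h.fderiv, hx]
  simp only [_root_.add_apply, smul_apply, ContinuousLinearMap.smulRight_apply,
    ContinuousLinearMap.comp_apply, ContinuousLinearMap.id_apply, map_smul, smul_add, smul_smul,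
    smul_eq_mul]
  simp only [← Complex.coe_smul, smul_smul]
  rw [← add_assoc, ← add_smul]
  congr 2 <;> push_cast <;> ring

theorem weylOp_neg_modifiedHamiltonian (hε : ε ≠ 0) (c : ℝ) {ξ : Multipliers} (hξ : ξ.Temperate)
    (ψ : 𝓢(Plane, Spinor)) (x : Plane) :
    weylOp ε (fun r p => pauliMatrix (-modifiedHamiltonian c ξ r p)) ψ x
      = -(kineticOp ε c ψ x + driftOp ε (ContinuousLinearMap.id ℝ Plane) unitVec ξ ψ x) := by
  -- The summands correspond, in this order, to `|p|²/2`, `c p_k σ_k`, `p_k ξ₀ᵏ`, `ξ₀⁰` and `ξ_s⁰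
  -- σ_s`, with the sign of `-h_ξ` absorbed in the functions.
  rw [weylOp_eq_sum (ι := (Fin 2 ⊕ Fin 2) ⊕ (Fin 2 ⊕ (Unit ⊕ Fin 3))) hε
    (Sum.elim (Sum.elim (fun k => [k, k]) (fun k => [k]))
      (Sum.elim (fun k => [k]) (fun _ => [])))
    (Sum.elim (Sum.elim (fun _ => (-(1 / 2 : ℝ)) • ψ) (fun k => (-c) • spinOp k.castSucc.succ ψ))
      (Sum.elim (fun k => -midOp x (fun r => ξ.U r k) ψ)
        (Sum.elim (fun _ => -midOp x ξ.A ψ)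
          (fun s => -midOp x (fun r => ξ.B r s) (spinOp s.succ ψ)))))]
  · simp only [Fintype.sum_sum_type, Sum.elim_inl, Sum.elim_inr, momentumList]
    have hneg (v : Plane) (F : 𝓢(Plane, Spinor)) : momentumOp ε v (-F) = -momentumOp ε v F := by
      simp only [momentumOp, LineDeriv.lineDerivOp_neg, smul_neg]
    have hsm (a : ℝ) (v : Plane) (F : 𝓢(Plane, Spinor)) :
        momentumOp ε v (a • F) = a • momentumOp ε v F := by
      simp only [momentumOp, LineDeriv.lineDerivOp_smul]
      rw [smul_comm]
    have hA := midOp_apply_self x hξ.A ψ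
    have hB (s : Fin 3) := midOp_apply_self x (temperate_coord hξ.B s) (spinOp s.succ ψ)
    have hU (k : Fin 2) := momentumOp_midOp_apply_self (ε := ε) x (temperate_coord hξ.U k) ψ
      (unitVec k)
    simp only [hneg, hsm, neg_apply, smul_apply, hA, hB, hU, kineticOp, driftOp, add_apply,
      sum_apply, Finset.univ_unique, Finset.sum_singleton, Finset.sum_neg_distrib, neg_smul]
    abel
  · intro y p
    rw [toLp_pauliMatrix_mulVec, Fin.sum_univ_succ]
    simp only [Fintype.sum_sum_type, Sum.elim_inl, Sum.elim_inr, mono_cons, mono_nil, mul_one,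
      neg_apply, smul_apply, midOp_apply x hξ.A, midOp_apply x (temperate_coord hξ.B _),
      midOp_apply x (temperate_coord hξ.U _), modifiedHamiltonian, Pi.neg_apply, Fin.cons_zero,
      Fin.cons_succ, spinOp_apply, Finset.univ_unique, Finset.sum_singleton, Fin.sum_univ_two,
      Fin.sum_univ_three, EuclideanSpace.real_norm_sq_eq, vec3]
    have h0 : pauliCLM 0 (ψ y) = ψ y := by
      ext i
      fin_cases i <;> simp [pauliCLM, pauli] <;> rfl
    simp [h0]
    module

end WeylSymbol

/-! ### Operators acting on kernels -/

section KernelRepresentation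

/-- `ψ = ∫ K(·, y) φ(y) dy` for the kernel with the columns `K`. -/
def KernelRep (ψ φ : 𝓢(Plane, Spinor)) (K : Fin 2 → 𝓢(Plane × Plane, Spinor)) : Prop :=
  ∀ x, ψ x = ∑ β, ∫ y, φ y β • K β (x, y)

/-- The operator `T` on spinors is the operator `T'` acting on the first variable of kernels. -/
def Intertwines (T : 𝓢(Plane, Spinor) → 𝓢(Plane, Spinor))
    (T' : 𝓢(Plane × Plane, Spinor) → 𝓢(Plane × Plane, Spinor)) : Prop :=
  ∀ ψ φ K, KernelRep ψ φ K → KernelRep (T ψ) φ fun β => T' (K β)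

theorem integrable_coord_smul_kernel (φ : 𝓢(Plane, Spinor)) (K : 𝓢(Plane × Plane, Spinor))
    (β : Fin 2) (x : Plane) : Integrable fun y => φ y β • K (x, y) := by
  have hK : Continuous fun y => K (x, y) := K.continuous.comp (by fun_prop)
  refine (((integrable_comp_coord φ β).norm).mul_const (SchwartzMap.seminorm ℝ 0 0 K)).mono'
    ((continuous_comp_coord φ β).smul hK).aestronglyMeasurable (Eventually.of_forall fun y => ?_)
  rw [norm_smul]
  gcongr
  exact SchwartzMap.norm_le_seminorm ℝ K _

variable {S T : 𝓢(Plane, Spinor) → 𝓢(Plane, Spinor)}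
  {S' T' : 𝓢(Plane × Plane, Spinor) → 𝓢(Plane × Plane, Spinor)}

theorem Intertwines.add (hS : Intertwines S S') (hT : Intertwines T T') :
    Intertwines (fun f => S f + T f) fun f => S' f + T' f := fun ψ φ K h x => by
  simp only [add_apply, smul_add]
  rw [hS ψ φ K h x, hT ψ φ K h x, ← Finset.sum_add_distrib]
  refine Finset.sum_congr rfl fun β _ => ?_
  rw [← integral_add (integrable_coord_smul_kernel φ _ β x)
    (integrable_coord_smul_kernel φ _ β x)]

theorem Intertwines.sub (hS : Intertwines S S') (hT : Intertwines T T') :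
    Intertwines (fun f => S f - T f) fun f => S' f - T' f := fun ψ φ K h x => by
  simp only [sub_apply, smul_sub]
  rw [hS ψ φ K h x, hT ψ φ K h x, ← Finset.sum_sub_distrib]
  refine Finset.sum_congr rfl fun β _ => ?_
  rw [← integral_sub (integrable_coord_smul_kernel φ _ β x)
    (integrable_coord_smul_kernel φ _ β x)]

theorem Intertwines.comp (hS : Intertwines S S') (hT : Intertwines T T') :
    Intertwines (fun f => S (T f)) fun f => S' (T' f) := fun _ _ _ h =>
  hS _ _ _ (hT _ _ _ h)

theorem Intertwines.real_smul (hS : Intertwines S S') (a : ℝ) :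
    Intertwines (fun f => a • S f) fun f => a • S' f := fun ψ φ K h x => by
  simp only [smul_apply]
  rw [hS ψ φ K h x, Finset.smul_sum]
  refine Finset.sum_congr rfl fun β _ => ?_
  rw [← integral_smul]
  congr 1; ext1 y
  rw [smul_comm]

theorem Intertwines.sum {ι : Type*} (s : Finset ι) {S : ι → 𝓢(Plane, Spinor) → 𝓢(Plane, Spinor)}
    {S' : ι → 𝓢(Plane × Plane, Spinor) → 𝓢(Plane × Plane, Spinor)}
    (h : ∀ i, Intertwines (S i) (S' i)) :
    Intertwines (fun f => ∑ i ∈ s, S i f) fun f => ∑ i ∈ s, S' i f := by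
  classical
  induction s using Finset.induction_on with
  | empty =>
    intro ψ φ K _ x
    simp
  | insert i s hi ih =>
    simp_rw [Finset.sum_insert hi]
    exact (h i).add ih

theorem intertwines_mulOp {f : Plane → ℝ} (hf : Function.HasTemperateGrowth f) :
    Intertwines (mulOp (ContinuousLinearMap.id ℝ Plane) f)
      (mulOp (ContinuousLinearMap.fst ℝ Plane Plane) f) := fun ψ φ K h x => by
  simp only [mulOp_apply _ hf, ContinuousLinearMap.id_apply, ContinuousLinearMap.coe_fst']
  rw [h x, Finset.smul_sum]
  refine Finset.sum_congr rfl fun β _ => ?_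
  rw [← integral_smul]
  congr 1; ext1 y
  rw [smul_comm]

theorem intertwines_spinOp (s : Fin 4) : Intertwines (spinOp s) (spinOp s) := fun ψ φ K h x => by
  simp only [spinOp_apply]
  rw [h x, map_sum]
  refine Finset.sum_congr rfl fun β _ => ?_
  rw [← ContinuousLinearMap.integral_comp_comm _ (integrable_coord_smul_kernel φ _ β x)]
  simp_rw [map_smul]

theorem hasFDerivAt_kernel_integral (φ : 𝓢(Plane, Spinor)) (K : 𝓢(Plane × Plane, Spinor))
    (β : Fin 2) (x : Plane) :
    HasFDerivAt (fun x => ∫ y, φ y β • K (x, y))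
      (∫ y, φ y β • (fderiv ℝ K (x, y)).comp (ContinuousLinearMap.inl ℝ Plane Plane)) x ∧
    Integrable fun y => φ y β • (fderiv ℝ K (x, y)).comp (ContinuousLinearMap.inl ℝ Plane Plane) := by
  set K' := SchwartzMap.fderivCLM ℝ (Plane × Plane) Spinor K with hK'
  have hb (x y : Plane) : ‖φ y β • (fderiv ℝ K (x, y)).comp (ContinuousLinearMap.inl ℝ Plane Plane)‖
      ≤ ‖φ y β‖ * SchwartzMap.seminorm ℝ 0 0 K' := by
    rw [norm_smul]
    gcongr
    calc _ ≤ ‖fderiv ℝ K (x, y)‖ * ‖ContinuousLinearMap.inl ℝ Plane Plane‖ :=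
          ContinuousLinearMap.opNorm_comp_le _ _
      _ ≤ ‖fderiv ℝ K (x, y)‖ * 1 := by
          gcongr; exact ContinuousLinearMap.norm_inl_le_one ℝ Plane Plane
      _ ≤ _ := by rw [mul_one]; exact SchwartzMap.norm_le_seminorm ℝ K' (x, y)
  have hm (x : Plane) : AEStronglyMeasurable
      (fun y => φ y β • (fderiv ℝ K (x, y)).comp (ContinuousLinearMap.inl ℝ Plane Plane)) volume := by
    have h1 : Continuous fun y => fderiv ℝ K (x, y) :=
      K'.continuous.comp (by fun_prop : Continuous fun y : Plane => (x, y))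
    exact ((continuous_comp_coord φ β).smul (h1.clm_comp continuous_const)).aestronglyMeasurable
  have hi : Integrable fun y => ‖φ y β‖ * SchwartzMap.seminorm ℝ 0 0 K' :=
    (integrable_comp_coord φ β).norm.mul_const _
  refine ⟨?_, hi.mono' (hm x) (Eventually.of_forall fun y => hb x y)⟩
  refine hasFDerivAt_integral_of_dominated_of_fderiv_le
    (F := fun x y => φ y β • K (x, y))
    (F' := fun x y => φ y β • (fderiv ℝ K (x, y)).comp (ContinuousLinearMap.inl ℝ Plane Plane))
    univ_mem
    (Eventually.of_forall fun x => (integrable_coord_smul_kernel φ K β x).aestronglyMeasurable)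
    (integrable_coord_smul_kernel φ K β x) (hm x)
    (Eventually.of_forall fun y x _ => hb x y) hi (Eventually.of_forall fun y x _ => ?_)
  exact (HasFDerivAt.comp (f := fun x : Plane => (x, y)) x (K.hasFDerivAt (x, y))
    (hasFDerivAt_prodMk_left x y)).const_smul (φ y β)

/-- The variable `x` occurs only in the first slot of the kernel, so differentiating the represented
function differentiates the kernel there. -/
theorem intertwines_momentumOp (ε : ℝ) (v : Plane) :
    Intertwines (momentumOp ε v) (momentumOp ε (v, 0)) := fun ψ φ K h x => by
  have hψ : (ψ : Plane → Spinor) = fun x => ∑ β, ∫ y, φ y β • K β (x, y) := funext h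
  have hd : HasFDerivAt (ψ : Plane → Spinor) (∑ β : Fin 2,
      ∫ y, φ y β • (fderiv ℝ (K β) (x, y)).comp (ContinuousLinearMap.inl ℝ Plane Plane)) x := by
    rw [hψ]
    exact HasFDerivAt.fun_sum fun β _ => (hasFDerivAt_kernel_integral φ (K β) β x).1
  rw [momentumOp_apply, hd.fderiv]
  simp only [momentumOp_apply, _root_.sum_apply]
  rw [Finset.smul_sum]
  refine Finset.sum_congr rfl fun β _ => ?_
  rw [ContinuousLinearMap.integral_apply (hasFDerivAt_kernel_integral φ (K β) β x).2,
    ← integral_smul]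
  congr 1; ext1 y
  rw [smul_comm]
  simp

theorem intertwines_driftOp (ε : ℝ) {ξ : Multipliers} (hξ : ξ.Temperate) :
    Intertwines (driftOp ε (ContinuousLinearMap.id ℝ Plane) unitVec ξ)
      (driftOp ε (ContinuousLinearMap.fst ℝ Plane Plane) (fun k => (unitVec k, 0)) ξ) := by
  unfold driftOp
  refine ((intertwines_mulOp hξ.A).add (Intertwines.sum _ fun s => ?_)).add
    (Intertwines.sum _ fun k => ?_)
  · exact (intertwines_mulOp (temperate_coord hξ.B s)).comp (intertwines_spinOp _)
  · have h1 := intertwines_mulOp (temperate_coord hξ.U k)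
    have h2 := intertwines_momentumOp ε (unitVec k)
    exact ((h1.comp h2).add (h2.comp h1)).real_smul _

end KernelRepresentation

/-! ### Trace of an operator with a spinor kernel -/

section KernelTrace

local notation "⟪" x ", " y "⟫" => inner ℂ x y

/-- The pointwise trace of a kernel on the diagonal. -/
def diagTrace (K : Fin 2 → 𝓢(Plane × Plane, Spinor)) (x : Plane) : ℂ := ∑ α, K α (x, x) α

/-- A component of a spinor-valued kernel. -/
def spinorComp (α : Fin 2) (F : 𝓢(Plane × Plane, Spinor)) : 𝓢(Plane × Plane, ℂ) :=
  SchwartzMap.postcompCLM (EuclideanSpace.proj α : Spinor →L[ℂ] ℂ) F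

theorem spinorComp_apply (α : Fin 2) (F : 𝓢(Plane × Plane, Spinor)) (z : Plane × Plane) :
    spinorComp α F z = F z α := rfl

theorem integrable_diag (S : 𝓢(Plane × Plane, ℂ)) : Integrable fun x => S (x, x) := by
  obtain ⟨C, -, hC⟩ := schwartz_le_mul S 3 0
  refine ((integrable_inv_pow le_rfl).const_mul C).mono'
    (S.continuous.comp (by fun_prop)).aestronglyMeasurable (Eventually.of_forall fun x => ?_)
  simpa using hC x x

theorem integrable_diagTrace (K : Fin 2 → 𝓢(Plane × Plane, Spinor)) :
    Integrable (diagTrace K) :=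
  integrable_finsetSum _ fun α _ => integrable_diag (spinorComp α (K α))

/-- The scalar trace formula applied to the four entries of the matrix kernel; the off-diagonal ones
contribute nothing. Together with `Intertwines` it computes `Tr (T ρ)` for an unbounded `T`, by
letting `T` act on the kernel of `ρ`. -/
theorem hasSum_trace {e : HilbertBasis ℕ ℂ SpinorL2} {φ ψ : ℕ → 𝓢(Plane, Spinor)}
    (he : ∀ j, e j = toL2 (φ j)) {K : Fin 2 → 𝓢(Plane × Plane, Spinor)}
    (h : ∀ j, KernelRep (ψ j) (φ j) K) :
    HasSum (fun j => ⟪toL2 (φ j), toL2 (ψ j)⟫) (∫ x, diagTrace K x) := by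
  have hab (α β : Fin 2) := hasSum_trace_entry e φ he (spinorComp α (K β)) α β
  have hs := hasSum_sum (s := Finset.univ) fun α _ =>
    hasSum_sum (s := Finset.univ) fun β _ => hab α β
  have hint (j : ℕ) (α β : Fin 2) :
      Integrable fun x => (starRingEnd ℂ) (φ j x α) * ∫ y, φ j y β * spinorComp α (K β) (x, y) := by
    have hb (x : Plane) : ‖∫ y, φ j y β * spinorComp α (K β) (x, y)‖
        ≤ ∫ y, ‖φ j y β‖ * SchwartzMap.seminorm ℝ 0 0 (spinorComp α (K β)) := by
      refine norm_integral_le_of_norm_le ((integrable_comp_coord (φ j) β).norm.mul_const _)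
        (Eventually.of_forall fun y => ?_)
      rw [norm_mul]
      gcongr
      exact SchwartzMap.norm_le_seminorm ℝ _ _
    refine ((integrable_comp_coord (φ j) α).norm.mul_const
      (∫ y, ‖φ j y β‖ * SchwartzMap.seminorm ℝ 0 0 (spinorComp α (K β)))).mono' ?_
      (Eventually.of_forall fun x => ?_)
    · refine (Complex.continuous_conj.comp (continuous_comp_coord (φ j) α)).aestronglyMeasurable.mul ?_
      exact AEStronglyMeasurable.integral_prod_right'
        (f := fun z : Plane × Plane => φ j z.2 β * spinorComp α (K β) (z.1, z.2))
        (((continuous_comp_coord (φ j) β).comp continuous_snd).mul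
          (spinorComp α (K β)).continuous).aestronglyMeasurable
    · rw [norm_mul, RCLike.norm_conj]
      gcongr
      exact hb x
  convert! hs using 1
  · ext j
    have hψ (x : Plane) (α : Fin 2) :
        ψ j x α = ∑ β, ∫ y, φ j y β * spinorComp α (K β) (x, y) := by
      rw [h j x]
      simp only [WithLp.ofLp_sum, Finset.sum_apply]
      refine Finset.sum_congr rfl fun β _ => ?_
      exact ((EuclideanSpace.proj α : Spinor →L[ℂ] ℂ).integral_comp_comm
        (integrable_coord_smul_kernel (φ j) (K β) β x)).symm
    rw [inner_toL2]
    have h1 (x : Plane) : ⟪φ j x, ψ j x⟫ = ∑ α, ∑ β, (starRingEnd ℂ) (φ j x α) *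
        ∫ y, φ j y β * spinorComp α (K β) (x, y) := by
      rw [PiLp.inner_apply]
      refine Finset.sum_congr rfl fun α _ => ?_
      rw [← Finset.mul_sum, ← hψ]
      simp [mul_comm]
    simp_rw [h1]
    rw [integral_finsetSum _ fun α _ => integrable_finsetSum _ fun β _ => hint j α β]
    refine Finset.sum_congr rfl fun α _ => ?_
    rw [integral_finsetSum _ fun β _ => hint j α β]
  · simp only [diagTrace, ← spinorComp_apply]
    rw [integral_finsetSum _ fun α _ => integrable_diag (spinorComp α (K α))]
    refine Finset.sum_congr rfl fun α _ => ?_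
    simp

end KernelTrace

/-! ### The kernel of a quantized Schwartz symbol -/

section SymbolKernel

variable {ε : ℝ}

/-- Midpoint and scaled difference of a pair of points. -/
def midDiff (ε : ℝ) : Plane × Plane →L[ℝ] Plane × Plane :=
  (((1 / 2 : ℝ) • (ContinuousLinearMap.fst ℝ Plane Plane + ContinuousLinearMap.snd ℝ Plane Plane)).prod
    (ε⁻¹ • (ContinuousLinearMap.fst ℝ Plane Plane - ContinuousLinearMap.snd ℝ Plane Plane)))

theorem midDiff_apply (ε : ℝ) (z : Plane × Plane) :
    midDiff ε z = ((1 / 2 : ℝ) • (z.1 + z.2), ε⁻¹ • (z.1 - z.2)) := rfl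

/-- The change of variables to midpoint and scaled difference. -/
def midDiffEquiv (ε : ℝ) (hε : ε ≠ 0) : (Plane × Plane) ≃L[ℝ] (Plane × Plane) :=
  ContinuousLinearEquiv.equivOfInverse (midDiff ε)
    ((ContinuousLinearMap.fst ℝ Plane Plane + (ε / 2) • ContinuousLinearMap.snd ℝ Plane Plane).prod
      (ContinuousLinearMap.fst ℝ Plane Plane - (ε / 2) • ContinuousLinearMap.snd ℝ Plane Plane))
    (fun z => by
      have h : ε / 2 * ε⁻¹ = 1 / 2 := by field_simp
      ext1
      · simp [midDiff, smul_smul, h]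
        module
      · simp [midDiff, smul_smul, h]
        module)
    (fun z => by
      ext1
      · simp [midDiff]
        module
      · simp [midDiff, smul_smul]
        have h : z.2 = (ε⁻¹ * ε) • z.2 := by rw [inv_mul_cancel₀ hε, one_smul]
        nth_rw 3 [h]
        module)

/-- The kernel, up to a constant, of the quantization of a scalar symbol. -/
def scalarKernel (ε : ℝ) (hε : ε ≠ 0) (f : 𝓢(Plane × Plane, ℂ)) : 𝓢(Plane × Plane, ℂ) :=
  SchwartzMap.compCLMOfContinuousLinearEquiv ℂ (midDiffEquiv ε hε) (pftSchwartz 1 one_ne_zero f)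

theorem scalarKernel_apply (hε : ε ≠ 0) (f : 𝓢(Plane × Plane, ℂ)) (x y : Plane) :
    scalarKernel ε hε f (x, y) = pft 1 f ((1 / 2 : ℝ) • (x + y), ε⁻¹ • (x - y)) := rfl

/-- The constant in front of the Weyl quantization. -/
def weylConst (ε : ℝ) : ℝ := ((2 * Real.pi * ε) ^ 2)⁻¹

theorem weylConst_pos (hε : ε ≠ 0) : 0 < weylConst ε := by
  unfold weylConst
  have := Real.pi_ne_zero
  positivity

/-- The columns of the kernel of the quantization of a Schwartz symbol. -/
def symbolKernel (ε : ℝ) (hε : ε ≠ 0) (f : 𝓢(Plane × Plane, Fin 4 → ℝ)) (β : Fin 2) :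
    𝓢(Plane × Plane, Spinor) :=
  weylConst ε • ∑ s, SchwartzMap.postcompCLM
    (ContinuousLinearMap.toSpanSingleton ℂ (pauliCLM s (EuclideanSpace.single β 1)))
    (scalarKernel ε hε (complexComp f s))

theorem symbolKernel_apply (hε : ε ≠ 0) (f : 𝓢(Plane × Plane, Fin 4 → ℝ)) (β : Fin 2)
    (z : Plane × Plane) : symbolKernel ε hε f β z
      = weylConst ε • ∑ s, scalarKernel ε hε (complexComp f s) z •
          pauliCLM s (EuclideanSpace.single β 1) := by
  simp [symbolKernel]

theorem sum_coord_smul_single (v : Spinor) : ∑ β, v β • EuclideanSpace.single β (1 : ℂ) = v := by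
  ext i
  fin_cases i <;> simp

theorem sum_coord_smul_symbolKernel (hε : ε ≠ 0) (f : 𝓢(Plane × Plane, Fin 4 → ℝ)) (v : Spinor)
    (z : Plane × Plane) : ∑ β, v β • symbolKernel ε hε f β z
      = (weylConst ε : ℂ) • ∑ s, scalarKernel ε hε (complexComp f s) z • pauliCLM s v := by
  simp_rw [symbolKernel_apply]
  conv_rhs => rw [← sum_coord_smul_single v]
  simp_rw [map_sum, map_smul, Finset.smul_sum]
  rw [Finset.sum_comm]
  refine Finset.sum_congr rfl fun s _ => Finset.sum_congr rfl fun β _ => ?_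
  rw [← Complex.coe_smul (weylConst ε)]
  simp only [smul_smul]
  congr 1
  ring

theorem schwartz_comp_le (f : 𝓢(Plane × Plane, Fin 4 → ℝ)) :
    ∃ C : ℝ, 0 ≤ C ∧ ∀ s r p, ‖f (r, p) s‖ ≤ C * ((1 + ‖p‖) ^ 3)⁻¹ := by
  obtain ⟨C, hC0, hC⟩ := schwartz_le_mul f 0 3
  exact ⟨C, hC0, fun s r p => (norm_le_pi_norm (f (r, p)) s).trans (by simpa using hC r p)⟩

theorem continuous_schwartz_comp {X : Type*} [TopologicalSpace X]
    (f : 𝓢(Plane × Plane, Fin 4 → ℝ)) (s : Fin 4) {u : X → Plane × Plane} (hu : Continuous u) :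
    Continuous fun x => f (u x) s :=
  (continuous_apply s).comp (f.continuous.comp hu)

theorem continuous_phase_comp {X : Type*} [TopologicalSpace X] (c : ℝ) {u v : X → Plane}
    (hu : Continuous u) (hv : Continuous v) : Continuous fun x => phase c (u x) (v x) :=
  (continuous_phase c).comp (hu.prodMk hv)

theorem integrable_phase_symbol_spinor (ε : ℝ) (f : 𝓢(Plane × Plane, Fin 4 → ℝ))
    (ψ : 𝓢(Plane, Spinor)) (x : Plane) (s : Fin 4) :
    Integrable (fun z : Plane × Plane => phase 1 z.1 (ε⁻¹ • (x - z.2)) •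
      f ((1 / 2 : ℝ) • (x + z.2), z.1) s • pauliCLM s (ψ z.2)) := by
  obtain ⟨C, hC0, hC⟩ := schwartz_comp_le f
  have h1 : Continuous fun z : Plane × Plane => phase 1 z.1 (ε⁻¹ • (x - z.2)) :=
    continuous_phase_comp 1 (by fun_prop) (by fun_prop)
  have h2 : Continuous fun z : Plane × Plane => f ((1 / 2 : ℝ) • (x + z.2), z.1) s :=
    continuous_schwartz_comp f s (by fun_prop)
  have h3 : Continuous fun z : Plane × Plane => pauliCLM s (ψ z.2) :=
    (pauliCLM s).continuous.comp (ψ.continuous.comp continuous_snd)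
  refine (((integrable_inv_pow le_rfl).const_mul C).mul_prod
    (ψ.integrable.norm.const_mul ‖pauliCLM s‖)).mono' (h1.smul (h2.smul h3)).aestronglyMeasurable
    (Eventually.of_forall fun z => ?_)
  rw [norm_smul, norm_phase, one_mul, norm_smul]
  exact mul_le_mul (hC s _ _) ((pauliCLM s).le_opNorm _) (norm_nonneg _) (by positivity)

theorem integral_phase_symbol_smul (hε : ε ≠ 0) (f : 𝓢(Plane × Plane, Fin 4 → ℝ)) (v : Spinor)
    (x y : Plane) : ∫ p, ∑ s, phase 1 p (ε⁻¹ • (x - y)) • f ((1 / 2 : ℝ) • (x + y), p) s •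
        pauliCLM s v
      = ∑ s, scalarKernel ε hε (complexComp f s) (x, y) • pauliCLM s v := by
  obtain ⟨C, hC0, hC⟩ := schwartz_comp_le f
  rw [integral_finsetSum]
  · refine Finset.sum_congr rfl fun s _ => ?_
    rw [scalarKernel_apply, pft_eq, ← integral_smul_const]
    congr 1; ext1 p
    rw [complexComp_apply, smul_eq_mul, mul_smul, Complex.coe_smul]
  · intro s _
    have h1 : Continuous fun p : Plane => phase 1 p (ε⁻¹ • (x - y)) :=
      continuous_phase_comp 1 continuous_id continuous_const
    have h2 : Continuous fun p : Plane => f ((1 / 2 : ℝ) • (x + y), p) s :=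
      continuous_schwartz_comp f s (by fun_prop)
    refine (((integrable_inv_pow le_rfl).const_mul C).mul_const ‖pauliCLM s v‖).mono'
      (h1.smul (h2.smul continuous_const)).aestronglyMeasurable (Eventually.of_forall fun p => ?_)
    rw [norm_smul, norm_phase, one_mul, norm_smul]
    exact mul_le_mul_of_nonneg_right (hC s _ _) (norm_nonneg _)

theorem weylOp_eq_kernel (hε : ε ≠ 0) (f : 𝓢(Plane × Plane, Fin 4 → ℝ)) (ψ : 𝓢(Plane, Spinor))
    (x : Plane) : weylOp ε (fun r p => pauliMatrix (f (r, p))) ψ x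
      = ∑ β, ∫ y, ψ y β • symbolKernel ε hε f β (x, y) := by
  have hph (p y : Plane) : Complex.exp (Complex.I * ((inner ℝ (x - y) p / ε : ℝ) : ℂ))
      = phase 1 p (ε⁻¹ • (x - y)) := by
    rw [phase, inner_smul_right, one_mul, real_inner_comm, div_eq_inv_mul]
  rw [← integral_finsetSum _ fun β _ => integrable_coord_smul_kernel ψ _ β x]
  simp_rw [sum_coord_smul_symbolKernel]
  rw [integral_smul, weylOp, weylConst]
  congr 1
  simp_rw [toLp_pauliMatrix_mulVec, hph, Finset.smul_sum]
  -- The order of integration can be exchanged because the symbol decays in `p` and the spinor in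
  -- `y`, uniformly in the remaining variable.
  rw [integral_integral_swap
    (integrable_finsetSum _ fun s _ => integrable_phase_symbol_spinor ε f ψ x s)]
  simp_rw [integral_phase_symbol_smul hε]

/-- Orthogonality of the Pauli matrices for the trace form; it is what isolates a single component
of the symbol in a trace. -/
theorem sum_pauli_pauli (s t : Fin 4) :
    ∑ α, (pauliCLM s (pauliCLM t (EuclideanSpace.single α 1)) : Spinor) α
      = if s = t then 2 else 0 := by
  have h (α : Fin 2) : (pauliCLM s (pauliCLM t (EuclideanSpace.single α 1)) : Spinor) α
      = (pauli s * pauli t) α α := by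
    change (pauli s *ᵥ (pauli t *ᵥ Pi.single α 1)) α = _
    rw [Matrix.mulVec_mulVec, Matrix.mulVec_single_one]
    rfl
  simp_rw [h]
  fin_cases s <;> fin_cases t <;>
    simp [pauli, Fin.sum_univ_two, Matrix.mul_apply] <;> norm_num

theorem pauliCLM_zero (v : Spinor) : pauliCLM 0 v = v := by
  ext i
  fin_cases i <;> simp [pauliCLM, pauli] <;> rfl

/-- On the diagonal the difference variable vanishes and the partial Fourier transform is the plain
momentum integral: traces of local operators are moments of the symbol. -/
theorem scalarKernel_diag (hε : ε ≠ 0) (f : 𝓢(Plane × Plane, ℂ)) (x : Plane) :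
    scalarKernel ε hε f (x, x) = ∫ p, f (x, p) := by
  rw [scalarKernel_apply, pft_eq]
  have hx : (1 / 2 : ℝ) • (x + x) = x := by
    rw [← two_smul ℝ x, smul_smul]; norm_num
  simp only [hx, sub_self, smul_zero, phase_comm 1 _ 0, phase_zero_left, one_smul]

theorem diagTrace_spinOp_symbolKernel (hε : ε ≠ 0) (f : 𝓢(Plane × Plane, Fin 4 → ℝ)) (s : Fin 4)
    (x : Plane) : diagTrace (fun β => spinOp s (symbolKernel ε hε f β)) x
      = ((2 * weylConst ε * ∫ p, f (x, p) s : ℝ) : ℂ) := by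
  have h1 (α : Fin 2) : (spinOp s (symbolKernel ε hε f α)) (x, x) α
      = ∑ t, (weylConst ε : ℂ) * scalarKernel ε hε (complexComp f t) (x, x) *
        (pauliCLM s (pauliCLM t (EuclideanSpace.single α 1)) : Spinor) α := by
    rw [spinOp_apply, symbolKernel_apply, ← Complex.coe_smul, map_smul, map_sum]
    simp only [map_smul, PiLp.smul_apply, WithLp.ofLp_sum, Finset.sum_apply, smul_eq_mul,
      Finset.mul_sum, mul_assoc]
  simp_rw [diagTrace, h1]
  rw [Finset.sum_comm]
  simp_rw [← Finset.mul_sum, sum_pauli_pauli, scalarKernel_diag, complexComp_apply,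
    integral_complex_ofReal]
  simp
  ring

theorem spinOp_zero {D : Type*} [NormedAddCommGroup D] [NormedSpace ℝ D] (F : 𝓢(D, Spinor)) :
    spinOp 0 F = F := by
  ext1 z
  rw [spinOp_apply, pauliCLM_zero]

theorem diagTrace_symbolKernel (hε : ε ≠ 0) (f : 𝓢(Plane × Plane, Fin 4 → ℝ)) (x : Plane) :
    diagTrace (symbolKernel ε hε f) x = ((2 * weylConst ε * ∫ p, f (x, p) 0 : ℝ) : ℂ) := by
  rw [← diagTrace_spinOp_symbolKernel hε f 0 x]
  simp_rw [spinOp_zero]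

/-- Differentiating in `x` hits the midpoint, which gives a real number `a`, and the phase, which
gives `i/ε` times the first moment. After multiplication by `-iε` the former is imaginary, so its
value is immaterial. -/
theorem fderiv_scalarKernel_diag (hε : ε ≠ 0) (f : 𝓢(Plane × Plane, Fin 4 → ℝ)) (s : Fin 4)
    (x : Plane) (k : Fin 2) : ∃ a : ℝ,
    fderiv ℝ (scalarKernel ε hε (complexComp f s)) (x, x) (unitVec k, 0)
      = (a : ℂ) + Complex.I * ((ε⁻¹ * ∫ p : Plane, p k * f (x, p) s : ℝ) : ℂ) := by
  set F := complexComp f s with hF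
  have hx : (1 / 2 : ℝ) • (x + x) = x := by
    rw [← two_smul ℝ x, smul_smul]; norm_num
  have h : HasFDerivAt (scalarKernel ε hε F)
      ((pft 1 (pftDeriv 1 F) (midDiff ε (x, x))).comp (midDiff ε)) (x, x) :=
    HasFDerivAt.comp (f := midDiff ε) (x, x) (hasFDerivAt_pft 1 F _) (midDiff ε).hasFDerivAt
  have hi (F' : Type) [NormedAddCommGroup F'] [NormedSpace ℂ F'] (h : 𝓢(Plane × Plane, F')) :
      Integrable fun p => h (x, p) := (restrictFst x h).integrable
  have h2 : midDiff ε (x, x) = (x, 0) := by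
    simp only [midDiff_apply, hx, sub_self, smul_zero]
  have hre (p : Plane) : fderiv ℝ F (x, p) ((1 / 2 : ℝ) • unitVec k, 0)
      = ((fderiv ℝ (fun z => f z s) (x, p) ((1 / 2 : ℝ) • unitVec k, 0) : ℝ) : ℂ) := by
    have hd : HasFDerivAt (fun z => f z s) _ (x, p) :=
      ((ContinuousLinearMap.proj (R := ℝ) (φ := fun _ : Fin 4 => ℝ) s).hasFDerivAt.comp (x, p)
        (f.hasFDerivAt (x, p)))
    have hd2 := Complex.ofRealCLM.hasFDerivAt.comp (x, p) hd
    have he : (F : Plane × Plane → ℂ) = Complex.ofRealCLM ∘ fun z => f z s := rfl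
    rw [he, hd2.fderiv, hd.fderiv]
    rfl
  refine ⟨∫ p, fderiv ℝ (fun z => f z s) (x, p) ((1 / 2 : ℝ) • unitVec k, 0), ?_⟩
  have hi1 : Integrable fun p => fderiv ℝ F (x, p) ((1 / 2 : ℝ) • unitVec k, 0) := by
    have := hi _ (SchwartzMap.postcompCLM (𝕜 := ℝ)
      (ContinuousLinearMap.apply ℝ ℂ (((1 / 2 : ℝ) • unitVec k, 0) : Plane × Plane))
      (SchwartzMap.fderivCLM ℝ (Plane × Plane) ℂ F))
    exact this
  have hi2 : Integrable fun p : Plane => (p k : ℂ) * F (x, p) := by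
    have := (SchwartzMap.smulLeftCLM ℂ (fun p : Plane => p k) (restrictFst x F)).integrable (μ := volume)
    refine this.congr (Eventually.of_forall fun p => ?_)
    simp only [SchwartzMap.smulLeftCLM_apply_apply (hasTemperateGrowth_coord k), Complex.real_smul,
      restrictFst_apply]
  rw [h.fderiv, ContinuousLinearMap.comp_apply, h2, pft_eq]
  simp only [phase_comm 1 _ 0, phase_zero_left, one_smul]
  rw [ContinuousLinearMap.integral_apply (hi _ (pftDeriv 1 F))]
  have h3 : midDiff ε (unitVec k, 0) = ((1 / 2 : ℝ) • unitVec k, ε⁻¹ • unitVec k) := by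
    simp [midDiff_apply]
  rw [h3]
  have h4 (p : Plane) : pftDeriv 1 F (x, p) ((1 / 2 : ℝ) • unitVec k, ε⁻¹ • unitVec k)
      = fderiv ℝ F (x, p) ((1 / 2 : ℝ) • unitVec k, 0)
        + (Complex.I * ε⁻¹) * ((p k : ℂ) * F (x, p)) := by
    rw [pftDeriv_apply, inner_smul_right, inner_unitVec, Complex.real_smul]
    push_cast
    simp only [smul_eq_mul]
    ring
  simp_rw [h4]
  rw [integral_add hi1 (hi2.const_mul _), integral_const_mul]
  simp_rw [hre]
  rw [integral_complex_ofReal]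
  have h5 (p : Plane) : (p k : ℂ) * F (x, p) = ((p k * f (x, p) s : ℝ) : ℂ) := by
    rw [hF, complexComp_apply]; push_cast; rfl
  simp_rw [h5]
  rw [integral_complex_ofReal]
  push_cast
  ring

theorem re_diagTrace_momentumOp_symbolKernel (hε : ε ≠ 0) (f : 𝓢(Plane × Plane, Fin 4 → ℝ))
    (k : Fin 2) (x : Plane) :
    (diagTrace (fun β => momentumOp ε (unitVec k, 0) (symbolKernel ε hε f β)) x).re
      = 2 * weylConst ε * ∫ p : Plane, p k * f (x, p) 0 := by
  obtain ⟨a, ha⟩ := fderiv_scalarKernel_diag hε f 0 x k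
  have hd (β : Fin 2) : momentumOp ε (unitVec k, 0) (symbolKernel ε hε f β) (x, x)
      = ∑ s, ((-(Complex.I * ε)) * weylConst ε * fderiv ℝ (scalarKernel ε hε (complexComp f s)) (x, x)
          (unitVec k, 0)) • pauliCLM s (EuclideanSpace.single β 1) := by
    have h : HasFDerivAt (symbolKernel ε hε f β) (weylConst ε • ∑ s,
        (fderiv ℝ (scalarKernel ε hε (complexComp f s)) (x, x)).smulRight
          (pauliCLM s (EuclideanSpace.single β 1))) (x, x) := by
      rw [show (symbolKernel ε hε f β : Plane × Plane → Spinor) = _ from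
        funext (symbolKernel_apply hε f β)]
      have h0 (s : Fin 4) := HasFDerivAt.smul_const
        ((scalarKernel ε hε (complexComp f s)).hasFDerivAt (x, x))
        (pauliCLM s (EuclideanSpace.single β 1))
      exact (HasFDerivAt.fun_sum fun s _ => h0 s).const_smul (weylConst ε)
    rw [momentumOp_apply, h.fderiv]
    simp only [smul_apply, _root_.sum_apply, ContinuousLinearMap.smulRight_apply, Finset.smul_sum]
    refine Finset.sum_congr rfl fun s _ => ?_
    rw [← Complex.coe_smul (E := Spinor) (weylConst ε), smul_smul, smul_smul]
  have h1 : diagTrace (fun β => momentumOp ε (unitVec k, 0) (symbolKernel ε hε f β)) x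
      = 2 * ((-(Complex.I * ε)) * weylConst ε *
        fderiv ℝ (scalarKernel ε hε (complexComp f 0)) (x, x) (unitVec k, 0)) := by
    simp only [diagTrace, hd, PiLp.smul_apply, WithLp.ofLp_sum, Finset.sum_apply, smul_eq_mul]
    rw [Finset.sum_comm]
    simp_rw [← Finset.mul_sum]
    have h0 (t : Fin 4) := sum_pauli_pauli 0 t
    simp_rw [pauliCLM_zero] at h0
    simp_rw [h0]
    simp
    ring
  rw [h1, ha]
  have : (ε : ℂ) ≠ 0 := by exact_mod_cast hε
  have h2 : 2 * ((-(Complex.I * ε)) * weylConst ε * ((a : ℂ)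
      + Complex.I * ((ε⁻¹ * ∫ p : Plane, p k * f (x, p) 0 : ℝ) : ℂ)))
      = ((2 * weylConst ε * ∫ p : Plane, p k * f (x, p) 0 : ℝ) : ℂ)
        + Complex.I * ((-2 * ε * weylConst ε * a : ℝ) : ℂ) := by
    push_cast
    linear_combination (-2 * weylConst ε * (ε * (ε : ℂ)⁻¹) * ((∫ p : Plane, p k * f (x, p) 0 : ℝ) : ℂ)) *
      Complex.I_mul_I + (2 * weylConst ε * ((∫ p : Plane, p k * f (x, p) 0 : ℝ) : ℂ))
        * mul_inv_cancel₀ this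
  rw [h2]
  simp

/-- The multipliers pair with precisely the moments that are prescribed. The commutator of momentum
with `ξ₀ᵏ` multiplies a real density by an imaginary number and disappears from the real part. -/
theorem re_diagTrace_driftOp_symbolKernel (hε : ε ≠ 0) (f : 𝓢(Plane × Plane, Fin 4 → ℝ))
    {ξ : Multipliers} (hξ : ξ.Temperate) (x : Plane) :
    (diagTrace (fun β => driftOp ε (ContinuousLinearMap.fst ℝ Plane Plane)
      (fun k => (unitVec k, 0)) ξ (symbolKernel ε hε f β)) x).re
      = 2 * weylConst ε * (ξ.A x * (∫ p, f (x, p) 0)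
        + ∑ s : Fin 3, ξ.B x s * (∫ p, f (x, p) s.succ)
        + ∑ k, ξ.U x k * ∫ p : Plane, p k * f (x, p) 0) := by
  have h : diagTrace (fun β => driftOp ε (ContinuousLinearMap.fst ℝ Plane Plane)
      (fun k => (unitVec k, 0)) ξ (symbolKernel ε hε f β)) x
      = (ξ.A x : ℂ) * diagTrace (symbolKernel ε hε f) x
        + ∑ s : Fin 3, (ξ.B x s : ℂ) * diagTrace (fun β => spinOp s.succ (symbolKernel ε hε f β)) x
        + ∑ k, ((ξ.U x k : ℂ) *
            diagTrace (fun β => momentumOp ε (unitVec k, 0) (symbolKernel ε hε f β)) x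
          + (1 / 2) * (-(Complex.I * ε)) * (fderiv ℝ (fun r => ξ.U r k) x (unitVec k) : ℂ) *
            diagTrace (symbolKernel ε hε f) x) := by
    simp only [diagTrace, driftOp, add_apply, smul_apply, mulOp_apply _ hξ.A,
      mulOp_apply _ (temperate_coord hξ.B _), mulOp_apply _ (temperate_coord hξ.U _),
      momentumOp_mulOp_apply _ _ _ (temperate_coord hξ.U _), ContinuousLinearMap.coe_fst',
      Fin.sum_univ_two, Fin.sum_univ_three, PiLp.add_apply, PiLp.smul_apply, Complex.real_smul,
      smul_eq_mul]
    push_cast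
    ring
  rw [h]
  simp only [diagTrace_symbolKernel, diagTrace_spinOp_symbolKernel, Complex.add_re, Complex.re_sum,
    Complex.re_ofReal_mul, re_diagTrace_momentumOp_symbolKernel, Complex.ofReal_re]
  have h0 (k : Fin 2) : ((1 / 2 : ℂ) * (-(Complex.I * ε)) *
      (fderiv ℝ (fun r => ξ.U r k) x (unitVec k) : ℂ)
      * ((2 * weylConst ε * ∫ p, f (x, p) 0 : ℝ) : ℂ)).re = 0 := by
    have : (1 / 2 : ℂ) * (-(Complex.I * ε)) * (fderiv ℝ (fun r => ξ.U r k) x (unitVec k) : ℂ)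
        * ((2 * weylConst ε * ∫ p, f (x, p) 0 : ℝ) : ℂ)
        = Complex.I * ((-(1 / 2) * ε * fderiv ℝ (fun r => ξ.U r k) x (unitVec k) *
          (2 * weylConst ε * ∫ p, f (x, p) 0) : ℝ) : ℂ) := by
      push_cast; ring
    rw [this]; simp
  simp only [h0, add_zero, Fin.sum_univ_two, Fin.sum_univ_three]
  ring

end SymbolKernel

/-! ### Hilbert-Schmidt norm as the norm of the kernel -/

section HilbertSchmidt

local notation "⟪" x ", " y "⟫" => inner ℂ x y

theorem integrable_kernel_sq (S : 𝓢(Plane × Plane, ℂ)) :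
    Integrable fun z : Plane × Plane => ‖S z‖ ^ 2 := by
  obtain ⟨C, hC⟩ := schwartz_sq_le S
  refine (integrable_inv_pow_prod.const_mul C).mono' (S.continuous.norm.pow 2).aestronglyMeasurable
    (Eventually.of_forall fun z => ?_)
  rw [Real.norm_of_nonneg (by positivity)]
  exact hC z.1 z.2

/-- The conjugated row of a kernel, as a function of the second variable. -/
def kernelRow (K : Fin 2 → 𝓢(Plane × Plane, Spinor)) (α : Fin 2) (x y : Plane) : Spinor :=
  WithLp.toLp 2 fun β => (starRingEnd ℂ) (K β (x, y) α)

theorem norm_kernelRow_sq (K : Fin 2 → 𝓢(Plane × Plane, Spinor)) (α : Fin 2) (x y : Plane) :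
    ‖kernelRow K α x y‖ ^ 2 = ∑ β, ‖spinorComp α (K β) (x, y)‖ ^ 2 := by
  rw [EuclideanSpace.norm_sq_eq]
  simp [kernelRow, spinorComp_apply]

theorem memLp_kernelRow (K : Fin 2 → 𝓢(Plane × Plane, Spinor)) (α : Fin 2) (x : Plane) :
    MemLp (kernelRow K α x) 2 volume := by
  have hc : Continuous (kernelRow K α x) := by
    refine (PiLp.continuous_toLp 2 _).comp (continuous_pi fun β => ?_)
    exact Complex.continuous_conj.comp
      ((spinorComp α (K β)).continuous.comp (by fun_prop : Continuous fun y : Plane => (x, y)))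
  rw [memLp_two_iff_integrable_sq_norm hc.aestronglyMeasurable]
  simp_rw [norm_kernelRow_sq]
  refine integrable_finsetSum _ fun β _ => ?_
  obtain ⟨C, hC⟩ := schwartz_sq_le (spinorComp α (K β))
  refine ((integrable_inv_pow (k := 3) le_rfl).const_mul (((1 + ‖x‖) ^ 3)⁻¹) |>.const_mul C).mono'
    (Continuous.aestronglyMeasurable ?_) (Eventually.of_forall fun y => ?_)
  · exact ((spinorComp α (K β)).continuous.comp
      (by fun_prop : Continuous fun y : Plane => (x, y))).norm.pow 2
  · rw [Real.norm_of_nonneg (by positivity)]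
    exact hC x y

theorem coord_eq_sum_integral {ψ φ : 𝓢(Plane, Spinor)} {K : Fin 2 → 𝓢(Plane × Plane, Spinor)}
    (h : KernelRep ψ φ K) (x : Plane) (α : Fin 2) :
    ψ x α = ∑ β, ∫ y, φ y β * K β (x, y) α := by
  rw [h x]
  simp only [WithLp.ofLp_sum, Finset.sum_apply]
  refine Finset.sum_congr rfl fun β _ => ?_
  exact ((EuclideanSpace.proj α : Spinor →L[ℂ] ℂ).integral_comp_comm
    (integrable_coord_smul_kernel φ (K β) β x)).symm

theorem integrable_coord_mul_kernel (φ : 𝓢(Plane, Spinor)) (K : 𝓢(Plane × Plane, Spinor))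
    (α β : Fin 2) (x : Plane) : Integrable fun y => φ y β * K (x, y) α :=
  (EuclideanSpace.proj α : Spinor →L[ℂ] ℂ).integrable_comp (integrable_coord_smul_kernel φ K β x)

theorem inner_kernelRow {ψ φ : 𝓢(Plane, Spinor)} {K : Fin 2 → 𝓢(Plane × Plane, Spinor)}
    (h : KernelRep ψ φ K) (x : Plane) (α : Fin 2) :
    ⟪(memLp_kernelRow K α x).toLp _, toL2 φ⟫ = ψ x α := by
  have h1 : ⟪(memLp_kernelRow K α x).toLp _, toL2 φ⟫ = ∫ y, ⟪kernelRow K α x y, φ y⟫ :=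
    inner_toLp_toLp _ (φ.memLp 2 volume)
  rw [h1, coord_eq_sum_integral h,
    ← integral_finsetSum _ fun β _ => integrable_coord_mul_kernel φ (K β) α β x]
  congr 1; ext1 y
  rw [PiLp.inner_apply]
  simp [kernelRow]

theorem integrable_coord_norm_sq (f : 𝓢(Plane, Spinor)) (α : Fin 2) :
    Integrable fun x => ‖f x α‖ ^ 2 := by
  have h := (memLp_two_iff_integrable_sq_norm
    (continuous_comp_coord f α).aestronglyMeasurable).1
    ((EuclideanSpace.proj α : Spinor →L[ℂ] ℂ).comp_memLp' (f.memLp 2 volume))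
  exact h

/-- Each coordinate of `ψ j` at `x` is the coefficient of a conjugated kernel row along `φ j`.
Parseval's identity, integrated in `x`, turns the sum over `j` into the integral of the squared
rows. -/
theorem hasSum_norm_sq_kernel {e : HilbertBasis ℕ ℂ SpinorL2} {φ ψ : ℕ → 𝓢(Plane, Spinor)}
    (he : ∀ j, e j = toL2 (φ j)) {K : Fin 2 → 𝓢(Plane × Plane, Spinor)}
    (h : ∀ j, KernelRep (ψ j) (φ j) K) :
    HasSum (fun j => ‖toL2 (ψ j)‖ ^ 2) (∑ β, ∫ z, ‖K β z‖ ^ 2) := by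
  have hrow (α : Fin 2) (x : Plane) : ‖(memLp_kernelRow K α x).toLp _‖ ^ 2
      = ∑ β, ∫ y, ‖spinorComp α (K β) (x, y)‖ ^ 2 := by
    rw [norm_toLp_sq]
    simp_rw [norm_kernelRow_sq]
    refine integral_finsetSum _ fun β _ => ?_
    obtain ⟨C, hC⟩ := schwartz_sq_le (spinorComp α (K β))
    refine ((integrable_inv_pow (k := 3) le_rfl).const_mul (((1 + ‖x‖) ^ 3)⁻¹) |>.const_mul C).mono'
      (Continuous.aestronglyMeasurable ?_) (Eventually.of_forall fun y => ?_)
    · exact ((spinorComp α (K β)).continuous.comp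
        (by fun_prop : Continuous fun y : Plane => (x, y))).norm.pow 2
    · rw [Real.norm_of_nonneg (by positivity)]
      exact hC x y
  have hpi (α β : Fin 2) : Integrable fun x => ∫ y, ‖spinorComp α (K β) (x, y)‖ ^ 2 :=
    (integrable_kernel_sq (spinorComp α (K β))).integral_prod_left
  have hcoord (α : Fin 2) : HasSum (fun j => ∫ x, ‖ψ j x α‖ ^ 2)
      (∑ β, ∫ z, ‖spinorComp α (K β) z‖ ^ 2) := by
    have key := hasSum_integral_inner_mul_inner (μ := volume) e
      (u := fun x => (memLp_kernelRow K α x).toLp _) (v := fun x => (memLp_kernelRow K α x).toLp _)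
      (fun j => by
        simp_rw [he, inner_kernelRow (h j)]
        exact (continuous_comp_coord (ψ j) α).aestronglyMeasurable)
      (fun j => by
        simp_rw [he, ← inner_conj_symm (toL2 (φ j)), inner_kernelRow (h j)]
        exact (Complex.continuous_conj.comp (continuous_comp_coord (ψ j) α)).aestronglyMeasurable)
      (by simp_rw [hrow]; exact integrable_finsetSum _ fun β _ => hpi α β)
      (by simp_rw [hrow]; exact integrable_finsetSum _ fun β _ => hpi α β)
    have key2 := key.mapL Complex.reCLM
    convert! key2 using 1
    · ext j
      simp_rw [he, ← inner_conj_symm (toL2 (φ j)), inner_kernelRow (h j), Complex.mul_conj,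
        Complex.normSq_eq_norm_sq]
      rw [integral_complex_ofReal]
      simp
    · have hrow' (x : Plane) : ⟪(memLp_kernelRow K α x).toLp _, (memLp_kernelRow K α x).toLp _⟫
          = ((∑ β, ∫ y, ‖spinorComp α (K β) (x, y)‖ ^ 2 : ℝ) : ℂ) := by
        rw [inner_self_eq_norm_sq_to_K, ← hrow]
        norm_cast
      simp_rw [hrow']
      rw [integral_complex_ofReal, integral_finsetSum _ fun β _ => hpi α β]
      simp only [Complex.reCLM_apply, Complex.ofReal_re]
      refine Finset.sum_congr rfl fun β _ => ?_
      rw [Measure.volume_eq_prod, integral_prod _ (integrable_kernel_sq (spinorComp α (K β)))]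
  have hs := hasSum_sum (s := Finset.univ) fun α _ => hcoord α
  convert! hs using 1
  · ext j
    have h1 : ‖toL2 (ψ j)‖ ^ 2 = ∫ x, ‖ψ j x‖ ^ 2 := norm_toLp_sq ((ψ j).memLp 2 volume)
    rw [h1, ← integral_finsetSum _ fun α _ => integrable_coord_norm_sq (ψ j) α]
    simp_rw [EuclideanSpace.norm_sq_eq]
  · rw [Finset.sum_comm]
    refine Finset.sum_congr rfl fun β _ => ?_
    rw [← integral_finsetSum _ fun α _ => integrable_kernel_sq (spinorComp α (K β))]
    simp_rw [EuclideanSpace.norm_sq_eq, spinorComp_apply]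

end HilbertSchmidt

/-! ### Plancherel's identity for Weyl symbols -/

section Plancherel

theorem integral_norm_sq_ft (f : 𝓢(Plane, ℂ)) :
    ∫ p, ‖ft 1 f p‖ ^ 2 = (2 * Real.pi) ^ 2 * ∫ p, ‖f p‖ ^ 2 := by
  have h := integral_comp_scale 1 (fun q => ‖𝓕 (f : Plane → ℂ) q‖ ^ 2)
  simp_rw [← ft_eq_fourier] at h
  rw [h, ← SchwartzMap.integral_norm_sq_fourier f, SchwartzMap.fourier_coe, smul_eq_mul, div_one]

theorem integral_norm_sq_pft (f : 𝓢(Plane × Plane, ℂ)) :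
    ∫ z, ‖pft 1 f z‖ ^ 2 = (2 * Real.pi) ^ 2 * ∫ z, ‖f z‖ ^ 2 := by
  have h1 : Integrable fun z => ‖pft 1 f z‖ ^ 2 :=
    integrable_kernel_sq (pftSchwartz 1 one_ne_zero f)
  rw [Measure.volume_eq_prod] at h1 ⊢
  have h2 := integrable_kernel_sq f
  rw [Measure.volume_eq_prod] at h2
  rw [integral_prod _ h1, integral_prod _ h2, ← integral_const_mul]
  congr 1; ext1 x
  exact integral_norm_sq_ft (restrictFst x f)

/-- The constant is the inverse of the absolute determinant of `L`; only its positivity and its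
independence of `F` matter. -/
theorem exists_integral_comp_equiv (L : (Plane × Plane) ≃L[ℝ] (Plane × Plane)) :
    ∃ C : ℝ, 0 < C ∧ ∀ F : Plane × Plane → ℝ, ∫ z, F (L z) = C * ∫ z, F z := by
  have hdet : LinearMap.det (L : (Plane × Plane) →ₗ[ℝ] (Plane × Plane)) ≠ 0 :=
    (LinearEquiv.isUnit_det' L.toLinearEquiv).ne_zero
  refine ⟨|(LinearMap.det (L : (Plane × Plane) →ₗ[ℝ] (Plane × Plane)))⁻¹|,
    abs_pos.2 (inv_ne_zero hdet), fun F => ?_⟩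
  have : (volume : Measure (Plane × Plane)).IsAddHaarMeasure := by
    rw [Measure.volume_eq_prod]; infer_instance
  have h := Measure.map_linearMap_addHaar_eq_smul_addHaar
    (volume : Measure (Plane × Plane)) hdet
  have h2 : ∫ z, F z ∂(Measure.map L (volume : Measure (Plane × Plane))) = ∫ z, F (L z) :=
    L.toHomeomorph.measurableEmbedding.integral_map F
  rw [← h2]
  have h3 : Measure.map L (volume : Measure (Plane × Plane))
      = ENNReal.ofReal |(LinearMap.det (L : (Plane × Plane) →ₗ[ℝ] (Plane × Plane)))⁻¹| • volume := h
  rw [h3, integral_smul_measure, ENNReal.toReal_ofReal (abs_nonneg _), smul_eq_mul]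

theorem pauliCLM_single_apply (s : Fin 4) (β i : Fin 2) :
    (pauliCLM s (EuclideanSpace.single β 1) : Spinor) i = pauli s i β := by
  change (pauli s *ᵥ Pi.single β 1) i = _
  rw [Matrix.mulVec_single_one]
  rfl

/-- The diagonal entries are `k₀ ± k₃` and the off-diagonal ones `k₁ ∓ i k₂`; the parallelogram law
applies to each pair. -/
theorem sum_norm_sq_pauli (k : Fin 4 → ℂ) :
    ∑ β, ‖∑ s, k s • pauliCLM s (EuclideanSpace.single β 1)‖ ^ 2 = 2 * ∑ s, ‖k s‖ ^ 2 := by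
  simp only [EuclideanSpace.norm_sq_eq, WithLp.ofLp_sum, Finset.sum_apply, PiLp.smul_apply,
    pauliCLM_single_apply, smul_eq_mul]
  have h1 := parallelogram_law_with_norm ℂ (k 0) (k 3)
  have h2 := parallelogram_law_with_norm ℂ (k 1) (k 2 * Complex.I)
  rw [norm_mul, Complex.norm_I, mul_one] at h2
  simp [Fin.sum_univ_four, pauli]
  rw [← sub_eq_add_neg, ← sub_eq_add_neg]
  linarith

variable {ε : ℝ}

/-- The kernel is a partial Fourier transform of the symbol in rotated linear coordinates, and both
operations multiply squared `L²` norms by constants. -/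
theorem exists_integral_norm_sq_symbolKernel (hε : ε ≠ 0) : ∃ C : ℝ, 0 < C ∧
    ∀ f : 𝓢(Plane × Plane, Fin 4 → ℝ),
      ∑ β, ∫ z, ‖symbolKernel ε hε f β z‖ ^ 2 = C * ∫ z, ∑ s, f z s ^ 2 := by
  obtain ⟨C, hC0, hC⟩ := exists_integral_comp_equiv (midDiffEquiv ε hε)
  refine ⟨weylConst ε ^ 2 * (2 * (C * (2 * Real.pi) ^ 2)), ?_, fun f => ?_⟩
  · have := weylConst_pos hε
    have := Real.pi_pos
    positivity
  have hk (s : Fin 4) : ∫ z, ‖scalarKernel ε hε (complexComp f s) z‖ ^ 2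
      = C * (2 * Real.pi) ^ 2 * ∫ z, f z s ^ 2 := by
    have h1 := hC fun z => ‖pft 1 (complexComp f s) z‖ ^ 2
    have h2 : ∫ z, ‖scalarKernel ε hε (complexComp f s) z‖ ^ 2
      = ∫ z, ‖pft 1 (complexComp f s) (midDiffEquiv ε hε z)‖ ^ 2 := rfl
    rw [h2, h1, integral_norm_sq_pft, mul_assoc]
    simp
  have hi (β : Fin 2) : Integrable fun z => ‖symbolKernel ε hε f β z‖ ^ 2 := by
    simp_rw [EuclideanSpace.norm_sq_eq, ← spinorComp_apply]
    exact integrable_finsetSum _ fun α _ => integrable_kernel_sq _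
  have hf (s : Fin 4) : Integrable fun z => f z s ^ 2 := by
    refine (integrable_kernel_sq (complexComp f s)).congr (Eventually.of_forall fun z => ?_)
    simp
  rw [← integral_finsetSum _ fun β _ => hi β, integral_finsetSum _ fun s _ => hf s]
  have hpt (z : Plane × Plane) : ∑ β, ‖symbolKernel ε hε f β z‖ ^ 2
      = weylConst ε ^ 2 * (2 * ∑ s, ‖scalarKernel ε hε (complexComp f s) z‖ ^ 2) := by
    rw [← sum_norm_sq_pauli, Finset.mul_sum]
    refine Finset.sum_congr rfl fun β _ => ?_
    rw [symbolKernel_apply, norm_smul, mul_pow, Real.norm_eq_abs, sq_abs]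
  simp_rw [hpt]
  rw [integral_const_mul, integral_const_mul,
    integral_finsetSum _ fun s _ => integrable_kernel_sq (scalarKernel ε hε (complexComp f s))]
  simp_rw [hk]
  rw [← Finset.mul_sum]
  ring

end Plancherel

/-! ### Symmetry of quantized symbols -/

section Hermitian

local notation "⟪" x ", " y "⟫" => inner ℂ x y

variable {ε : ℝ}

/-- The symbol is real, and exchanging `x` and `y` fixes the midpoint and reverses the phase. -/
theorem conj_scalarKernel (hε : ε ≠ 0) (f : 𝓢(Plane × Plane, Fin 4 → ℝ)) (s : Fin 4)
    (x y : Plane) : (starRingEnd ℂ) (scalarKernel ε hε (complexComp f s) (y, x))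
      = scalarKernel ε hε (complexComp f s) (x, y) := by
  rw [scalarKernel_apply, scalarKernel_apply, pft_eq, pft_eq, ← integral_conj]
  congr 1; ext1 p
  rw [smul_eq_mul, smul_eq_mul, map_mul, star_phase, complexComp_apply, complexComp_apply,
    Complex.conj_ofReal, add_comm y x]
  congr 1
  rw [phase, phase, ← neg_sub x y, smul_neg, inner_neg_right]
  congr 3; ring

/-- The quantization of a Schwartz symbol is symmetric. -/
theorem inner_symbolKernel_symm (hε : ε ≠ 0) (f : 𝓢(Plane × Plane, Fin 4 → ℝ))
    {φ φ' ψ ψ' : 𝓢(Plane, Spinor)} (hφ : KernelRep φ' φ (symbolKernel ε hε f))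
    (hψ : KernelRep ψ' ψ (symbolKernel ε hε f)) : ⟪toL2 φ, toL2 ψ'⟫ = ⟪toL2 φ', toL2 ψ⟫ := by
  set k := fun s => scalarKernel ε hε (complexComp f s) with hk
  have hrep {χ χ' : 𝓢(Plane, Spinor)} (h : KernelRep χ' χ (symbolKernel ε hε f)) (x : Plane) :
      Integrable (fun y => (weylConst ε : ℂ) • ∑ s, k s (x, y) • pauliCLM s (χ y)) ∧
      χ' x = ∫ y, (weylConst ε : ℂ) • ∑ s, k s (x, y) • pauliCLM s (χ y) := by
    simp_rw [hk, ← sum_coord_smul_symbolKernel]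
    refine ⟨integrable_finsetSum _ fun β _ => integrable_coord_smul_kernel χ _ β x, ?_⟩
    rw [h x, integral_finsetSum _ fun β _ => integrable_coord_smul_kernel χ _ β x]
  have hQ (s : Fin 4) : Integrable fun z : Plane × Plane =>
      k s z * ⟪φ z.1, pauliCLM s (ψ z.2)⟫ := by
    have hc : Continuous fun z : Plane × Plane => k s z * ⟪φ z.1, pauliCLM s (ψ z.2)⟫ :=
      (k s).continuous.mul ((φ.continuous.comp continuous_fst).inner
        ((pauliCLM s).continuous.comp (ψ.continuous.comp continuous_snd)))
    refine ((φ.integrable.norm.mul_prod (ψ.integrable.norm.const_mul ‖pauliCLM s‖)).const_mul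
      (SchwartzMap.seminorm ℝ 0 0 (k s))).mono' hc.aestronglyMeasurable
      (Eventually.of_forall fun z => ?_)
    rw [norm_mul]
    refine mul_le_mul (SchwartzMap.norm_le_seminorm ℝ (k s) z) ?_ (norm_nonneg _) (by positivity)
    refine (norm_inner_le_norm _ _).trans ?_
    gcongr
    exact (pauliCLM s).le_opNorm _
  have h1 (x : Plane) : ⟪φ x, ψ' x⟫
      = ∫ y, (weylConst ε : ℂ) * ∑ s, k s (x, y) * ⟪φ x, pauliCLM s (ψ y)⟫ := by
    rw [(hrep hψ x).2, ← integral_inner (hrep hψ x).1]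
    congr 1; ext1 y
    rw [inner_smul_right, inner_sum]
    simp_rw [inner_smul_right]
  have h2 (y : Plane) : ⟪φ' y, ψ y⟫
      = ∫ x, (weylConst ε : ℂ) * ∑ s, k s (x, y) * ⟪φ x, pauliCLM s (ψ y)⟫ := by
    rw [← inner_conj_symm, (hrep hφ y).2, ← integral_inner (hrep hφ y).1, ← integral_conj]
    congr 1; ext1 x
    rw [inner_conj_symm, inner_smul_left, sum_inner, Complex.conj_ofReal]
    simp_rw [inner_smul_left, hk, conj_scalarKernel, inner_pauliCLM]
  rw [inner_toL2, inner_toL2]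
  simp_rw [h1, h2]
  refine integral_integral_swap ?_
  exact (integrable_finsetSum _ fun s _ => hQ s).const_mul _

end Hermitian

/-! ### Relative entropy and Hilbert-Schmidt distance -/

section RelativeEntropy

local notation "⟪" x ", " y "⟫" => inner ℂ x y

variable {H : Type*} [NormedAddCommGroup H] [InnerProductSpace ℂ H]

theorem hasSum_norm_inner_sq (e : HilbertBasis ℕ ℂ H) (v : H) :
    HasSum (fun k => ‖⟪e k, v⟫‖ ^ 2) (‖v‖ ^ 2) := by
  have h := (e.hasSum_inner_mul_inner v v).mapL Complex.reCLM
  convert! h using 1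
  · ext k
    rw [← inner_conj_symm v (e k), mul_comm, Complex.mul_conj]
    simp [Complex.normSq_eq_norm_sq]
    norm_cast
  · rw [inner_self_eq_norm_sq_to_K]
    norm_cast

theorem summable_weighted_inner_sq (e : HilbertBasis ℕ ℂ H) {w : ℕ → ℝ} (hw : ∀ j, 0 ≤ w j)
    {v : ℕ → H} (hs : Summable fun j => w j * ‖v j‖ ^ 2) :
    Summable fun p : ℕ × ℕ => w p.1 * ‖⟪e p.2, v p.1⟫‖ ^ 2 := by
  have h (j : ℕ) := (hasSum_norm_inner_sq e (v j)).mul_left (w j)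
  refine (summable_prod_of_nonneg fun p => mul_nonneg (hw _) (sq_nonneg _)).2
    ⟨fun j => (h j).summable, ?_⟩
  simp_rw [(h _).tsum_eq]
  exact hs

/-- Here `d j` stands for `D e_j`, where `D` has matrix elements `gap j k ⟨e'_k, e_j⟩` between two
eigenbases; expanding `⟨e_j, D e_j⟩` in the second basis gives the double series. Its absolute
convergence follows from `|gap| ≤ 1 + gap²`: the weights and the numbers `w_j ‖D e_j‖²` are
summable. -/
theorem hasSum_weighted_gap {e e' : HilbertBasis ℕ ℂ H} {w : ℕ → ℝ} (hw : ∀ j, 0 ≤ w j)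
    {d : ℕ → H} {gap : ℕ → ℕ → ℝ} (h : ∀ j k, ⟪e' k, d j⟫ = (gap j k : ℂ) * ⟪e' k, e j⟫)
    (hs : Summable w) (hsd : Summable fun j => w j * ‖d j‖ ^ 2) {T : ℝ}
    (hT : HasSum (fun j => w j * (⟪e j, d j⟫).re) T) :
    HasSum (fun p : ℕ × ℕ => w p.1 * (gap p.1 p.2 * ‖⟪e' p.2, e p.1⟫‖ ^ 2)) T := by
  have h1 : Summable fun p : ℕ × ℕ => w p.1 * ‖⟪e' p.2, e p.1⟫‖ ^ 2 :=
    summable_weighted_inner_sq e' hw (by simpa [e.orthonormal.norm_eq_one] using hs)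
  have h2 := summable_weighted_inner_sq e' hw hsd
  have ha : Summable fun p : ℕ × ℕ => w p.1 * (gap p.1 p.2 * ‖⟪e' p.2, e p.1⟫‖ ^ 2) := by
    refine (h1.add h2).of_norm_bounded fun p => ?_
    have h3 : ‖⟪e' p.2, d p.1⟫‖ = |gap p.1 p.2| * ‖⟪e' p.2, e p.1⟫‖ := by
      rw [h, norm_mul, Complex.norm_real, Real.norm_eq_abs]
    rw [h3, Real.norm_eq_abs, abs_mul, abs_of_nonneg (hw _), abs_mul,
      abs_of_nonneg (sq_nonneg ‖⟪e' p.2, e p.1⟫‖), ← mul_add, mul_pow]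
    refine mul_le_mul_of_nonneg_left ?_ (hw _)
    nlinarith [sq_nonneg (|gap p.1 p.2| - 1), sq_nonneg ‖⟪e' p.2, e p.1⟫‖,
      mul_nonneg (sq_nonneg (|gap p.1 p.2| - 1)) (sq_nonneg ‖⟪e' p.2, e p.1⟫‖),
      mul_nonneg (sq_nonneg (|gap p.1 p.2|)) (sq_nonneg ‖⟪e' p.2, e p.1⟫‖)]
  have hj (j : ℕ) : HasSum (fun k => w j * (gap j k * ‖⟪e' k, e j⟫‖ ^ 2))
      (w j * (⟪e j, d j⟫).re) := by
    have h3 := ((e'.hasSum_inner_mul_inner (e j) (d j)).mapL Complex.reCLM).mul_left (w j)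
    convert! h3 using 1
    ext k
    congr 1
    rw [h, ← inner_conj_symm (e j) (e' k)]
    have : (starRingEnd ℂ) ⟪e' k, e j⟫ * ((gap j k : ℂ) * ⟪e' k, e j⟫)
        = ((gap j k * ‖⟪e' k, e j⟫‖ ^ 2 : ℝ) : ℂ) := by
      rw [mul_left_comm, mul_comm ((starRingEnd ℂ) _), Complex.mul_conj,
        Complex.normSq_eq_norm_sq]
      push_cast; rfl
    rw [this, Complex.reCLM_apply, Complex.ofReal_re]
  have := (ha.hasSum.prod_fiberwise hj).unique hT
  rw [← this]
  exact ha.hasSum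

/-- For `b ≤ a` convexity gives `e^a - e^b ≤ e^a (a - b) ≤ M (a - b)`; multiply by `e^a - e^b`. The
expression is symmetric in `a` and `b`. -/
theorem sq_exp_sub_exp_le {M a b : ℝ} (ha : Real.exp a ≤ M) (hb : Real.exp b ≤ M) :
    (Real.exp a - Real.exp b) ^ 2 ≤ M * ((Real.exp a - Real.exp b) * (a - b)) := by
  have key {a b : ℝ} (hab : b ≤ a) (ha : Real.exp a ≤ M) :
      (Real.exp a - Real.exp b) ^ 2 ≤ M * ((Real.exp a - Real.exp b) * (a - b)) := by
    have h1 : 0 ≤ Real.exp a - Real.exp b := sub_nonneg.2 (Real.exp_le_exp.2 hab)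
    have h2 : Real.exp a - Real.exp b ≤ M * (a - b) := by
      have h3 := Real.add_one_le_exp (b - a)
      have h4 : Real.exp b = Real.exp a * Real.exp (b - a) := by rw [← Real.exp_add]; ring_nf
      have h5 : Real.exp a - Real.exp b ≤ Real.exp a * (a - b) := by
        rw [h4]; nlinarith [Real.exp_pos a]
      nlinarith
    nlinarith
  rcases le_total b a with h | h
  · exact key h ha
  · have := key h hb
    nlinarith

/-- The symmetrised relative entropy of two exponentials controls their Hilbert-Schmidt
distance. -/
theorem tsum_sq_exp_sub_exp_le {e e' : HilbertBasis ℕ ℂ H} {μ ν : ℕ → ℝ} {d d' : ℕ → H}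
    (h : ∀ j k, ⟪e' k, d j⟫ = ((μ j - ν k : ℝ) : ℂ) * ⟪e' k, e j⟫)
    (h' : ∀ k j, ⟪e j, d' k⟫ = ((μ j - ν k : ℝ) : ℂ) * ⟪e j, e' k⟫)
    (hs : Summable fun j => Real.exp (μ j)) (hs' : Summable fun k => Real.exp (ν k))
    (hsd : Summable fun j => Real.exp (μ j) * ‖d j‖ ^ 2)
    (hsd' : Summable fun k => Real.exp (ν k) * ‖d' k‖ ^ 2) {T T' : ℝ}
    (hT : HasSum (fun j => Real.exp (μ j) * (⟪e j, d j⟫).re) T)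
    (hT' : HasSum (fun k => Real.exp (ν k) * (⟪e' k, d' k⟫).re) T') {M : ℝ}
    (hM : ∀ j, Real.exp (μ j) ≤ M) (hM' : ∀ k, Real.exp (ν k) ≤ M) :
    (Summable fun p : ℕ × ℕ =>
      (Real.exp (μ p.1) - Real.exp (ν p.2)) ^ 2 * ‖⟪e' p.2, e p.1⟫‖ ^ 2) ∧
    ∑' p : ℕ × ℕ, (Real.exp (μ p.1) - Real.exp (ν p.2)) ^ 2 * ‖⟪e' p.2, e p.1⟫‖ ^ 2
      ≤ M * (T - T') := by
  have h1 := hasSum_weighted_gap (fun j => (Real.exp_pos (μ j)).le) h hs hsd hT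
  have h2 := hasSum_weighted_gap (e := e') (e' := e) (fun j => (Real.exp_pos (ν j)).le)
    (gap := fun k j => μ j - ν k) h' hs' hsd' hT'
  -- The second trace is summed with its own eigenbasis first; transposing the index pairs allows
  -- subtraction term by term.
  rw [← (Equiv.prodComm ℕ ℕ).hasSum_iff] at h2
  have h3 := (h1.sub h2).mul_left M
  have hle (p : ℕ × ℕ) : (Real.exp (μ p.1) - Real.exp (ν p.2)) ^ 2 * ‖⟪e' p.2, e p.1⟫‖ ^ 2
      ≤ M * (Real.exp (μ p.1) * ((μ p.1 - ν p.2) * ‖⟪e' p.2, e p.1⟫‖ ^ 2)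
        - Real.exp (ν p.2) * ((μ p.1 - ν p.2) * ‖⟪e p.1, e' p.2⟫‖ ^ 2)) := by
    rw [norm_inner_symm (e p.1)]
    calc _ ≤ (M * ((Real.exp (μ p.1) - Real.exp (ν p.2)) * (μ p.1 - ν p.2)))
          * ‖⟪e' p.2, e p.1⟫‖ ^ 2 := by
          gcongr
          exact sq_exp_sub_exp_le (hM _) (hM' _)
      _ = _ := by ring
  have hsum : Summable fun p : ℕ × ℕ =>
      (Real.exp (μ p.1) - Real.exp (ν p.2)) ^ 2 * ‖⟪e' p.2, e p.1⟫‖ ^ 2 :=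
    Summable.of_nonneg_of_le (fun p => by positivity) hle h3.summable
  refine ⟨hsum, ?_⟩
  rw [← h3.tsum_eq]
  exact hsum.tsum_le_tsum hle h3.summable

end RelativeEntropy

/-! ### Stability of quantum exponentials -/

section QuantumExponential

local notation "⟪" x ", " y "⟫" => inner ℂ x y

variable {ε c : ℝ}

/-- The spectral data of a quantum exponential of `-h_ξ` with a Schwartz symbol. -/
structure IsGibbsState (ε c : ℝ) (hε : ε ≠ 0) (ξ : Multipliers)
    (f : 𝓢(Plane × Plane, Fin 4 → ℝ)) (e : HilbertBasis ℕ ℂ SpinorL2)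
    (φ : ℕ → 𝓢(Plane, Spinor)) (μ : ℕ → ℝ) : Prop where
  temperate : ξ.Temperate
  basis : ∀ j, e j = toL2 (φ j)
  eigen : ∀ j, (μ j : ℂ) • φ j = -(kineticOp ε c (φ j)
    + driftOp ε (ContinuousLinearMap.id ℝ Plane) unitVec ξ (φ j))
  kernel : ∀ j, KernelRep ((Real.exp (μ j) : ℂ) • φ j) (φ j) (symbolKernel ε hε f)

theorem IsEquilibrium.exists_isGibbsState (hε : ε ≠ 0) {n₀ : Plane → ℝ} {n : Plane → Fin 3 → ℝ}
    {J : Plane → Fin 2 → ℝ} {ξ : Multipliers} {g : PauliField} (h : IsEquilibrium ε c n₀ n J ξ g)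
    (f : 𝓢(Plane × Plane, Fin 4 → ℝ)) (hf : ∀ r p, f (r, p) = g r p) :
    ∃ e φ μ, IsGibbsState ε c hε ξ f e φ μ := by
  have hξ : ξ.Temperate := ⟨h.temperate_A, h.temperate_B, h.temperate_U⟩
  obtain ⟨e, φ, μ, he⟩ := h.exp_form
  refine ⟨e, φ, μ, hξ, fun j => (he j).1, fun j => ?_, fun j x => ?_⟩
  · ext1 x
    rw [smul_apply, ← (he j).2.1 x, weylOp_neg_modifiedHamiltonian hε c hξ]
    rfl
  · rw [smul_apply, ← (he j).2.2 x, ← weylOp_eq_kernel]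
    simp_rw [hf]

/-- The difference of the quantizations of two modified Hamiltonians. -/
def gapOp (ε : ℝ) {D : Type*} [NormedAddCommGroup D] [NormedSpace ℝ D] (π : D →L[ℝ] Plane)
    (v : Fin 2 → D) (ξ ξ' : Multipliers) (F : 𝓢(D, Spinor)) : 𝓢(D, Spinor) :=
  driftOp ε π v ξ' F - driftOp ε π v ξ F

/-- `gapOp` on spinors. -/
abbrev spinorGap (ε : ℝ) (ξ ξ' : Multipliers) : 𝓢(Plane, Spinor) → 𝓢(Plane, Spinor) :=
  gapOp ε (ContinuousLinearMap.id ℝ Plane) unitVec ξ ξ'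

/-- `gapOp` on kernels. -/
abbrev kernelGap (ε : ℝ) (ξ ξ' : Multipliers) :
    𝓢(Plane × Plane, Spinor) → 𝓢(Plane × Plane, Spinor) :=
  gapOp ε (ContinuousLinearMap.fst ℝ Plane Plane) (fun k => (unitVec k, 0)) ξ ξ'

theorem spinorGap_eq (ε : ℝ) (ξ ξ' : Multipliers) (F : 𝓢(Plane, Spinor)) :
    spinorGap ε ξ ξ' F = driftOp ε (ContinuousLinearMap.id ℝ Plane) unitVec ξ' F
      - driftOp ε (ContinuousLinearMap.id ℝ Plane) unitVec ξ F := rfl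

theorem isSymm_spinorGap (ε : ℝ) {ξ ξ' : Multipliers} (hξ : ξ.Temperate) (hξ' : ξ'.Temperate) :
    IsSymm (spinorGap ε ξ ξ') :=
  (isSymm_driftOp ε hξ').sub (isSymm_driftOp ε hξ)

theorem intertwines_gap (ε : ℝ) {ξ ξ' : Multipliers} (hξ : ξ.Temperate) (hξ' : ξ'.Temperate) :
    Intertwines (spinorGap ε ξ ξ') (kernelGap ε ξ ξ') :=
  (intertwines_driftOp ε hξ').sub (intertwines_driftOp ε hξ)

theorem mulOp_complex_smul {D : Type*} [NormedAddCommGroup D] [NormedSpace ℝ D]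
    (π : D →L[ℝ] Plane) {f : Plane → ℝ} (hf : Function.HasTemperateGrowth f) (a : ℂ)
    (F : 𝓢(D, Spinor)) : mulOp π f (a • F) = a • mulOp π f F := by
  ext1 z
  simp only [mulOp_apply π hf, smul_apply]
  rw [smul_comm]

theorem momentumOp_complex_smul {D : Type*} [NormedAddCommGroup D] [NormedSpace ℝ D]
    (ε : ℝ) (v : D) (a : ℂ) (F : 𝓢(D, Spinor)) :
    momentumOp ε v (a • F) = a • momentumOp ε v F := by
  simp only [momentumOp, LineDeriv.lineDerivOp_smul]
  rw [smul_comm]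

theorem spinOp_complex_smul {D : Type*} [NormedAddCommGroup D] [NormedSpace ℝ D]
    (s : Fin 4) (a : ℂ) (F : 𝓢(D, Spinor)) : spinOp s (a • F) = a • spinOp s F := by
  ext1 z
  simp

theorem spinorGap_smul (ε : ℝ) {ξ ξ' : Multipliers} (hξ : ξ.Temperate) (hξ' : ξ'.Temperate)
    (a : ℂ) (F : 𝓢(Plane, Spinor)) : spinorGap ε ξ ξ' (a • F) = a • spinorGap ε ξ ξ' F := by
  have h {ξ : Multipliers} (hξ : ξ.Temperate) :
      driftOp ε (ContinuousLinearMap.id ℝ Plane) unitVec ξ (a • F)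
        = a • driftOp ε (ContinuousLinearMap.id ℝ Plane) unitVec ξ F := by
    simp only [driftOp, mulOp_complex_smul _ hξ.A, mulOp_complex_smul _ (temperate_coord hξ.B _),
      mulOp_complex_smul _ (temperate_coord hξ.U _), momentumOp_complex_smul, spinOp_complex_smul,
      smul_add, Finset.smul_sum]
    congr 1
    refine Finset.sum_congr rfl fun k _ => ?_
    rw [smul_comm (1 / 2 : ℝ) a, smul_comm (1 / 2 : ℝ) a]
  rw [spinorGap_eq, h hξ, h hξ', spinorGap_eq, smul_sub]

variable {hε : ε ≠ 0} {ξ ξ' : Multipliers} {f f' : 𝓢(Plane × Plane, Fin 4 → ℝ)}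
  {e e' : HilbertBasis ℕ ℂ SpinorL2} {φ φ' : ℕ → 𝓢(Plane, Spinor)} {μ ν : ℕ → ℝ}

theorem IsGibbsState.hasSum_exp (h : IsGibbsState ε c hε ξ f e φ μ) :
    HasSum (fun j => Real.exp (μ j)) (2 * weylConst ε * ∫ x, ∫ p, f (x, p) 0) := by
  have h1 := (hasSum_trace h.basis h.kernel).mapL Complex.reCLM
  convert! h1 using 1
  · ext j
    have h2 : ‖toL2 (φ j)‖ = 1 := by rw [← h.basis]; exact e.orthonormal.norm_eq_one j
    rw [map_smul, inner_smul_right, inner_self_eq_norm_sq_to_K, h2]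
    simp
    norm_cast
  · simp_rw [diagTrace_symbolKernel]
    rw [integral_complex_ofReal, integral_const_mul]
    simp

/-- All eigenvalues are positive, so each is at most the trace, which is a multiple of the total
mass. -/
theorem IsGibbsState.exp_le (h : IsGibbsState ε c hε ξ f e φ μ) (j : ℕ) :
    Real.exp (μ j) ≤ 2 * weylConst ε * ∫ x, ∫ p, f (x, p) 0 :=
  le_hasSum h.hasSum_exp j fun _ _ => (Real.exp_pos _).le

/-- The density of the pairing of multipliers with the moments of a distribution. -/
def multiplierPairing (ξ : Multipliers) (f : 𝓢(Plane × Plane, Fin 4 → ℝ)) (x : Plane) : ℝ :=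
  ξ.A x * (∫ p, f (x, p) 0) + ∑ s : Fin 3, ξ.B x s * (∫ p, f (x, p) s.succ)
    + ∑ k, ξ.U x k * ∫ p : Plane, p k * f (x, p) 0

/-- The trace of the operator gap times the Gibbs operator: the gap, applied to the first variable
of the kernel, is evaluated on the diagonal. The kinetic part does not occur, so no second moment in
`p` enters. -/
theorem IsGibbsState.hasSum_gap (h : IsGibbsState ε c hε ξ f e φ μ) {ζ ζ' : Multipliers}
    (hζ : ζ.Temperate) (hζ' : ζ'.Temperate) :
    HasSum (fun j => Real.exp (μ j) * (⟪e j, toL2 (spinorGap ε ζ ζ' (φ j))⟫).re)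
      (2 * weylConst ε * ∫ x, (multiplierPairing ζ' f x - multiplierPairing ζ f x)) := by
  have h1 := (hasSum_trace h.basis fun j =>
    intertwines_gap ε hζ hζ' _ _ _ (h.kernel j)).mapL Complex.reCLM
  convert! h1 using 1
  · ext j
    rw [spinorGap_smul ε hζ hζ', map_smul, inner_smul_right, h.basis, Complex.reCLM_apply,
      Complex.re_ofReal_mul]
  · rw [← Complex.reCLM.integral_comp_comm (integrable_diagTrace _), ← integral_const_mul]
    congr 1; ext1 x
    have h2 (ξ : Multipliers) (hξ : ξ.Temperate) := re_diagTrace_driftOp_symbolKernel hε f hξ x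
    have h3 : diagTrace (fun β => kernelGap ε ζ ζ' (symbolKernel ε hε f β)) x
        = diagTrace (fun β => driftOp ε (ContinuousLinearMap.fst ℝ Plane Plane)
            (fun k => (unitVec k, 0)) ζ' (symbolKernel ε hε f β)) x
          - diagTrace (fun β => driftOp ε (ContinuousLinearMap.fst ℝ Plane Plane)
            (fun k => (unitVec k, 0)) ζ (symbolKernel ε hε f β)) x := by
      simp only [diagTrace, gapOp, sub_apply, PiLp.sub_apply, Finset.sum_sub_distrib]
    rw [h3, Complex.reCLM_apply, Complex.sub_re, h2 _ hζ', h2 _ hζ]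
    simp only [multiplierPairing]
    ring

/-- The trace formula applied to the square of the gap operator; by symmetry its diagonal elements
are squared norms. This supplies the absolute convergence needed to rearrange the entropy series. -/
theorem IsGibbsState.summable_gap_sq (h : IsGibbsState ε c hε ξ f e φ μ) {ζ ζ' : Multipliers}
    (hζ : ζ.Temperate) (hζ' : ζ'.Temperate) :
    Summable fun j => Real.exp (μ j) * ‖toL2 (spinorGap ε ζ ζ' (φ j))‖ ^ 2 := by
  have hD := intertwines_gap ε hζ hζ'
  have h1 := (hasSum_trace h.basis fun j =>
    (hD.comp hD) _ _ _ (h.kernel j)).mapL Complex.reCLM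
  refine h1.summable.congr fun j => ?_
  beta_reduce
  rw [spinorGap_smul ε hζ hζ', spinorGap_smul ε hζ hζ', map_smul, inner_smul_right,
    isSymm_spinorGap ε hζ hζ', inner_self_eq_norm_sq_to_K, Complex.reCLM_apply,
    Complex.re_ofReal_mul]
  norm_cast

/-- Adding and subtracting the kinetic part writes the gap as the difference of two full
Hamiltonians. One acts on its eigenvector `φ j`, the other is moved by symmetry to its eigenvector
`φ' k`. -/
theorem IsGibbsState.inner_gap (h : IsGibbsState ε c hε ξ f e φ μ)
    (h' : IsGibbsState ε c hε ξ' f' e' φ' ν) (j k : ℕ) :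
    ⟪e' k, toL2 (spinorGap ε ξ ξ' (φ j))⟫ = ((μ j - ν k : ℝ) : ℂ) * ⟪e' k, e j⟫ := by
  have h1 : spinorGap ε ξ ξ' (φ j) = (μ j : ℂ) • φ j + (kineticOp ε c (φ j)
      + driftOp ε (ContinuousLinearMap.id ℝ Plane) unitVec ξ' (φ j)) := by
    rw [h.eigen j, spinorGap_eq]; abel
  have h2 := ((isSymm_kineticOp ε c).add (isSymm_driftOp ε h'.temperate)) (φ' k) (φ j)
  have h3 := neg_eq_iff_eq_neg.2 (h'.eigen k)
  simp only [← h3] at h2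
  rw [h1, map_add, inner_add_right, h'.basis, h2, map_neg, map_smul, map_smul, inner_neg_left,
    inner_smul_left, inner_smul_right, h.basis, Complex.conj_ofReal]
  push_cast; ring

theorem IsGibbsState.inner_gap' (h : IsGibbsState ε c hε ξ f e φ μ)
    (h' : IsGibbsState ε c hε ξ' f' e' φ' ν) (k j : ℕ) :
    ⟪e j, toL2 (spinorGap ε ξ ξ' (φ' k))⟫ = ((μ j - ν k : ℝ) : ℂ) * ⟪e j, e' k⟫ := by
  rw [h.basis, isSymm_spinorGap ε h.temperate h'.temperate, ← inner_conj_symm, h'.basis,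
    ← h'.basis k, h.inner_gap h', map_mul, Complex.conj_ofReal, inner_conj_symm, h'.basis, h.basis]

theorem symbolKernel_sub (hε : ε ≠ 0) (f f' : 𝓢(Plane × Plane, Fin 4 → ℝ)) (β : Fin 2)
    (z : Plane × Plane) :
    symbolKernel ε hε (f - f') β z = symbolKernel ε hε f β z - symbolKernel ε hε f' β z := by
  have h (s : Fin 4) : scalarKernel ε hε (complexComp (f - f') s) z
      = scalarKernel ε hε (complexComp f s) z - scalarKernel ε hε (complexComp f' s) z := by
    obtain ⟨x, y⟩ := z
    rw [scalarKernel_apply, scalarKernel_apply, scalarKernel_apply, ← pftSchwartz_apply 1 one_ne_zero,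
      ← pftSchwartz_apply 1 one_ne_zero, ← pftSchwartz_apply 1 one_ne_zero]
    simp only [pftSchwartz_apply, pft_eq]
    rw [← integral_sub]
    · congr 1; ext1 p
      rw [← smul_sub]
      simp
    · exact integrable_unimodular_smul (continuous_phase_left _ _) (by simp)
        (restrictFst _ (complexComp f s)).integrable
    · exact integrable_unimodular_smul (continuous_phase_left _ _) (by simp)
        (restrictFst _ (complexComp f' s)).integrable
  simp only [symbolKernel_apply, h, sub_smul, Finset.sum_sub_distrib, smul_sub]

/-- The operator with a given Schwartz kernel. -/
def applyKernel (K : Fin 2 → 𝓢(Plane × Plane, Spinor)) (φ : 𝓢(Plane, Spinor)) : 𝓢(Plane, Spinor) :=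
  ∑ β, restrictFst 0 (SchwartzMap.compCLMOfContinuousLinearEquiv ℝ
    (ContinuousLinearEquiv.prodComm ℝ Plane Plane) (pftSchwartz 1 one_ne_zero
      (SchwartzMap.smulLeftCLM Spinor (fun z : Plane × Plane => φ z.2 β) (K β))))

/-- The partial Fourier transform at frequency zero is the integral over the second variable;
`applyKernel` is built this way because the result is then a Schwartz function by construction. -/
theorem kernelRep_applyKernel (K : Fin 2 → 𝓢(Plane × Plane, Spinor)) (φ : 𝓢(Plane, Spinor)) :
    KernelRep (applyKernel K φ) φ K := fun x => by
  have ht (β : Fin 2) : Function.HasTemperateGrowth fun z : Plane × Plane => φ z.2 β :=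
    ((EuclideanSpace.proj β : Spinor →L[ℂ] ℂ).restrictScalars ℝ).hasTemperateGrowth.comp
      (φ.hasTemperateGrowth.comp (ContinuousLinearMap.snd ℝ Plane Plane).hasTemperateGrowth)
  rw [applyKernel, sum_apply]
  refine Finset.sum_congr rfl fun β _ => ?_
  rw [restrictFst_apply, SchwartzMap.compCLMOfContinuousLinearEquiv_apply, Function.comp_apply,
    pftSchwartz_apply, pft_eq]
  congr 1; ext1 y
  rw [SchwartzMap.smulLeftCLM_apply_apply (ht β)]
  simp [phase]

/-- The difference of the two exponentials is diagonal in the same mixed sense as the Hamiltonian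
gap: the first operator acts on `φ j` and the second, by symmetry, on `φ' k`. -/
theorem IsGibbsState.inner_applyKernel_sub (h : IsGibbsState ε c hε ξ f e φ μ)
    (h' : IsGibbsState ε c hε ξ' f' e' φ' ν) (j k : ℕ) :
    ⟪e' k, toL2 (applyKernel (symbolKernel ε hε (f - f')) (φ j))⟫
      = ((Real.exp (μ j) - Real.exp (ν k) : ℝ) : ℂ) * ⟪e' k, e j⟫ := by
  have h1 : applyKernel (symbolKernel ε hε (f - f')) (φ j)
      = (Real.exp (μ j) : ℂ) • φ j - applyKernel (symbolKernel ε hε f') (φ j) := by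
    ext1 x
    rw [sub_apply, kernelRep_applyKernel _ _ x, h.kernel j x, kernelRep_applyKernel _ _ x,
      ← Finset.sum_sub_distrib]
    refine Finset.sum_congr rfl fun β _ => ?_
    rw [← integral_sub (integrable_coord_smul_kernel _ _ β x)
      (integrable_coord_smul_kernel _ _ β x)]
    simp_rw [symbolKernel_sub, smul_sub]
  rw [h1, map_sub, inner_sub_right, h'.basis,
    inner_symbolKernel_symm hε f' (h'.kernel k) (kernelRep_applyKernel _ (φ j)), map_smul, map_smul,
    inner_smul_left, inner_smul_right, Complex.conj_ofReal, h.basis]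
  push_cast; ring

/-- The `L²` distance of the symbols of two Gibbs states is controlled by the pairing of the
differences of the multipliers and of the moments. -/
theorem exists_integral_sq_sub_le (hε : ε ≠ 0) : ∃ C : ℝ, 0 < C ∧
    ∀ {ξ ξ' : Multipliers} {f f' : 𝓢(Plane × Plane, Fin 4 → ℝ)}
      {e e' : HilbertBasis ℕ ℂ SpinorL2} {φ φ' : ℕ → 𝓢(Plane, Spinor)} {μ ν : ℕ → ℝ} {M : ℝ},
      IsGibbsState ε c hε ξ f e φ μ → IsGibbsState ε c hε ξ' f' e' φ' ν →
      ∫ x, ∫ p, f (x, p) 0 ≤ M → ∫ x, ∫ p, f' (x, p) 0 ≤ M →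
      ∫ z, ∑ s, (f z s - f' z s) ^ 2
        ≤ C * M * ((∫ x, (multiplierPairing ξ' f x - multiplierPairing ξ f x))
          - ∫ x, (multiplierPairing ξ' f' x - multiplierPairing ξ f' x)) := by
  obtain ⟨C, hC0, hC⟩ := exists_integral_norm_sq_symbolKernel hε
  have hw := weylConst_pos hε
  -- One factor `2 * weylConst ε` comes from the bound of the eigenvalues by the trace, the other
  -- from the trace of the gap; `C` converts the Hilbert-Schmidt norm into the `L²` norm of symbols.
  refine ⟨(2 * weylConst ε) ^ 2 / C, by positivity, ?_⟩
  intro ξ ξ' f f' e e' φ φ' μ ν M h h' hM hM'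
  obtain ⟨hsum, hle⟩ := tsum_sq_exp_sub_exp_le (h.inner_gap h') (h.inner_gap' h')
    h.hasSum_exp.summable h'.hasSum_exp.summable (h.summable_gap_sq h.temperate h'.temperate)
    (h'.summable_gap_sq h.temperate h'.temperate) (h.hasSum_gap h.temperate h'.temperate)
    (h'.hasSum_gap h.temperate h'.temperate) (M := 2 * weylConst ε * M)
    (fun j => (h.exp_le j).trans (by gcongr)) (fun j => (h'.exp_le j).trans (by gcongr))
  have hHS := hasSum_norm_sq_kernel h.basis fun j =>
    kernelRep_applyKernel (symbolKernel ε hε (f - f')) (φ j)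
  have hrow (j : ℕ) : HasSum (fun k =>
      (Real.exp (μ j) - Real.exp (ν k)) ^ 2 * ‖⟪e' k, e j⟫‖ ^ 2)
      (‖toL2 (applyKernel (symbolKernel ε hε (f - f')) (φ j))‖ ^ 2) := by
    have h1 := hasSum_norm_inner_sq e' (toL2 (applyKernel (symbolKernel ε hε (f - f')) (φ j)))
    simp_rw [h.inner_applyKernel_sub h', norm_mul, mul_pow, Complex.norm_real, Real.norm_eq_abs,
      sq_abs] at h1
    exact h1
  -- Row `j` of the double series sums by Parseval to the squared norm of the difference of the
  -- exponentials applied to `φ j`; these add up to the squared Hilbert-Schmidt norm.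
  have heq := (hsum.hasSum.prod_fiberwise hrow).unique hHS
  rw [heq, hC] at hle
  have hf : ∫ z, ∑ s, (f - f') z s ^ 2 = ∫ z, ∑ s, (f z s - f' z s) ^ 2 := by
    simp [sub_apply]
  rw [hf] at hle
  rw [div_mul_eq_mul_div, div_mul_eq_mul_div, le_div_iff₀ hC0]
  calc _ = C * ∫ z, ∑ s, (f z s - f' z s) ^ 2 := mul_comm _ _
    _ ≤ _ := hle
    _ = _ := by ring

end QuantumExponential

/-! ### Pairing of multipliers with moments -/

section RapidMoments

/-- Measurable functions of the position that decrease rapidly. -/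
structure RapidFun (F : Plane → ℝ) : Prop where
  meas : AEStronglyMeasurable F volume
  decay : ∀ k : ℕ, ∃ C : ℝ, ∀ x, |F x| ≤ C * ((1 + ‖x‖) ^ k)⁻¹

theorem RapidFun.sub {F G : Plane → ℝ} (hF : RapidFun F) (hG : RapidFun G) :
    RapidFun fun x => F x - G x where
  meas := hF.meas.sub hG.meas
  decay k := by
    obtain ⟨C, hC⟩ := hF.decay k
    obtain ⟨D, hD⟩ := hG.decay k
    refine ⟨C + D, fun x => (abs_sub _ _).trans ?_⟩
    rw [add_mul]
    exact add_le_add (hC x) (hD x)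

theorem RapidFun.integrable_mul {F : Plane → ℝ} (hF : RapidFun F) {a : Plane → ℝ}
    (ha : AEStronglyMeasurable a volume) {K : ℝ} {m : ℕ} (hK : ∀ x, |a x| ≤ K * (1 + ‖x‖) ^ m) :
    Integrable fun x => a x * F x := by
  obtain ⟨C, hC⟩ := hF.decay (m + 3)
  refine ((integrable_inv_pow (k := 3) le_rfl).const_mul (K * C)).mono' (ha.mul hF.meas)
    (Eventually.of_forall fun x => ?_)
  rw [Real.norm_eq_abs, abs_mul]
  calc |a x| * |F x| ≤ (K * (1 + ‖x‖) ^ m) * (C * ((1 + ‖x‖) ^ (m + 3))⁻¹) :=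
        mul_le_mul (hK x) (hC x) (abs_nonneg _) ((abs_nonneg _).trans (hK x))
    _ = K * C * ((1 + ‖x‖) ^ 3)⁻¹ := by
        have : (0 : ℝ) < 1 + ‖x‖ := by positivity
        field_simp
        ring

theorem exists_temperate_bound {a : Plane → ℝ} (ha : Function.HasTemperateGrowth a) :
    ∃ (K : ℝ) (m : ℕ), ∀ x, |a x| ≤ K * (1 + ‖x‖) ^ m := by
  obtain ⟨m, K, hK⟩ := ha.2 0
  exact ⟨K, m, fun x => by simpa using hK x⟩

theorem RapidFun.integrable_temperate_mul {F : Plane → ℝ} (hF : RapidFun F) {a : Plane → ℝ}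
    (ha : Function.HasTemperateGrowth a) : Integrable fun x => a x * F x := by
  obtain ⟨K, m, hK⟩ := exists_temperate_bound ha
  exact hF.integrable_mul ha.1.continuous.aestronglyMeasurable hK

theorem aestronglyMeasurable_weight_pow (m : ℕ) :
    AEStronglyMeasurable (fun x : Plane => (1 + ‖x‖) ^ m) volume :=
  (by fun_prop : Continuous fun x : Plane => (1 + ‖x‖) ^ m).aestronglyMeasurable

theorem RapidFun.integrable_abs {F : Plane → ℝ} (hF : RapidFun F) (m : ℕ) :
    Integrable fun x => (1 + ‖x‖) ^ m * |F x| := by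
  have h := (hF.integrable_mul (K := 1) (aestronglyMeasurable_weight_pow m) fun x => by
    rw [one_mul, abs_of_nonneg (by positivity)]).norm
  refine h.congr (Eventually.of_forall fun x => ?_)
  simp only
  rw [norm_mul, Real.norm_of_nonneg (by positivity), Real.norm_eq_abs]

theorem integrable_weight_mul_norm {ι : Type*} [Fintype ι] {v : Plane → ι → ℝ}
    (hv : ∀ i, RapidFun fun x => v x i) (m : ℕ) : Integrable fun x => (1 + ‖x‖) ^ m * ‖v x‖ := by
  have hm : AEMeasurable v volume := aemeasurable_pi_iff.2 fun i => (hv i).meas.aemeasurable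
  refine (integrable_finsetSum Finset.univ fun i _ => (hv i).integrable_abs m).mono'
    ((aestronglyMeasurable_weight_pow m).mul hm.norm.aestronglyMeasurable)
    (Eventually.of_forall fun x => ?_)
  rw [Real.norm_of_nonneg (by positivity), ← Finset.mul_sum]
  gcongr
  refine (pi_norm_le_iff_of_nonneg (Finset.sum_nonneg fun i _ => abs_nonneg _)).2 fun i => ?_
  exact Finset.single_le_sum (f := fun i => |v x i|) (fun i _ => abs_nonneg _) (Finset.mem_univ i)

/-- Decay in `x` of every order survives the momentum integral, so polynomially growing multipliers
can be integrated against the moments. -/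
theorem rapidFun_moment (f : 𝓢(Plane × Plane, Fin 4 → ℝ)) (l : List (Fin 2)) (s : Fin 4) :
    RapidFun fun x => ∫ p, mono l p * f (x, p) s where
  meas := by
    refine AEStronglyMeasurable.integral_prod_right'
      (f := fun z : Plane × Plane => mono l z.2 * f z s) (Continuous.aestronglyMeasurable ?_)
    exact ((continuous_mono l).comp continuous_snd).mul (continuous_schwartz_comp f s continuous_id)
  decay k := by
    obtain ⟨C, hC0, hC⟩ := schwartz_le_mul f k (l.length + 3)
    refine ⟨C * ∫ p : Plane, ((1 + ‖p‖) ^ 3)⁻¹, fun x => ?_⟩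
    have h : ∀ p, ‖mono l p * f (x, p) s‖ ≤ C * ((1 + ‖x‖) ^ k)⁻¹ * ((1 + ‖p‖) ^ 3)⁻¹ := fun p => by
      rw [norm_mul, Real.norm_eq_abs]
      calc _ ≤ (1 + ‖p‖) ^ l.length * (C * (((1 + ‖x‖) ^ k)⁻¹ * ((1 + ‖p‖) ^ (l.length + 3))⁻¹)) :=
            mul_le_mul (abs_mono_le l p) ((norm_le_pi_norm (f (x, p)) s).trans (hC x p))
              (norm_nonneg _) (by positivity)
        _ = _ := by
            have : (0 : ℝ) < 1 + ‖p‖ := by positivity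
            field_simp
            ring
    calc _ ≤ ∫ p : Plane, C * ((1 + ‖x‖) ^ k)⁻¹ * ((1 + ‖p‖) ^ 3)⁻¹ :=
          norm_integral_le_of_norm_le ((integrable_inv_pow le_rfl).const_mul _)
            (Eventually.of_forall h)
      _ = _ := by rw [integral_const_mul]; ring

theorem rapidFun_density (f : 𝓢(Plane × Plane, Fin 4 → ℝ)) (s : Fin 4) :
    RapidFun fun x => ∫ p, f (x, p) s := by
  simpa using rapidFun_moment f [] s

theorem rapidFun_flow (f : 𝓢(Plane × Plane, Fin 4 → ℝ)) (k : Fin 2) :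
    RapidFun fun x => ∫ p : Plane, p k * f (x, p) 0 := by
  simpa using rapidFun_moment f [k] 0

theorem integrable_multiplierPairing {ξ : Multipliers} (hξ : ξ.Temperate)
    (f : 𝓢(Plane × Plane, Fin 4 → ℝ)) : Integrable (multiplierPairing ξ f) :=
  (((rapidFun_density f 0).integrable_temperate_mul hξ.A).add (integrable_finsetSum _ fun s _ =>
    (rapidFun_density f s.succ).integrable_temperate_mul (temperate_coord hξ.B s))).add
    (integrable_finsetSum _ fun k _ =>
      (rapidFun_flow f k).integrable_temperate_mul (temperate_coord hξ.U k))

/-- Growth of multipliers. -/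
def Multipliers.BoundedBy (ξ : Multipliers) (K : ℝ) (m : ℕ) : Prop :=
  ∀ r, |ξ.A r| + ‖ξ.B r‖ + ‖ξ.U r‖ ≤ K * (1 + ‖r‖) ^ m

theorem Multipliers.Temperate.exists_boundedBy {ξ : Multipliers} (hξ : ξ.Temperate) :
    ∃ K m, ξ.BoundedBy K m := by
  obtain ⟨m₁, K₁, h1⟩ := hξ.A.2 0
  obtain ⟨m₂, K₂, h2⟩ := hξ.B.2 0
  obtain ⟨m₃, K₃, h3⟩ := hξ.U.2 0
  refine ⟨|K₁| + |K₂| + |K₃|, m₁ + m₂ + m₃, fun r => ?_⟩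
  have hle {K : ℝ} {m : ℕ} (hm : m ≤ m₁ + m₂ + m₃) {a : ℝ} (h : a ≤ K * (1 + ‖r‖) ^ m) :
      a ≤ |K| * (1 + ‖r‖) ^ (m₁ + m₂ + m₃) := by
    refine h.trans (mul_le_mul (le_abs_self K) (pow_le_pow_right₀ ?_ hm) (by positivity)
      (abs_nonneg _))
    linarith [norm_nonneg r]
  have h1' : |ξ.A r| ≤ K₁ * (1 + ‖r‖) ^ m₁ := by simpa using h1 r
  have h2' : ‖ξ.B r‖ ≤ K₂ * (1 + ‖r‖) ^ m₂ := by simpa using h2 r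
  have h3' : ‖ξ.U r‖ ≤ K₃ * (1 + ‖r‖) ^ m₃ := by simpa using h3 r
  rw [add_mul, add_mul]
  exact add_le_add (add_le_add (hle (by omega) h1') (hle (by omega) h2')) (hle (by omega) h3')

theorem Multipliers.BoundedBy.mono {ξ : Multipliers} {K K' : ℝ} {m m' : ℕ}
    (h : ξ.BoundedBy K m) (hK : |K| ≤ K') (hm : m ≤ m') : ξ.BoundedBy K' m' := fun r => by
  refine (h r).trans (mul_le_mul ((le_abs_self K).trans hK)
    (pow_le_pow_right₀ (by linarith [norm_nonneg r]) hm) (by positivity) ((abs_nonneg _).trans hK))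

/-- The differences of the moments of two distributions, in a weighted `L¹` norm. -/
def momentDistance (m : ℕ) (f f' : 𝓢(Plane × Plane, Fin 4 → ℝ)) : ℝ :=
  (∫ r, (1 + ‖r‖) ^ m * |(∫ p, f (r, p) 0) - ∫ p, f' (r, p) 0|)
  + 3 * (∫ r, (1 + ‖r‖) ^ m * ‖(fun s : Fin 3 => ∫ p, f (r, p) s.succ) -
      fun s : Fin 3 => ∫ p, f' (r, p) s.succ‖)
  + 2 * ∫ r, (1 + ‖r‖) ^ m * ‖(fun k : Fin 2 => ∫ p : Plane, p k * f (r, p) 0) -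
      fun k : Fin 2 => ∫ p : Plane, p k * f' (r, p) 0‖

/-- The left side is bilinear: differences of multipliers against differences of moments. Each
multiplier component differs by at most twice the common bound, and the weights 3 and 2 in
`momentDistance` count the components of spin and flow. -/
theorem pairing_difference_le {ξ ξ' : Multipliers} (hξ : ξ.Temperate) (hξ' : ξ'.Temperate)
    {K : ℝ} {m : ℕ} (hK : ξ.BoundedBy K m) (hK' : ξ'.BoundedBy K m)
    (f f' : 𝓢(Plane × Plane, Fin 4 → ℝ)) :
    (∫ x, (multiplierPairing ξ' f x - multiplierPairing ξ f x))
      - ∫ x, (multiplierPairing ξ' f' x - multiplierPairing ξ f' x)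
      ≤ 2 * K * momentDistance m f f' := by
  have hi := integrable_multiplierPairing hξ f
  have hi1 := integrable_multiplierPairing hξ' f
  have hi2 := integrable_multiplierPairing hξ f'
  have hi3 := integrable_multiplierPairing hξ' f'
  have h0 := ((rapidFun_density f 0).sub (rapidFun_density f' 0)).integrable_abs m
  have hs := integrable_weight_mul_norm
    (v := fun r => (fun s : Fin 3 => ∫ p, f (r, p) s.succ) - fun s : Fin 3 => ∫ p, f' (r, p) s.succ)
    (fun s => (rapidFun_density f s.succ).sub (rapidFun_density f' s.succ)) m
  have hk := integrable_weight_mul_norm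
    (v := fun r => (fun k : Fin 2 => ∫ p : Plane, p k * f (r, p) 0) -
      fun k : Fin 2 => ∫ p : Plane, p k * f' (r, p) 0)
    (fun k => (rapidFun_flow f k).sub (rapidFun_flow f' k)) m
  have hd : Integrable fun x => multiplierPairing ξ' f x - multiplierPairing ξ f x := hi1.sub hi
  have hd' : Integrable fun x => multiplierPairing ξ' f' x - multiplierPairing ξ f' x :=
    hi3.sub hi2
  have h03 : Integrable fun r => (1 + ‖r‖) ^ m * |(∫ p, f (r, p) 0) - ∫ p, f' (r, p) 0|
      + 3 * ((1 + ‖r‖) ^ m * ‖(fun s : Fin 3 => ∫ p, f (r, p) s.succ) -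
        fun s : Fin 3 => ∫ p, f' (r, p) s.succ‖) := h0.add (hs.const_mul 3)
  rw [← integral_sub hd hd', momentDistance, ← integral_const_mul,
    ← integral_const_mul, ← integral_add h0 (hs.const_mul 3),
    ← integral_add h03 (hk.const_mul 2), ← integral_const_mul]
  refine integral_mono (hd.sub hd')
    ((h03.add (hk.const_mul 2)).const_mul _) fun x => ?_
  set W := K * (1 + ‖x‖) ^ m with hW
  set a := (∫ p, f (x, p) 0) - ∫ p, f' (x, p) 0 with ha
  set b := (fun s : Fin 3 => ∫ p, f (x, p) s.succ) - fun s : Fin 3 => ∫ p, f' (x, p) s.succ with hb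
  set u := (fun k : Fin 2 => ∫ p : Plane, p k * f (x, p) 0) -
      fun k : Fin 2 => ∫ p : Plane, p k * f' (x, p) 0 with hu
  have hx := hK x
  have hx' := hK' x
  have hmul {α β y z : ℝ} (h1 : |α| ≤ W) (h2 : |β| ≤ W) (hy : |y| ≤ z) :
      (α - β) * y ≤ 2 * W * z := by
    refine (le_abs_self _).trans ?_
    rw [abs_mul]
    refine mul_le_mul ((abs_sub _ _).trans (by linarith)) hy (abs_nonneg _) ?_
    linarith [abs_nonneg α]
  have hA : (ξ'.A x - ξ.A x) * a ≤ 2 * W * |a| :=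
    hmul (by linarith [norm_nonneg (ξ'.B x), norm_nonneg (ξ'.U x)])
      (by linarith [norm_nonneg (ξ.B x), norm_nonneg (ξ.U x)]) le_rfl
  have hB (s : Fin 3) : (ξ'.B x s - ξ.B x s) * b s ≤ 2 * W * ‖b‖ :=
    hmul ((norm_le_pi_norm (ξ'.B x) s).trans
        (by linarith [abs_nonneg (ξ'.A x), norm_nonneg (ξ'.U x)]))
      ((norm_le_pi_norm (ξ.B x) s).trans (by linarith [abs_nonneg (ξ.A x), norm_nonneg (ξ.U x)]))
      (norm_le_pi_norm b s)
  have hU (k : Fin 2) : (ξ'.U x k - ξ.U x k) * u k ≤ 2 * W * ‖u‖ :=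
    hmul ((norm_le_pi_norm (ξ'.U x) k).trans
        (by linarith [abs_nonneg (ξ'.A x), norm_nonneg (ξ'.B x)]))
      ((norm_le_pi_norm (ξ.U x) k).trans (by linarith [abs_nonneg (ξ.A x), norm_nonneg (ξ.B x)]))
      (norm_le_pi_norm u k)
  have key : (multiplierPairing ξ' f x - multiplierPairing ξ f x)
      - (multiplierPairing ξ' f' x - multiplierPairing ξ f' x)
      = (ξ'.A x - ξ.A x) * a + ∑ s, (ξ'.B x s - ξ.B x s) * b s
        + ∑ k, (ξ'.U x k - ξ.U x k) * u k := by
    simp only [multiplierPairing, ha, hb, hu, Fin.sum_univ_two, Fin.sum_univ_three, Pi.sub_apply]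
    ring
  have hrhs : 2 * K * ((1 + ‖x‖) ^ m * |a| + 3 * ((1 + ‖x‖) ^ m * ‖b‖)
      + 2 * ((1 + ‖x‖) ^ m * ‖u‖)) = 2 * W * |a| + 3 * (2 * W * ‖b‖) + 2 * (2 * W * ‖u‖) := by
    rw [hW]; ring
  calc _ = _ := key
    _ ≤ 2 * W * |a| + 3 * (2 * W * ‖b‖) + 2 * (2 * W * ‖u‖) := by
        rw [Fin.sum_univ_three, Fin.sum_univ_two]
        linarith [hB 0, hB 1, hB 2, hU 0, hU 1]
    _ = _ := hrhs.symm

end RapidMoments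

/-! ### From `L²` convergence to convergence of moments -/

section MomentConvergence

variable {ψ : Plane → ℝ} {ε c τ₀ t : ℝ} {l : List (Fin 2)}

theorem integrable_weight_mul_schwartz {E : Type*} [NormedAddCommGroup E] [NormedSpace ℝ E]
    (k : ℕ) (f : 𝓢(Plane × Plane, E)) :
    Integrable fun z : Plane × Plane => (1 + ‖z.2‖) ^ k * ‖f z‖ := by
  obtain ⟨C, -, hC⟩ := schwartz_le_mul f 3 (k + 3)
  have hm : Continuous fun z : Plane × Plane => (1 + ‖z.2‖) ^ k * ‖f z‖ :=
    ((continuous_const.add continuous_snd.norm).pow k).mul f.continuous.norm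
  refine (integrable_inv_pow_prod.const_mul C).mono' hm.aestronglyMeasurable
    (Eventually.of_forall fun z => ?_)
  rw [Real.norm_of_nonneg (by positivity)]
  calc _ ≤ (1 + ‖z.2‖) ^ k * (C * (((1 + ‖z.1‖) ^ 3)⁻¹ * ((1 + ‖z.2‖) ^ (k + 3))⁻¹)) := by
        gcongr; exact hC z.1 z.2
    _ = _ := by
        have : (0 : ℝ) < 1 + ‖z.2‖ := by positivity
        field_simp
        ring

theorem integral_weight_mul_schwartz {E : Type*} [NormedAddCommGroup E] [NormedSpace ℝ E]
    (k : ℕ) (f : 𝓢(Plane × Plane, E)) :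
    ∫ r, ∫ p : Plane, (1 + ‖p‖) ^ k * ‖f (r, p)‖
      = ∫ z : Plane × Plane, (1 + ‖z.2‖) ^ k * ‖f z‖ :=
  (integral_prod (fun z : Plane × Plane => (1 + ‖z.2‖) ^ k * ‖f z‖)
    (integrable_weight_mul_schwartz k f)).symm

theorem abs_mono_mul_le (f : 𝓢(Plane × Plane, Fin 4 → ℝ)) (s : Fin 4) {k : ℕ} (hl : l.length ≤ k)
    (z : Plane × Plane) : |mono l z.2 * f z s| ≤ (1 + ‖z.2‖) ^ k * ‖f z‖ := by
  rw [abs_mul]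
  exact mul_le_mul ((abs_mono_le l z.2).trans (pow_le_pow_right₀ (by linarith [norm_nonneg z.2]) hl))
    (norm_le_pi_norm (f z) s) (abs_nonneg _) (by positivity)

theorem integrable_mono_mul_schwartz (f : 𝓢(Plane × Plane, Fin 4 → ℝ)) (s : Fin 4) :
    Integrable fun z : Plane × Plane => mono l z.2 * f z s :=
  (integrable_weight_mul_schwartz l.length f).mono'
    (((continuous_mono l).comp continuous_snd).mul
      (continuous_schwartz_comp f s continuous_id)).aestronglyMeasurable
    (Eventually.of_forall fun z => abs_mono_mul_le f s le_rfl z)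

theorem exists_abs_le (hψ : Continuous ψ) (hs : HasCompactSupport ψ) :
    ∃ A : ℝ, 0 < A ∧ ∀ r, |ψ r| ≤ A := by
  obtain ⟨A, hA⟩ := hs.exists_bound_of_continuous hψ
  exact ⟨max A 1, by positivity, fun r => (hA r).trans (le_max_left _ _)⟩

theorem integrable_test_mul_moment (hψ : Continuous ψ) (hs : HasCompactSupport ψ)
    (f : 𝓢(Plane × Plane, Fin 4 → ℝ)) (s : Fin 4) :
    Integrable fun z : Plane × Plane => ψ z.1 * (mono l z.2 * f z s) := by
  obtain ⟨A, -, hA⟩ := exists_abs_le hψ hs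
  exact (integrable_mono_mul_schwartz f s).bdd_mul (c := A)
    (hψ.comp continuous_fst).aestronglyMeasurable (Eventually.of_forall fun z => hA z.1)

theorem integral_test_mul_moment (hψ : Continuous ψ) (hs : HasCompactSupport ψ)
    (f : 𝓢(Plane × Plane, Fin 4 → ℝ)) (s : Fin 4) :
    ∫ r, ψ r * ∫ p, mono l p * f (r, p) s = ∫ z : Plane × Plane, ψ z.1 * (mono l z.2 * f z s) := by
  rw [Measure.volume_eq_prod, integral_prod _ (integrable_test_mul_moment hψ hs f s)]
  simp only [integral_const_mul]

theorem abs_integral_test_mul_moment_le {A : ℝ} (hψ : Continuous ψ) (hs : HasCompactSupport ψ)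
    (hA : ∀ r, |ψ r| ≤ A) (f : 𝓢(Plane × Plane, Fin 4 → ℝ)) (s : Fin 4) {k : ℕ}
    (hl : l.length ≤ k) :
    |∫ r, ψ r * ∫ p, mono l p * f (r, p) s| ≤ A * ∫ r, ∫ p : Plane, (1 + ‖p‖) ^ k * ‖f (r, p)‖ := by
  rw [← Real.norm_eq_abs, integral_test_mul_moment hψ hs, integral_weight_mul_schwartz, ← integral_const_mul]
  refine norm_integral_le_of_norm_le ((integrable_weight_mul_schwartz (E := Fin 4 → ℝ) k f).const_mul A)
    (Eventually.of_forall fun z => ?_)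
  rw [norm_mul]
  exact mul_le_mul (hA z.1) (abs_mono_mul_le f s hl z) (norm_nonneg _)
    ((abs_nonneg _).trans (hA z.1))

/-- For large momentum, `q ≥ R`, the third moment dominates the second with a gain `1/R`. For `q ≤
R` Young's inequality separates `x²` from `q⁴ v²`, and `q⁷ ≤ R⁷` rewrites the latter with the weight
`q⁻³`, integrable on the plane. -/
theorem weighted_young {q R v x lam : ℝ} (hq : 1 ≤ q) (hR : 0 < R) (hv : 0 ≤ v) (hx : 0 ≤ x)
    (hlam : 0 < lam) :
    q ^ 2 * (v * x) ≤ R⁻¹ * (v * (q ^ 3 * x)) + lam * x ^ 2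
      + R ^ 7 / (4 * lam) * (v ^ 2 * (q ^ 3)⁻¹) := by
  have hq0 : 0 < q := by linarith
  rcases le_total R q with h | h
  · have h1 : q ^ 2 * (v * x) ≤ R⁻¹ * (v * (q ^ 3 * x)) := by
      have : 1 ≤ R⁻¹ * q := by rw [inv_mul_eq_div]; exact (one_le_div hR).2 h
      calc q ^ 2 * (v * x) = 1 * (q ^ 2 * (v * x)) := by ring
        _ ≤ (R⁻¹ * q) * (q ^ 2 * (v * x)) := by gcongr
        _ = _ := by ring
    have : 0 ≤ lam * x ^ 2 + R ^ 7 / (4 * lam) * (v ^ 2 * (q ^ 3)⁻¹) := by positivity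
    linarith
  · have h1 : q ^ 2 * (v * x) ≤ lam * x ^ 2 + q ^ 4 * v ^ 2 / (4 * lam) := by
      have : lam * x ^ 2 + q ^ 4 * v ^ 2 / (4 * lam) - q ^ 2 * (v * x)
          = (2 * lam * x - q ^ 2 * v) ^ 2 / (4 * lam) := by field_simp; ring
      have h2 : 0 ≤ (2 * lam * x - q ^ 2 * v) ^ 2 / (4 * lam) := by positivity
      linarith
    have h2 : q ^ 4 * v ^ 2 / (4 * lam) ≤ R ^ 7 / (4 * lam) * (v ^ 2 * (q ^ 3)⁻¹) := by
      calc q ^ 4 * v ^ 2 / (4 * lam) = q ^ 7 / (4 * lam) * (v ^ 2 * (q ^ 3)⁻¹) := by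
            field_simp
        _ ≤ _ := by gcongr
    have : 0 ≤ R⁻¹ * (v * (q ^ 3 * x)) := by positivity
    linarith

theorem integrable_sq_sub (f f' : 𝓢(Plane × Plane, Fin 4 → ℝ)) :
    Integrable fun z : Plane × Plane => ∑ s, (f z s - f' z s) ^ 2 := by
  obtain ⟨C, hC0, hC⟩ := schwartz_le_mul (f - f') 3 3
  refine integrable_finsetSum _ fun s _ => (integrable_inv_pow_prod.const_mul (C * C)).mono'
    (((continuous_schwartz_comp f s continuous_id).sub
      (continuous_schwartz_comp f' s continuous_id)).pow 2).aestronglyMeasurable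
    (Eventually.of_forall fun z => ?_)
  have h := (norm_le_pi_norm ((f - f') z) s).trans (hC z.1 z.2)
  have h2 : ((1 + ‖z.1‖) ^ 3)⁻¹ * ((1 + ‖z.2‖) ^ 3)⁻¹ ≤ 1 :=
    mul_le_one₀ (inv_le_one_of_one_le₀ (one_le_pow₀ (by linarith [norm_nonneg z.1])))
      (by positivity) (inv_le_one_of_one_le₀ (one_le_pow₀ (by linarith [norm_nonneg z.2])))
  rw [norm_pow, pow_two]
  calc _ ≤ C * (((1 + ‖z.1‖) ^ 3)⁻¹ * ((1 + ‖z.2‖) ^ 3)⁻¹) * (C * 1) :=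
        mul_le_mul h (h.trans (by gcongr)) (norm_nonneg _) (by positivity)
    _ = _ := by ring

/-- Convergence in `L²` with bounded moments of order three gives convergence of the moments of
order two. -/
theorem exists_moment_difference_bound (hψ : Continuous ψ) (hs : HasCompactSupport ψ)
    (hl : l.length ≤ 2) {B : ℝ} (hB : 0 ≤ B) {δ : ℝ} (hδ : 0 < δ) : ∃ lam : ℝ, 0 < lam ∧
    ∀ (f f' : 𝓢(Plane × Plane, Fin 4 → ℝ)) (s : Fin 4),
      ∫ r, ∫ p : Plane, (1 + ‖p‖) ^ 3 * ‖f (r, p)‖ ≤ B →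
      ∫ r, ∫ p : Plane, (1 + ‖p‖) ^ 3 * ‖f' (r, p)‖ ≤ B →
      |(∫ r, ψ r * ∫ p, mono l p * f (r, p) s) - ∫ r, ψ r * ∫ p, mono l p * f' (r, p) s|
        ≤ δ + lam * ∫ z, ∑ s, (f z s - f' z s) ^ 2 := by
  obtain ⟨A, hA0, hA⟩ := exists_abs_le hψ hs
  have hi2 : Integrable fun r => ψ r ^ 2 := by
    simp only [pow_two]
    exact (hψ.mul hψ).integrable_of_hasCompactSupport hs.mul_right
  have hiK : Integrable fun z : Plane × Plane => ψ z.1 ^ 2 * ((1 + ‖z.2‖) ^ 3)⁻¹ :=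
    hi2.mul_prod (integrable_inv_pow le_rfl)
  set K := ∫ z : Plane × Plane, ψ z.1 ^ 2 * ((1 + ‖z.2‖) ^ 3)⁻¹
  have hK : 0 ≤ K := integral_nonneg fun z => by positivity
  -- Chosen so that the tail term `2AB/R` is at most `δ/2`; the added `1` keeps `R` positive when `B
  -- = 0`.
  set R := 4 * A * B / δ + 1 with hR
  have hR0 : 0 < R := by positivity
  -- Chosen so that the remainder `R⁷K/(4 lam)` is at most `δ/2`, and positive even when `K = 0`.
  set lam := R ^ 7 * K / (2 * δ) + 1 with hlam
  have hlam0 : 0 < lam := by positivity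
  refine ⟨lam, hlam0, fun f f' s hf hf' => ?_⟩
  have hi3 := ((integrable_weight_mul_schwartz 3 f).add (integrable_weight_mul_schwartz 3 f'))
  have hiB : Integrable fun z : Plane × Plane =>
      (R⁻¹ * A) * ((1 + ‖z.2‖) ^ 3 * ‖f z‖ + (1 + ‖z.2‖) ^ 3 * ‖f' z‖) := hi3.const_mul _
  have hiS := (integrable_sq_sub f f').const_mul lam
  have hiBS : Integrable fun z : Plane × Plane =>
      (R⁻¹ * A) * ((1 + ‖z.2‖) ^ 3 * ‖f z‖ + (1 + ‖z.2‖) ^ 3 * ‖f' z‖)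
        + lam * ∑ s, (f z s - f' z s) ^ 2 := hiB.add hiS
  have hiK' := hiK.const_mul (R ^ 7 / (4 * lam))
  rw [integral_test_mul_moment hψ hs, integral_test_mul_moment hψ hs,
    ← integral_sub (integrable_test_mul_moment hψ hs f s) (integrable_test_mul_moment hψ hs f' s)]
  have hpt (z : Plane × Plane) : ‖ψ z.1 * (mono l z.2 * f z s) - ψ z.1 * (mono l z.2 * f' z s)‖
      ≤ (R⁻¹ * A) * ((1 + ‖z.2‖) ^ 3 * ‖f z‖ + (1 + ‖z.2‖) ^ 3 * ‖f' z‖)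
        + lam * (∑ s, (f z s - f' z s) ^ 2)
        + R ^ 7 / (4 * lam) * (ψ z.1 ^ 2 * ((1 + ‖z.2‖) ^ 3)⁻¹) := by
    have hm : |mono l z.2| ≤ (1 + ‖z.2‖) ^ 2 :=
      (abs_mono_le l z.2).trans (pow_le_pow_right₀ (by linarith [norm_nonneg z.2]) hl)
    have hd : |f z s - f' z s| ≤ ‖f z‖ + ‖f' z‖ := (abs_sub _ _).trans
      (add_le_add (norm_le_pi_norm (f z) s) (norm_le_pi_norm (f' z) s))
    have hsq : |f z s - f' z s| ^ 2 ≤ ∑ s, (f z s - f' z s) ^ 2 := by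
      rw [sq_abs]
      exact Finset.single_le_sum (f := fun s => (f z s - f' z s) ^ 2) (fun _ _ => sq_nonneg _)
        (Finset.mem_univ s)
    have hy := weighted_young (q := 1 + ‖z.2‖) (by linarith [norm_nonneg z.2]) hR0
      (abs_nonneg (ψ z.1)) (abs_nonneg (f z s - f' z s)) hlam0
    rw [sq_abs (ψ z.1)] at hy
    calc _ = |mono l z.2| * (|ψ z.1| * |f z s - f' z s|) := by
          rw [← mul_sub, ← mul_sub, Real.norm_eq_abs, abs_mul, abs_mul]; ring
      _ ≤ (1 + ‖z.2‖) ^ 2 * (|ψ z.1| * |f z s - f' z s|) := by gcongr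
      _ ≤ _ := hy
      _ ≤ _ := by
          gcongr ?_ + lam * ?_ + _
          · rw [mul_assoc, ← mul_add]
            gcongr
            exact hA z.1
  calc _ ≤ ∫ z : Plane × Plane, ((R⁻¹ * A) * ((1 + ‖z.2‖) ^ 3 * ‖f z‖ + (1 + ‖z.2‖) ^ 3 * ‖f' z‖)
        + lam * (∑ s, (f z s - f' z s) ^ 2)
        + R ^ 7 / (4 * lam) * (ψ z.1 ^ 2 * ((1 + ‖z.2‖) ^ 3)⁻¹)) :=
        norm_integral_le_of_norm_le (hiBS.add hiK') (Eventually.of_forall hpt)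
    _ = (R⁻¹ * A) * ((∫ r, ∫ p : Plane, (1 + ‖p‖) ^ 3 * ‖f (r, p)‖)
          + ∫ r, ∫ p : Plane, (1 + ‖p‖) ^ 3 * ‖f' (r, p)‖)
        + lam * (∫ z, ∑ s, (f z s - f' z s) ^ 2) + R ^ 7 / (4 * lam) * K := by
        rw [integral_add hiBS hiK', integral_add hiB hiS, integral_const_mul, integral_const_mul,
          integral_const_mul, integral_add (integrable_weight_mul_schwartz 3 f)
            (integrable_weight_mul_schwartz 3 f'), integral_weight_mul_schwartz,
          integral_weight_mul_schwartz]
    _ ≤ (R⁻¹ * A) * (B + B) + lam * (∫ z, ∑ s, (f z s - f' z s) ^ 2) + R ^ 7 / (4 * lam) * K := by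
        gcongr
    _ ≤ _ := by
        have h1 : (R⁻¹ * A) * (B + B) ≤ δ / 2 := by
          have : (R⁻¹ * A) * (B + B) = (2 * A * B) / R := by field_simp; ring
          rw [this, div_le_iff₀ hR0, hR]
          have : δ / 2 * (4 * A * B / δ + 1) = 2 * A * B + δ / 2 := by field_simp; ring
          rw [this]
          linarith
        have h2 : R ^ 7 / (4 * lam) * K ≤ δ / 2 := by
          have : R ^ 7 / (4 * lam) * K = (R ^ 7 * K) / 4 / lam := by field_simp
          rw [this, div_le_iff₀ hlam0, hlam]
          have : δ / 2 * (R ^ 7 * K / (2 * δ) + 1) = R ^ 7 * K / 4 + δ / 2 := by field_simp; ring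
          rw [this]
          linarith
        linarith

end MomentConvergence

/-! ### Convergence of the equilibria -/

section EquilibriumConvergence

variable {ε c τ₀ t : ℝ} {w g : ℝ → ℝ → PauliField} {ξ : ℝ → ℝ → Multipliers}
  {n₀ : Plane → ℝ} {n : Plane → Fin 3 → ℝ} {J : Plane → Fin 2 → ℝ} {ξlim : Multipliers}
  {glim : PauliField}

theorem IsEquilibrium.temperate (h : IsEquilibrium ε c n₀ n J ξlim glim) : ξlim.Temperate :=
  ⟨h.temperate_A, h.temperate_B, h.temperate_U⟩

/-- The weighted `L¹` distance of two sets of moments. -/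
def momentGap (m : ℕ) (n₀ n₀' : Plane → ℝ) (n n' : Plane → Fin 3 → ℝ) (J J' : Plane → Fin 2 → ℝ) :
    ℝ :=
  (∫ r, (1 + ‖r‖) ^ m * |n₀ r - n₀' r|) + 3 * (∫ r, (1 + ‖r‖) ^ m * ‖n r - n' r‖)
    + 2 * ∫ r, (1 + ‖r‖) ^ m * ‖J r - J' r‖

theorem IsEquilibrium.momentDistance_eq {n₀' : Plane → ℝ} {n' : Plane → Fin 3 → ℝ}
    {J' : Plane → Fin 2 → ℝ} {ξ ξ' : Multipliers} {g g' : PauliField}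
    (h : IsEquilibrium ε c n₀ n J ξ g) (h' : IsEquilibrium ε c n₀' n' J' ξ' g')
    {f f' : 𝓢(Plane × Plane, Fin 4 → ℝ)} (hf : ∀ r p, f (r, p) = g r p)
    (hf' : ∀ r p, f' (r, p) = g' r p) (m : ℕ) :
    momentDistance m f f' = momentGap m n₀ n₀' n n' J J' := by
  simp only [momentGap, ← h.density_eq, ← h'.density_eq, ← h.spin_eq, ← h'.spin_eq, ← h.flow_eq,
    ← h'.flow_eq, momentDistance, hf, hf']
  rfl

/-- Entropy stability with the mass bound `M` expressed through the second state alone: the first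
mass differs from it by at most the unweighted moment gap. -/
theorem exists_integral_sq_sub_le_momentGap (hε : ε ≠ 0) : ∃ C : ℝ, 0 < C ∧
    ∀ {n₀ n₀' : Plane → ℝ} {n n' : Plane → Fin 3 → ℝ} {J J' : Plane → Fin 2 → ℝ}
      {ξ ξ' : Multipliers} {g g' : PauliField} {f f' : 𝓢(Plane × Plane, Fin 4 → ℝ)} {K : ℝ} {m : ℕ},
      IsEquilibrium ε c n₀ n J ξ g → IsEquilibrium ε c n₀' n' J' ξ' g' →
      (∀ r p, f (r, p) = g r p) → (∀ r p, f' (r, p) = g' r p) →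
      ξ.BoundedBy K m → ξ'.BoundedBy K m →
      ∫ z, ∑ s, (f z s - f' z s) ^ 2
        ≤ C * (|∫ r, n₀' r| + momentGap 0 n₀ n₀' n n' J J')
          * (2 * K * momentGap m n₀ n₀' n n' J J') := by
  obtain ⟨C, hC0, hC⟩ := exists_integral_sq_sub_le (c := c) hε
  refine ⟨C, hC0, ?_⟩
  intro n₀ n₀' n n' J J' ξ ξ' g g' f f' K m h h' hf hf' hK hK'
  obtain ⟨e, φ, μ, hG⟩ := h.exists_isGibbsState hε f hf
  obtain ⟨e', φ', ν, hG'⟩ := h'.exists_isGibbsState hε f' hf'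
  have hn : ∀ r, n₀ r = ∫ p, f (r, p) 0 := fun r => by
    rw [← h.density_eq]; simp only [density, hf]
  have hn' : ∀ r, n₀' r = ∫ p, f' (r, p) 0 := fun r => by
    rw [← h'.density_eq]; simp only [density, hf']
  have hgap : ∫ r, |n₀ r - n₀' r| ≤ momentGap 0 n₀ n₀' n n' J J' := by
    have h1 : 0 ≤ ∫ r, (1 + ‖r‖) ^ 0 * ‖n r - n' r‖ := integral_nonneg fun r => by positivity
    have h2 : 0 ≤ ∫ r, (1 + ‖r‖) ^ 0 * ‖J r - J' r‖ := integral_nonneg fun r => by positivity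
    have h3 : ∫ r, |n₀ r - n₀' r| = ∫ r, (1 + ‖r‖) ^ 0 * |n₀ r - n₀' r| := by simp
    rw [momentGap]
    linarith
  have hd := (rapidFun_density f 0).integrable_abs 0
  have hd' := (rapidFun_density f' 0).integrable_abs 0
  have hi : Integrable n₀ := by
    refine ((rapidFun_density f 0).integrable_mul (a := fun _ => 1) (K := 1) (m := 0)
      aestronglyMeasurable_const (by simp)).congr (Eventually.of_forall fun r => ?_)
    simp [hn]
  have hi' : Integrable n₀' := by
    refine ((rapidFun_density f' 0).integrable_mul (a := fun _ => 1) (K := 1) (m := 0)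
      aestronglyMeasurable_const (by simp)).congr (Eventually.of_forall fun r => ?_)
    simp [hn']
  have hM : ∫ x, ∫ p, f (x, p) 0 ≤ |∫ r, n₀' r| + momentGap 0 n₀ n₀' n n' J J' := by
    simp only [← hn]
    have h1 : (∫ r, n₀ r) - ∫ r, n₀' r ≤ ∫ r, |n₀ r - n₀' r| := by
      rw [← integral_sub hi hi']
      exact (le_abs_self _).trans (abs_integral_le_integral_abs)
    linarith [le_abs_self (∫ r, n₀' r)]
  have hM' : ∫ x, ∫ p, f' (x, p) 0 ≤ |∫ r, n₀' r| + momentGap 0 n₀ n₀' n n' J J' := by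
    simp only [← hn']
    have h1 : 0 ≤ ∫ r, |n₀ r - n₀' r| := integral_nonneg fun r => abs_nonneg _
    linarith [le_abs_self (∫ r, n₀' r)]
  have h0 : 0 ≤ |∫ r, n₀' r| + momentGap 0 n₀ n₀' n n' J J' :=
    add_nonneg (abs_nonneg _) ((integral_nonneg fun r => abs_nonneg _).trans hgap)
  refine (hC hG hG' hM hM').trans ?_
  rw [← h.momentDistance_eq h' hf hf' m]
  gcongr
  exact pairing_difference_le h.temperate h'.temperate hK hK' f f'

/-- The moments of the equilibria, tested against `ψ`, converge. -/
theorem tendsto_pair_equilibrium (hε : ε ≠ 0) (hτ₀ : 0 < τ₀) (ht : 0 < t)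
    {n₀ : ℝ → Plane → ℝ} {n : ℝ → Plane → Fin 3 → ℝ} {J : ℝ → Plane → Fin 2 → ℝ}
    {ξlim : ℝ → Multipliers} {glim : ℝ → PauliField}
    (hg : ∀ τ ∈ Ioo 0 τ₀, IsRegular (g τ))
    (heq : ∀ τ ∈ Ioo 0 τ₀, IsEquilibrium ε c
      (density (w τ t)) (spin (w τ t)) (flow (w τ t)) (ξ τ t) (g τ t))
    {B : ℝ} (hmom : ∀ τ ∈ Ioo 0 τ₀, (∫ r, ∫ p, (1 + ‖p‖) ^ 3 * ‖g τ t r p‖) ≤ B)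
    {K : ℝ} {m : ℕ} (hξ : ∀ τ ∈ Ioo 0 τ₀, (ξ τ t).BoundedBy K m)
    (hglim : IsRegular glim)
    (heqlim : IsEquilibrium ε c (n₀ t) (n t) (J t) (ξlim t) (glim t))
    (hn₀ : ∀ m : ℕ, Tendsto
      (fun τ => ∫ r, (1 + ‖r‖) ^ m * |density (w τ t) r - n₀ t r|) (𝓝[>] 0) (𝓝 0))
    (hn : ∀ m : ℕ, Tendsto
      (fun τ => ∫ r, (1 + ‖r‖) ^ m * ‖spin (w τ t) r - n t r‖) (𝓝[>] 0) (𝓝 0))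
    (hJ : ∀ m : ℕ, Tendsto
      (fun τ => ∫ r, (1 + ‖r‖) ^ m * ‖flow (w τ t) r - J t r‖) (𝓝[>] 0) (𝓝 0))
    {ψ : Plane → ℝ} (hψ : Continuous ψ) (hs : HasCompactSupport ψ) {l : List (Fin 2)}
    (hl : l.length ≤ 2) (s : Fin 4) :
    Tendsto (fun τ => pair ψ (monoMom l (field (g τ) s)) t) (𝓝[>] 0)
      (𝓝 (pair ψ (monoMom l (field glim s)) t)) := by
  obtain ⟨C, hC0, hC⟩ := exists_integral_sq_sub_le_momentGap (c := c) hε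
  obtain ⟨K₁, m₁, hK₁⟩ := heqlim.temperate.exists_boundedBy
  set K' := |K| + |K₁|
  set m' := m + m₁
  have hlim : (ξlim t).BoundedBy K' m' :=
    hK₁.mono (by simp [K']) (by simp [m'])
  have hgap (m : ℕ) : Tendsto (fun τ => momentGap m (density (w τ t)) (n₀ t) (spin (w τ t)) (n t)
      (flow (w τ t)) (J t)) (𝓝[>] 0) (𝓝 0) := by
    simpa [momentGap] using ((hn₀ m).add ((hn m).const_mul 3)).add ((hJ m).const_mul 2)
  set S : ℝ → ℝ := fun τ => ∫ z : Plane × Plane, ∑ s, (g τ t z.1 z.2 s - glim t z.1 z.2 s) ^ 2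
  have hτ : ∀ᶠ τ in 𝓝[>] (0 : ℝ), τ ∈ Ioo 0 τ₀ := Ioo_mem_nhdsGT hτ₀
  have hS : Tendsto S (𝓝[>] 0) (𝓝 0) := by
    -- The mass factor stays bounded while the weighted moment gap tends to zero.
    have h1 := ((((hgap 0).const_add |∫ r, n₀ t r|).const_mul C).mul
      ((hgap m').const_mul (2 * K')))
    simp only [mul_zero] at h1
    refine squeeze_zero' (Eventually.of_forall fun τ => integral_nonneg fun z =>
      Finset.sum_nonneg fun s _ => sq_nonneg _) ?_ h1
    filter_upwards [hτ] with τ hτ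
    exact hC (f := (hg τ hτ).slice ht) (f' := hglim.slice ht) (heq τ hτ) heqlim
      (fun _ _ => rfl) (fun _ _ => rfl) ((hξ τ hτ).mono (by simp [K']) (by simp [m'])) hlim
  set B' := max (max B (∫ r, ∫ p : Plane, (1 + ‖p‖) ^ 3 * ‖glim t r p‖)) 0
  rw [Metric.tendsto_nhds]
  intro δ hδ
  -- `lam` depends on `δ` and on the bound of the third moments but not on `τ`, so `τ` can
  -- afterwards be taken so small that `lam * S τ < δ / 2`.
  obtain ⟨lam, hlam, hle⟩ := exists_moment_difference_bound hψ hs hl (B := B') (le_max_right _ _)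
    (half_pos hδ)
  have hS' : ∀ᶠ τ in 𝓝[>] (0 : ℝ), S τ < δ / (2 * lam) :=
    hS.eventually (gt_mem_nhds (by positivity))
  filter_upwards [hτ, hS'] with τ hτ hSτ
  have h := hle ((hg τ hτ).slice ht) (hglim.slice ht) s
    ((hmom τ hτ).trans ((le_max_left _ _).trans (le_max_left _ _)))
    ((le_max_right _ _).trans (le_max_left _ _))
  rw [Real.dist_eq]
  refine lt_of_le_of_lt h ?_
  have h2 : lam * S τ < δ / 2 := by
    calc lam * S τ < lam * (δ / (2 * lam)) := by gcongr
      _ = δ / 2 := by field_simp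
  change δ / 2 + lam * S τ < δ
  linarith

end EquilibriumConvergence

/-! ### Relaxation limit of the moment equations -/

section HydrodynamicLimit

variable {χ : Plane → ℝ} {ε γ τ τ₀ a b t : ℝ} {V : Plane → ℝ} {l : List (Fin 2)} {s : Fin 4}

/-- The weak flux is a linear combination of tested moments. -/
theorem weakFlux_mem {α : Type*} (Q : Submodule ℝ (α → ℝ)) (hV : ContDiff ℝ ∞ V) (hχ : IsTest χ)
    (f : α → Fin 4 → ℝ × Plane × Plane → ℝ) (T : α → ℝ)
    (hQ : ∀ ψ, IsTest ψ → ∀ l' : List (Fin 2), l'.length ≤ l.length + 1 → ∀ s',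
      (fun x => pair ψ (monoMom l' (f x s')) (T x)) ∈ Q) :
    (fun x => weakFlux ε γ V χ (f x) l s (T x)) ∈ Q := by
  -- Only the free transport and the spin precession raise the order by one; the potential terms
  -- lower it. Being linear, the flux inherits any property that is stable under linear
  -- combinations: continuity, boundedness and convergence are each encoded as a submodule `Q`.
  have hk (k : Fin 2) (ψ) (hψ : IsTest ψ) (s') := hQ ψ hψ (k :: l) (by simp) s'
  have h1 : (fun x => ∑ k, pair (partialR k χ) (monoMom (k :: l) (f x s)) (T x)) ∈ Q := by
    have := Q.sum_mem (t := Finset.univ) fun k _ => hk k _ (hχ.partialR k) s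
    convert! this using 1
  have h2 : (fun x => ∑ k, ∑ s', gradCoef s k s' *
      pair (partialR k χ) (monoMom l (f x s')) (T x)) ∈ Q := by
    have := Q.sum_mem (t := Finset.univ) fun k _ => Q.sum_mem (t := Finset.univ) fun s' _ =>
      Q.smul_mem (gradCoef s k s') (hQ _ (hχ.partialR k) l (by simp) s')
    convert! this using 1
  have h3 : (fun x => ∑ k, ∑ s', spinCoef s k s' *
      pair χ (monoMom (k :: l) (f x s')) (T x)) ∈ Q := by
    have := Q.sum_mem (t := Finset.univ) fun k _ => Q.sum_mem (t := Finset.univ) fun s' _ =>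
      Q.smul_mem (spinCoef s k s') (hk k _ hχ s')
    convert! this using 1
  have h4 : (fun x => potentialPair V χ (fun ψ l => pair ψ (monoMom l (f x s)) (T x)) l) ∈ Q := by
    have hp (i : Fin 2) := hχ.mul (contDiff_partialR hV i)
    match l, hQ with
    | [], _ => exact Q.zero_mem
    | [i], hQ => exact hQ _ (hp i) [] (by simp) s
    | [i, j], hQ => exact Q.add_mem (hQ _ (hp i) [j] (by simp) s) (hQ _ (hp j) [i] (by simp) s)
    | _ :: _ :: _ :: _, _ => exact Q.zero_mem
  have h := Q.sub_mem (Q.sub_mem (Q.add_mem (Q.smul_mem (2 * γ)⁻¹ h1) (Q.smul_mem (ε / 2) h2)) h3) h4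
  convert! h using 1
  ext x
  simp [weakFlux, div_eq_inv_mul]

theorem continuousOn_weakFlux (hV : ContDiff ℝ ∞ V) (hχ : IsTest χ)
    {f : Fin 4 → ℝ × Plane × Plane → ℝ} (hf : ∀ s, RapidC1 (f s)) (ε γ : ℝ) (l : List (Fin 2))
    (s : Fin 4) : ContinuousOn (weakFlux ε γ V χ f l s) (Ioi 0) := by
  let Q : Submodule ℝ (ℝ → ℝ) :=
    { carrier := {F | ContinuousOn F (Ioi 0)}
      add_mem' := fun h h' => ContinuousOn.add h h'
      zero_mem' := continuousOn_const
      smul_mem' := fun c _ h => continuousOn_const.mul h }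
  exact weakFlux_mem Q hV hχ (fun _ => f) id fun ψ hψ l' _ s' =>
    ((hf s').timeC1 l').timeCont.continuousOn_pair hψ

/-- The remainder of a moment equation without collisions. -/
def momentDefect (ε γ : ℝ) (V : Plane → ℝ) (f : Fin 4 → ℝ × Plane × Plane → ℝ) (l : List (Fin 2))
    (s : Fin 4) (y : ℝ × Plane) : ℝ :=
  momentBalance ε γ f l s y + potentialTerm V (fun l => monoMom l (f s) y) y.2 l

theorem timeCont_momentDefect (hV : ContDiff ℝ ∞ V) {f : Fin 4 → ℝ × Plane × Plane → ℝ}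
    (hf : ∀ s, RapidC1 (f s)) (ε γ : ℝ) (l : List (Fin 2)) (s : Fin 4) :
    TimeCont (momentDefect ε γ V f l s) :=
  (timeCont_momentBalance hf ε γ l s).add (timeCont_potentialTerm hV (hf s).rapid l)

theorem intervalIntegrable_of_continuousOn_Ioi {F : ℝ → ℝ} (hF : ContinuousOn F (Ioi 0))
    (ha : 0 < a) (hab : a ≤ b) : IntervalIntegrable F volume a b :=
  (hF.mono fun _ hx => lt_of_lt_of_le ha (by rw [uIcc_of_le hab] at hx; exact hx.1)).intervalIntegrable

/-- The weak identity integrated in time. This form is needed because relaxation controls time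
integrals of moments and not their values at single times. -/
theorem pair_monoMom_sub_eq (hV : ContDiff ℝ ∞ V) (hχ : IsTest χ)
    {f : Fin 4 → ℝ × Plane × Plane → ℝ} (hf : ∀ s, RapidC1 (f s)) (ε γ : ℝ) (l : List (Fin 2))
    (s : Fin 4) (ha : 0 < a) (hab : a ≤ b) :
    pair χ (monoMom l (f s)) b - pair χ (monoMom l (f s)) a
      = (∫ t in a..b, weakFlux ε γ V χ f l s t) + ∫ t in a..b, pair χ (momentDefect ε γ V f l s) t := by
  have h1 := intervalIntegrable_of_continuousOn_Ioi (continuousOn_weakFlux hV hχ hf ε γ l s) ha hab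
  have h2 := intervalIntegrable_of_continuousOn_Ioi
    ((timeCont_momentDefect hV hf ε γ l s).continuousOn_pair hχ) ha hab
  rw [← intervalIntegral.integral_add h1 h2]
  refine (intervalIntegral.integral_eq_sub_of_hasDerivAt (fun t ht => ?_) (h1.add h2)).symm
  rw [uIcc_of_le hab] at ht
  exact hasDerivAt_pair_monoMom hV hf ε γ hχ l s (lt_of_lt_of_le ha ht.1)

/-- The derivative of the integral in its upper limit recovers the continuous integrand. -/
theorem eq_zero_of_integral_eq_zero {F : ℝ → ℝ} (hF : ContinuousOn F (Ioi 0))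
    (h : ∀ a b, 0 < a → a ≤ b → ∫ t in a..b, F t = 0) (ht : 0 < t) : F t = 0 := by
  have h2 : t / 2 < t := half_lt_self ht
  have hd : HasDerivAt (fun u => ∫ x in (t / 2)..u, F x) (F t) t :=
    intervalIntegral.integral_hasDerivAt_right
      (intervalIntegrable_of_continuousOn_Ioi hF (half_pos ht) h2.le)
      (hF.stronglyMeasurableAtFilter isOpen_Ioi t ht) (hF.continuousAt (Ioi_mem_nhds ht))
  refine hd.unique ((hasDerivAt_const t (0 : ℝ)).congr_of_eventuallyEq ?_)
  filter_upwards [lt_mem_nhds h2] with u hu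
  exact h _ _ (half_pos ht) hu.le

theorem eq_zero_of_pair_eq_zero {F : ℝ × Plane → ℝ} (hF : TimeCont F) (ht : 0 < t)
    (h : ∀ χ, IsTest χ → pair χ F t = 0) (r : Plane) : F (t, r) = 0 := by
  have hc := hF.continuous_slice ht
  have h1 : ∀ᵐ r : Plane, F (t, r) = 0 :=
    ae_eq_zero_of_integral_contDiff_smul_eq_zero hc.locallyIntegrable fun χ hχ hs => h χ ⟨hχ, hs⟩
  have h2 := (Continuous.ae_eq_iff_eq volume hc continuous_const).1 h1
  exact congrFun h2 r

theorem IsRegular.pair_moment_le {w : ℝ → PauliField} (hw : IsRegular w) (ht : 0 < t) {A : ℝ}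
    (hχ : IsTest χ) (hA : ∀ r, |χ r| ≤ A) (hl : l.length ≤ 3) (s : Fin 4) :
    |pair χ (monoMom l (field w s)) t| ≤ A * ∫ r, ∫ p, (1 + ‖p‖) ^ 3 * ‖w t r p‖ :=
  abs_integral_test_mul_moment_le hχ.continuous hχ.supp hA (hw.slice ht) s hl

theorem SolvesWignerBGK.pair_momentDefect {w g : ℝ → PauliField} (hε : ε ≠ 0)
    (hV : Function.HasTemperateGrowth V) (hsol : SolvesWignerBGK ε γ τ V w g) (hw : IsRegular w)
    (hg : IsRegular g) (hχ : IsTest χ) (s : Fin 4) (ht : 0 < t) (hl : l.length ≤ 2) :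
    pair χ (momentDefect ε γ V (field w) l s) t
      = τ⁻¹ * (pair χ (monoMom l (field g s)) t - pair χ (monoMom l (field w s)) t) := by
  have h1 := ((hg.rapidC1_field s).timeC1 l).timeCont.integrable hχ.continuous hχ.supp ht
  have h2 := ((hw.rapidC1_field s).timeC1 l).timeCont.integrable hχ.continuous hχ.supp ht
  simp only [pair]
  rw [← integral_sub h1 h2, ← integral_const_mul]
  congr 1
  ext r
  rw [momentDefect, hsol.momentBalance_eq hε hV hw hg s ht hl]
  ring

/-- Uniformly bounded families. -/
def boundedFamilies {α : Type*} (S : Set α) : Submodule ℝ (α → ℝ) where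
  carrier := {F | ∃ C, ∀ x ∈ S, |F x| ≤ C}
  add_mem' := by
    rintro F G ⟨C, hC⟩ ⟨D, hD⟩
    exact ⟨C + D, fun x hx => (abs_add_le _ _).trans (add_le_add (hC x hx) (hD x hx))⟩
  zero_mem' := ⟨0, by simp⟩
  smul_mem' := by
    rintro c F ⟨C, hC⟩
    refine ⟨|c| * C, fun x hx => ?_⟩
    rw [Pi.smul_apply, smul_eq_mul, abs_mul]
    exact mul_le_mul_of_nonneg_left (hC x hx) (abs_nonneg c)

variable {w g : ℝ → ℝ → PauliField}

theorem pair_moment_mem_boundedFamilies (hw : ∀ τ ∈ Ioo 0 τ₀, IsRegular (w τ)) (ha : 0 < a) {C : ℝ}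
    (hC : ∀ τ ∈ Ioo 0 τ₀, ∀ t ∈ Icc a b, (∫ r, ∫ p, (1 + ‖p‖) ^ 3 * ‖w τ t r p‖) ≤ C)
    (hχ : IsTest χ) (hl : l.length ≤ 3) (s : Fin 4) :
    (fun x : ℝ × ℝ => pair χ (monoMom l (field (w x.1) s)) x.2)
      ∈ boundedFamilies (Ioo 0 τ₀ ×ˢ Icc a b) := by
  obtain ⟨A, hA0, hA⟩ := exists_abs_le hχ.continuous hχ.supp
  refine ⟨A * C, fun x hx => ?_⟩
  refine ((hw x.1 hx.1).pair_moment_le (lt_of_lt_of_le ha hx.2.1) hχ hA hl s).trans ?_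
  gcongr
  exact hC x.1 hx.1 x.2 hx.2

/-- In the relaxation limit, the moments of the solutions approach those of the equilibria. -/
theorem tendsto_integral_relaxation (hε : ε ≠ 0) (hτ₀ : 0 < τ₀)
    (hV : Function.HasTemperateGrowth V)
    (hw : ∀ τ ∈ Ioo 0 τ₀, IsRegular (w τ)) (hg : ∀ τ ∈ Ioo 0 τ₀, IsRegular (g τ))
    (hsol : ∀ τ ∈ Ioo 0 τ₀, SolvesWignerBGK ε γ τ V (w τ) (g τ)) (ha : 0 < a) (hab : a ≤ b) {C : ℝ}
    (hC : ∀ τ ∈ Ioo 0 τ₀, ∀ t ∈ Icc a b, (∫ r, ∫ p, (1 + ‖p‖) ^ 3 * ‖w τ t r p‖) ≤ C)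
    (hχ : IsTest χ) (hl : l.length ≤ 2) (s : Fin 4) :
    Tendsto (fun τ => ∫ t in a..b, (pair χ (monoMom l (field (g τ) s)) t
      - pair χ (monoMom l (field (w τ) s)) t)) (𝓝[>] 0) (𝓝 0) := by
  -- The flux of a moment of order two involves order three, exactly the order bounded by
  -- hypothesis.
  obtain ⟨D, hD⟩ := weakFlux_mem (ε := ε) (γ := γ) (s := s) (l := l)
    (boundedFamilies (Ioo 0 τ₀ ×ˢ Icc a b)) hV.1 hχ (fun x => field (w x.1)) (fun x => x.2)
    fun ψ hψ l' hl' s' => pair_moment_mem_boundedFamilies hw ha hC hψ (by omega) s'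
  obtain ⟨D', hD'⟩ := pair_moment_mem_boundedFamilies hw ha hC hχ (l := l) (by omega) s
  have hlim : Tendsto (fun τ : ℝ => τ * (D' + D' + D * |b - a|)) (𝓝[>] 0) (𝓝 0) := by
    have := ((continuous_id (X := ℝ)).mul continuous_const).tendsto' 0 0
      (show id (0 : ℝ) * (D' + D' + D * |b - a|) = 0 by simp)
    exact this.mono_left nhdsWithin_le_nhds
  refine squeeze_zero_norm' ?_ hlim
  filter_upwards [Ioo_mem_nhdsGT hτ₀] with τ hτ
  have hτ0 : 0 < τ := hτ.1
  have h := pair_monoMom_sub_eq hV.1 hχ (hw τ hτ).rapidC1_field ε γ l s ha hab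
  have hE : ∫ t in a..b, pair χ (momentDefect ε γ V (field (w τ)) l s) t
      = τ⁻¹ * ∫ t in a..b, (pair χ (monoMom l (field (g τ) s)) t
        - pair χ (monoMom l (field (w τ) s)) t) := by
    rw [← intervalIntegral.integral_const_mul]
    refine intervalIntegral.integral_congr fun t ht => ?_
    rw [uIcc_of_le hab] at ht
    exact (hsol τ hτ).pair_momentDefect hε hV (hw τ hτ) (hg τ hτ) hχ s (lt_of_lt_of_le ha ht.1) hl
  rw [hE] at h
  set I := ∫ t in a..b, (pair χ (monoMom l (field (g τ) s)) t
        - pair χ (monoMom l (field (w τ) s)) t)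
  -- The collision term carries `1/τ` whereas all other terms are bounded, so solving for it leaves
  -- an explicit factor `τ`.
  have hI : I = τ * (pair χ (monoMom l (field (w τ) s)) b - pair χ (monoMom l (field (w τ) s)) a
      - ∫ t in a..b, weakFlux ε γ V χ (field (w τ)) l s t) := by
    rw [h]; field_simp; ring
  have hF : |∫ t in a..b, weakFlux ε γ V χ (field (w τ)) l s t| ≤ D * |b - a| := by
    rw [← Real.norm_eq_abs]
    refine intervalIntegral.norm_integral_le_of_norm_le_const fun t ht => ?_
    rw [uIoc_of_le hab] at ht
    exact hD (τ, t) ⟨hτ, ht.1.le, ht.2⟩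
  rw [hI, Real.norm_eq_abs, abs_mul, abs_of_pos hτ0]
  gcongr
  refine (abs_sub _ _).trans (add_le_add ((abs_sub _ _).trans (add_le_add ?_ ?_)) hF)
  · exact hD' (τ, b) ⟨hτ, hab, le_rfl⟩
  · exact hD' (τ, a) ⟨hτ, le_rfl, hab⟩

/-- Families whose time integrals converge as the parameter tends to zero; `none` marks the
limit. -/
def convergentFamilies (τ₀ a b : ℝ) : Submodule ℝ (Option ℝ × ℝ → ℝ) where
  carrier := {F | (∀ τ ∈ Ioo 0 τ₀, IntervalIntegrable (fun t => F (some τ, t)) volume a b) ∧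
    IntervalIntegrable (fun t => F (none, t)) volume a b ∧
    ∃ I : ℝ → ℝ, (∀ τ ∈ Ioo 0 τ₀, I τ = ∫ t in a..b, F (some τ, t)) ∧
      Tendsto I (𝓝[>] 0) (𝓝 (∫ t in a..b, F (none, t)))}
  add_mem' := by
    rintro F G ⟨h1, h2, I, h3, h4⟩ ⟨k1, k2, K, k3, k4⟩
    refine ⟨fun τ hτ => (h1 τ hτ).add (k1 τ hτ), h2.add k2, fun τ => I τ + K τ, fun τ hτ => ?_, ?_⟩
    · simp only
      rw [h3 τ hτ, k3 τ hτ, ← intervalIntegral.integral_add (h1 τ hτ) (k1 τ hτ)]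
      rfl
    · have := h4.add k4
      rwa [← intervalIntegral.integral_add h2 k2] at this
  zero_mem' := ⟨fun _ _ => by simp, by simp, fun _ => 0, by simp, by simp⟩
  smul_mem' := by
    rintro c F ⟨h1, h2, I, h3, h4⟩
    refine ⟨fun τ hτ => (h1 τ hτ).const_mul c, h2.const_mul c, fun τ => c * I τ, fun τ hτ => ?_, ?_⟩
    · simp only
      rw [h3 τ hτ, ← intervalIntegral.integral_const_mul]
      rfl
    · have := h4.const_mul c
      rwa [← intervalIntegral.integral_const_mul] at this

/-- The members of a family of fields, and its limit. -/
def withLimit (w : ℝ → ℝ → PauliField) (glim : ℝ → PauliField) (o : Option ℝ) : ℝ → PauliField :=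
  o.elim glim w

/-- The time integral for `w^τ` is that for `g^τ` minus the relaxation error. The former converges
by dominated convergence from the pointwise limits `hconv`, the latter tends to zero. -/
theorem pair_moment_mem_convergentFamilies {glim : ℝ → PauliField} (hε : ε ≠ 0) (hτ₀ : 0 < τ₀)
    (hV : Function.HasTemperateGrowth V)
    (hw : ∀ τ ∈ Ioo 0 τ₀, IsRegular (w τ)) (hg : ∀ τ ∈ Ioo 0 τ₀, IsRegular (g τ))
    (hsol : ∀ τ ∈ Ioo 0 τ₀, SolvesWignerBGK ε γ τ V (w τ) (g τ)) (ha : 0 < a) (hab : a ≤ b) {C : ℝ}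
    (hC : ∀ τ ∈ Ioo 0 τ₀, ∀ t ∈ Icc a b, (∫ r, ∫ p, (1 + ‖p‖) ^ 3 * ‖w τ t r p‖) ≤ C ∧
      (∫ r, ∫ p, (1 + ‖p‖) ^ 3 * ‖g τ t r p‖) ≤ C)
    (hglim : IsRegular glim) (hχ : IsTest χ) (hl : l.length ≤ 2) (s : Fin 4)
    (hconv : ∀ t > 0, Tendsto (fun τ => pair χ (monoMom l (field (g τ) s)) t) (𝓝[>] 0)
      (𝓝 (pair χ (monoMom l (field glim s)) t))) :
    (fun x : Option ℝ × ℝ => pair χ (monoMom l (field (withLimit w glim x.1) s)) x.2)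
      ∈ convergentFamilies τ₀ a b := by
  have hint {u : ℝ → PauliField} (hu : IsRegular u) :
      IntervalIntegrable (pair χ (monoMom l (field u s))) volume a b :=
    intervalIntegrable_of_continuousOn_Ioi
      (((hu.rapidC1_field s).timeC1 l).timeCont.continuousOn_pair hχ) ha hab
  obtain ⟨D, hD⟩ := pair_moment_mem_boundedFamilies hg ha (fun τ hτ t ht => (hC τ hτ t ht).2) hχ
    (l := l) (by omega) s
  have hG : Tendsto (fun τ => ∫ t in a..b, pair χ (monoMom l (field (g τ) s)) t) (𝓝[>] 0)
      (𝓝 (∫ t in a..b, pair χ (monoMom l (field glim s)) t)) := by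
    refine intervalIntegral.tendsto_integral_filter_of_dominated_convergence (fun _ => D) ?_ ?_
      intervalIntegrable_const ?_
    · filter_upwards [Ioo_mem_nhdsGT hτ₀] with τ hτ
      exact (hint (hg τ hτ)).def'.aestronglyMeasurable
    · filter_upwards [Ioo_mem_nhdsGT hτ₀] with τ hτ
      refine Eventually.of_forall fun t ht => ?_
      rw [uIoc_of_le hab] at ht
      exact hD (τ, t) ⟨hτ, ht.1.le, ht.2⟩
    · refine Eventually.of_forall fun t ht => hconv t ?_
      rw [uIoc_of_le hab] at ht
      exact ha.trans ht.1
  have hR := tendsto_integral_relaxation hε hτ₀ hV hw hg hsol ha hab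
    (fun τ hτ t ht => (hC τ hτ t ht).1) hχ hl s
  have hGR := hG.sub hR
  rw [sub_zero] at hGR
  refine ⟨fun τ hτ => hint (hw τ hτ), hint hglim, _, fun τ hτ => ?_, hGR⟩
  simp only
  rw [intervalIntegral.integral_sub (hint (hg τ hτ)) (hint (hw τ hτ)), sub_sub_cancel]
  rfl

/-- The moment equations of the conserved quantities hold for the limit. -/
theorem momentDefect_limit_eq_zero {glim : ℝ → PauliField} (hε : ε ≠ 0) (hτ₀ : 0 < τ₀)
    (hV : Function.HasTemperateGrowth V)
    (hw : ∀ τ ∈ Ioo 0 τ₀, IsRegular (w τ)) (hg : ∀ τ ∈ Ioo 0 τ₀, IsRegular (g τ))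
    (hsol : ∀ τ ∈ Ioo 0 τ₀, SolvesWignerBGK ε γ τ V (w τ) (g τ))
    (hmom : ∀ a b : ℝ, 0 < a → ∃ C : ℝ, ∀ τ ∈ Ioo 0 τ₀, ∀ t ∈ Icc a b,
      (∫ r, ∫ p, (1 + ‖p‖) ^ 3 * ‖w τ t r p‖) ≤ C ∧ (∫ r, ∫ p, (1 + ‖p‖) ^ 3 * ‖g τ t r p‖) ≤ C)
    (hglim : IsRegular glim)
    (hconv : ∀ ψ, IsTest ψ → ∀ l : List (Fin 2), l.length ≤ 2 → ∀ s, ∀ t > 0,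
      Tendsto (fun τ => pair ψ (monoMom l (field (g τ) s)) t) (𝓝[>] 0)
        (𝓝 (pair ψ (monoMom l (field glim s)) t)))
    (hl : l.length ≤ 1) (s : Fin 4)
    (hcons : ∀ τ ∈ Ioo 0 τ₀, ∀ t > 0, ∀ r,
      monoMom l (field (w τ) s) (t, r) = monoMom l (field (g τ) s) (t, r))
    (ht : 0 < t) (r : Plane) : momentDefect ε γ V (field glim) l s (t, r) = 0 := by
  have hE := timeCont_momentDefect hV.1 hglim.rapidC1_field ε γ l s
  -- The remainder is continuous, so it is enough that it vanishes when tested in `r` and integrated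
  -- over every interval of positive times.
  refine eq_zero_of_pair_eq_zero hE ht (fun χ hχ => ?_) r
  refine eq_zero_of_integral_eq_zero (hE.continuousOn_pair hχ) (fun a b ha hab => ?_) ht
  obtain ⟨C, hC⟩ := hmom a b ha
  obtain ⟨-, -, I, hI, hlim⟩ := weakFlux_mem (ε := ε) (γ := γ) (s := s) (l := l)
    (convergentFamilies τ₀ a b) hV.1 hχ (fun x => field (withLimit w glim x.1)) (fun x => x.2)
    fun ψ hψ l' hl' s' => pair_moment_mem_convergentFamilies hε hτ₀ hV hw hg hsol ha hab hC hglim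
      hψ (by omega) s' (hconv ψ hψ l' (by omega) s')
  have hcons' {τ : ℝ} (hτ : τ ∈ Ioo 0 τ₀) {t : ℝ} (ht : 0 < t) :
      pair χ (monoMom l (field (w τ) s)) t = pair χ (monoMom l (field (g τ) s)) t := by
    simp only [pair, hcons τ hτ t ht]
  have hb := (hconv χ hχ l (by omega) s b (ha.trans_le hab)).sub (hconv χ hχ l (by omega) s a ha)
  -- For a conserved moment the increment of `w^τ` is that of `g^τ` and hence converges; it also
  -- equals the time integral of the flux `I τ`, as the collision term is zero.
  have hEq : Tendsto I (𝓝[>] 0) (𝓝 (pair χ (monoMom l (field glim s)) b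
      - pair χ (monoMom l (field glim s)) a)) := by
    refine hb.congr' ?_
    filter_upwards [Ioo_mem_nhdsGT hτ₀] with τ hτ
    rw [hI τ hτ, ← hcons' hτ ha, ← hcons' hτ (ha.trans_le hab),
      pair_monoMom_sub_eq hV.1 hχ (hw τ hτ).rapidC1_field ε γ l s ha hab]
    have h0 : ∫ t in a..b, pair χ (momentDefect ε γ V (field (w τ)) l s) t = 0 := by
      rw [intervalIntegral.integral_congr (g := fun _ => (0 : ℝ)) fun t ht => ?_,
        intervalIntegral.integral_zero]
      rw [uIcc_of_le hab] at ht
      have ht0 := ha.trans_le ht.1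
      simp only
      rw [(hsol τ hτ).pair_momentDefect hε hV (hw τ hτ) (hg τ hτ) hχ s ht0 (by omega),
        hcons' hτ ht0, sub_self, mul_zero]
    rw [h0, add_zero]
    rfl
  -- Thus the increment of the limit moment equals the time integral of the limit flux. The identity
  -- for `glim` differs from this only by its remainder.
  have h1 := tendsto_nhds_unique hEq hlim
  have h2 := pair_monoMom_sub_eq hV.1 hχ hglim.rapidC1_field ε γ l s ha hab
  rw [h1] at h2
  change (∫ t in a..b, weakFlux ε γ V χ (field glim) l s t) = _ at h2
  linarith

end HydrodynamicLimit

/-! ### The hydrodynamic equations in components -/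

section Hydrodynamics

variable {ε γ c t : ℝ} {V : Plane → ℝ} {n₀ : ℝ → Plane → ℝ} {n : ℝ → Plane → Fin 3 → ℝ}
  {J : ℝ → Plane → Fin 2 → ℝ} {g : ℝ → PauliField}

theorem monoMom_nil_field (g : ℝ → PauliField) (r : Plane) (s : Fin 4) :
    monoMom [] (field g s) (t, r) = ∫ p, g t r p s := by
  simp [monoMom_apply, field]

theorem monoMom_singleton_field (g : ℝ → PauliField) (r : Plane) (i : Fin 2) (s : Fin 4) :
    monoMom [i] (field g s) (t, r) = ∫ p : Plane, p i * g t r p s := by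
  simp [monoMom_apply, field]

theorem density_eq_monoMom (g : ℝ → PauliField) (r : Plane) :
    density (g t) r = monoMom [] (field g 0) (t, r) :=
  (monoMom_nil_field g r 0).symm

theorem spin_eq_monoMom (g : ℝ → PauliField) (r : Plane) (s : Fin 3) :
    spin (g t) r s = monoMom [] (field g s.succ) (t, r) :=
  (monoMom_nil_field g r s.succ).symm

theorem flow_eq_monoMom (g : ℝ → PauliField) (r : Plane) (i : Fin 2) :
    flow (g t) r i = monoMom [i] (field g 0) (t, r) :=
  (monoMom_singleton_field g r i 0).symm

theorem momentumSpin_eq_monoMom (g : ℝ → PauliField) (r : Plane) (i : Fin 2) (s : Fin 3) :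
    momentumSpin (g t) r i s = monoMom [i] (field g s.succ) (t, r) :=
  (monoMom_singleton_field g r i s.succ).symm

theorem IsRegular.spinPrecession_eq (hg : IsRegular g) (ht : 0 < t) (r : Plane) (s : Fin 3) :
    spinPrecession (g t) r s
      = ∑ k, ∑ s', spinCoef s.succ k s' * monoMom [k] (field g s') (t, r) := by
  have hi (k : Fin 2) (s' : Fin 4) : Integrable fun p : Plane => p k * g t r p s' := by
    simpa [field] using ((hg.rapidC1_field s').rapid.mono_mul [k]).integrable_momentum ht r
  have h (k : Fin 2) (s' : Fin 4) := (hi k s').const_mul (spinCoef s.succ k s')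
  simp only [monoMom_singleton_field, ← integral_const_mul]
  simp_rw [← integral_finsetSum _ fun s' _ => h _ s']
  rw [← integral_finsetSum _ fun k _ => integrable_finsetSum _ fun s' _ => h k s', spinPrecession]
  congr 1
  ext p
  fin_cases s
  all_goals simp [spinCoef, Fin.sum_univ_succ, crossProduct, vec3, vec]
  all_goals ring

/-- Expanding the centred product, the cross terms give `-2 J_i J_k / n₀` and the constant one `+J_i
J_k / n₀`, so adding `J_i J_k / n₀` leaves the raw second moment. -/
theorem IsRegular.momentumFlux_eq (hg : IsRegular g) (ht : 0 < t) (r : Plane)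
    (h0 : n₀ t r ≠ 0) (hn : n₀ t r = monoMom [] (field g 0) (t, r))
    (hJ : ∀ i, J t r i = monoMom [i] (field g 0) (t, r)) (i k : Fin 2) :
    momentumFlux (n₀ t) (J t) (g t) r i k = monoMom [k, i] (field g 0) (t, r) := by
  have hi (l : List (Fin 2)) : Integrable fun p : Plane => mono l p * g t r p 0 :=
    ((hg.rapidC1_field 0).rapid.mono_mul l).integrable_momentum ht r
  set a := J t r i / n₀ t r with ha
  set b := J t r k / n₀ t r with hb
  have h2 := hi [k, i]
  have h3 := (hi [k]).const_mul (-a)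
  have h4 := (hi [i]).const_mul (-b)
  have h5 := (hi []).const_mul (a * b)
  have h23 : Integrable fun p : Plane => mono [k, i] p * g t r p 0 + -a * (mono [k] p * g t r p 0) :=
    h2.add h3
  have h234 : Integrable fun p : Plane => mono [k, i] p * g t r p 0 + -a * (mono [k] p * g t r p 0)
      + -b * (mono [i] p * g t r p 0) := h23.add h4
  have key : stressTensor (n₀ t) (J t) (g t) r i k = ∫ p : Plane, (mono [k, i] p * g t r p 0
      + -a * (mono [k] p * g t r p 0) + -b * (mono [i] p * g t r p 0)
      + a * b * (mono [] p * g t r p 0)) := by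
    rw [stressTensor]
    congr 1
    ext p
    simp only [mono_cons, mono_nil, ← ha, ← hb]
    ring
  rw [momentumFlux, key, integral_add h234 h5, integral_add h23 h4, integral_add h2 h3,
    integral_const_mul, integral_const_mul, integral_const_mul]
  have hm (l : List (Fin 2)) : ∫ p, mono l p * g t r p 0 = monoMom l (field g 0) (t, r) := rfl
  rw [hm, hm, hm, hm, ← hJ, ← hJ, ← hn, ha, hb]
  field_simp
  ring

theorem RapidC1.differentiableAt_time {f : ℝ × Plane × Plane → ℝ} (hf : RapidC1 f)
    (l : List (Fin 2)) (ht : 0 < t) (r : Plane) :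
    DifferentiableAt ℝ (fun t' => monoMom l f (t', r)) t :=
  DifferentiableAt.comp (f := fun t' : ℝ => (t', r)) t (hf.differentiableAt_monoMom l ht r)
    (by fun_prop)

theorem RapidC1.differentiableAt_position {f : ℝ × Plane × Plane → ℝ} (hf : RapidC1 f)
    (l : List (Fin 2)) (ht : 0 < t) (r : Plane) :
    DifferentiableAt ℝ (fun r' => monoMom l f (t, r')) r :=
  DifferentiableAt.comp (f := fun r' : Plane => (t, r')) r (hf.differentiableAt_monoMom l ht r)
    (by fun_prop)

/-- The moment equations of the conserved quantities, closed by the distributions `g`, are the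
hydrodynamic equations. -/
theorem IsRegular.solvesHydrodynamic (hg : IsRegular g) (hpos : ∀ t > 0, ∀ r, 0 < n₀ t r)
    (hn₀ : ∀ t > 0, ∀ r, n₀ t r = density (g t) r) (hn : ∀ t > 0, ∀ r, n t r = spin (g t) r)
    (hJ : ∀ t > 0, ∀ r, J t r = flow (g t) r)
    (h0 : ∀ s, ∀ t > 0, ∀ r, momentDefect ε γ V (field g) [] s (t, r) = 0)
    (h1 : ∀ i, ∀ t > 0, ∀ r, momentDefect ε γ V (field g) [i] 0 (t, r) = 0) :
    SolvesHydrodynamic ε γ V n₀ n J g := by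
  have hn₀' (t) (ht : 0 < t) (r) : n₀ t r = monoMom [] (field g 0) (t, r) := by
    rw [hn₀ t ht, density_eq_monoMom]
  have hn' (t) (ht : 0 < t) (r) (s) : n t r s = monoMom [] (field g s.succ) (t, r) := by
    rw [hn t ht, spin_eq_monoMom]
  have hJ' (t) (ht : 0 < t) (r) (i) : J t r i = monoMom [i] (field g 0) (t, r) := by
    rw [hJ t ht, flow_eq_monoMom]
  have hF (t) (ht : 0 < t) (r) (i k) :
      momentumFlux (n₀ t) (J t) (g t) r i k = monoMom [k, i] (field g 0) (t, r) :=
    hg.momentumFlux_eq ht r (hpos t ht r).ne' (hn₀' t ht r) (hJ' t ht r) i k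
  have hd (s : Fin 4) := hg.rapidC1_field s
  have hT (t) (ht : 0 < t) (r : Plane) (l : List (Fin 2)) (s : Fin 4) {F : ℝ → ℝ}
      (hF : ∀ t > 0, F t = monoMom l (field g s) (t, r)) :
      DifferentiableAt ℝ F t ∧ deriv F t = fderiv ℝ (monoMom l (field g s)) (t, r) dirT := by
    -- The moments are identified only for positive times, so the time derivative is compared near
    -- `t`.
    have he : F =ᶠ[𝓝 t] fun t' => monoMom l (field g s) (t', r) := by
      filter_upwards [lt_mem_nhds ht] with u hu
      exact hF u hu
    refine ⟨((hd s).differentiableAt_time l ht r).congr_of_eventuallyEq he, ?_⟩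
    rw [he.deriv_eq, deriv_eq_fderiv_dirT ((hd s).differentiableAt_monoMom l ht r)]
  have hX (t) (ht : 0 < t) (l : List (Fin 2)) (s : Fin 4) {F : Plane → ℝ}
      (hF : ∀ r, F r = monoMom l (field g s) (t, r)) (r : Plane) :
      DifferentiableAt ℝ F r ∧
        ∀ k, partialR k F r = fderiv ℝ (monoMom l (field g s)) (t, r) (dirR k) := by
    obtain rfl : F = fun r => monoMom l (field g s) (t, r) := funext hF
    exact ⟨(hd s).differentiableAt_position l ht r,
      partialR_eq_fderiv_dirR ((hd s).differentiableAt_monoMom l ht r)⟩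
  refine ⟨fun t ht r => ⟨?_, ?_, ?_⟩, fun t ht r => ?_, fun t ht r => ?_, fun t ht r => ?_,
    fun t ht r k s => ?_, fun t ht r i k => ?_, fun t ht r => ?_, fun t ht r s => ?_,
    fun t ht r i => ?_⟩
  · exact (hT t ht r [] 0 fun t ht => hn₀' t ht r).1
  · exact differentiableAt_pi.2 fun s => (hT t ht r [] s.succ fun t ht => hn' t ht r s).1
  · exact differentiableAt_pi.2 fun i => (hT t ht r [i] 0 fun t ht => hJ' t ht r i).1
  · exact (hX t ht [] 0 (hn₀' t ht) r).1
  · exact differentiableAt_pi.2 fun s => (hX t ht [] s.succ (fun r => hn' t ht r s) r).1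
  · exact differentiableAt_pi.2 fun i => (hX t ht [i] 0 (fun r => hJ' t ht r i) r).1
  · exact (hX t ht [k] s.succ (fun r => momentumSpin_eq_monoMom g r k s) r).1
  · exact (hX t ht [k, i] 0 (fun r => hF t ht r i k) r).1
  · rw [← h0 0 t ht r, (hT t ht r [] 0 fun t ht => hn₀' t ht r).2, div3,
      (hX t ht [] _ (fun r => hn' t ht r 0) r).2, (hX t ht [] _ (fun r => hn' t ht r 1) r).2]
    simp only [(hX t ht _ 0 (fun r => hJ' t ht r _) r).2]
    simp [momentDefect, momentBalance, potentialTerm, gradCoef, spinCoef, Fin.sum_univ_succ]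
  · rw [← h0 s.succ t ht r, (hT t ht r [] _ fun t ht => hn' t ht r s).2, hg.spinPrecession_eq ht,
      grad3, (hX t ht [] _ (hn₀' t ht) r).2, (hX t ht [] _ (hn₀' t ht) r).2]
    simp only [(hX t ht _ _ (fun r => momentumSpin_eq_monoMom g r _ s) r).2, momentDefect,
      momentBalance, potentialTerm, add_zero]
    congr 3
    fin_cases s
    all_goals simp [gradCoef, Fin.sum_univ_succ]
  · rw [← h1 i t ht r, (hT t ht r [i] 0 fun t ht => hJ' t ht r i).2, div3,
      (hX t ht [i] _ (fun r => momentumSpin_eq_monoMom g r i 0) r).2,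
      (hX t ht [i] _ (fun r => momentumSpin_eq_monoMom g r i 1) r).2, hn₀' t ht]
    simp only [(hX t ht _ 0 (fun r => hF t ht r i _) r).2]
    simp [momentDefect, momentBalance, potentialTerm, gradCoef, spinCoef, Fin.sum_univ_succ]
    ring

end Hydrodynamics

end Graphene

end

/-! ### The hydrodynamic limit -/

theorem theorem2
    -- semiclassical parameter, `γ = c / ε`, and the potential
    (ε γ : ℝ) (hε : 0 < ε) (hγ : 0 < γ)
    (V : Graphene.Plane → ℝ) (hV : Function.HasTemperateGrowth V)
    -- solutions `w τ` of the scaled system, with the equilibria `g τ` of their moments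
    (τ₀ : ℝ) (hτ₀ : 0 < τ₀)
    (w g : ℝ → ℝ → Graphene.PauliField) (ξ : ℝ → ℝ → Graphene.Multipliers)
    (hw : ∀ τ ∈ Set.Ioo 0 τ₀, Graphene.IsRegular (w τ))
    (hg : ∀ τ ∈ Set.Ioo 0 τ₀, Graphene.IsRegular (g τ))
    (heq : ∀ τ ∈ Set.Ioo 0 τ₀, ∀ t > 0, Graphene.IsEquilibrium ε (γ * ε)
      (Graphene.density (w τ t)) (Graphene.spin (w τ t)) (Graphene.flow (w τ t)) (ξ τ t) (g τ t))
    (hsol : ∀ τ ∈ Set.Ioo 0 τ₀, Graphene.SolvesWignerBGK ε γ τ V (w τ) (g τ))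
    -- bounds uniform in `τ`: third moments in `p`, and growth of the Lagrange multipliers
    (hmom : ∀ a b : ℝ, 0 < a → ∃ C : ℝ, ∀ τ ∈ Set.Ioo 0 τ₀, ∀ t ∈ Set.Icc a b,
      (∫ r, ∫ p, (1 + ‖p‖) ^ 3 * ‖w τ t r p‖) ≤ C ∧
      (∫ r, ∫ p, (1 + ‖p‖) ^ 3 * ‖g τ t r p‖) ≤ C)
    (hξ : ∀ t > 0, ∃ (C : ℝ) (m : ℕ), ∀ τ ∈ Set.Ioo 0 τ₀, ∀ r,
      |(ξ τ t).A r| + ‖(ξ τ t).B r‖ + ‖(ξ τ t).U r‖ ≤ C * (1 + ‖r‖) ^ m)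
    -- the limit moments, with their equilibrium distribution
    (n₀ : ℝ → Graphene.Plane → ℝ) (n : ℝ → Graphene.Plane → Fin 3 → ℝ)
    (J : ℝ → Graphene.Plane → Fin 2 → ℝ)
    (ξlim : ℝ → Graphene.Multipliers) (glim : ℝ → Graphene.PauliField)
    (hpos : ∀ t > 0, ∀ r, 0 < n₀ t r)
    (hglim : Graphene.IsRegular glim)
    (heqlim : ∀ t > 0, Graphene.IsEquilibrium ε (γ * ε) (n₀ t) (n t) (J t) (ξlim t) (glim t))
    -- convergence of the moments as `τ → 0`
    (hn₀ : ∀ t > 0, ∀ m : ℕ, Tendsto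
      (fun τ => ∫ r, (1 + ‖r‖) ^ m * |Graphene.density (w τ t) r - n₀ t r|) (𝓝[>] 0) (𝓝 0))
    (hn : ∀ t > 0, ∀ m : ℕ, Tendsto
      (fun τ => ∫ r, (1 + ‖r‖) ^ m * ‖Graphene.spin (w τ t) r - n t r‖) (𝓝[>] 0) (𝓝 0))
    (hJ : ∀ t > 0, ∀ m : ℕ, Tendsto
      (fun τ => ∫ r, (1 + ‖r‖) ^ m * ‖Graphene.flow (w τ t) r - J t r‖) (𝓝[>] 0) (𝓝 0)) :
    Graphene.SolvesHydrodynamic ε γ V n₀ n J glim := by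
  have hconv : ∀ ψ, Graphene.IsTest ψ → ∀ l : List (Fin 2), l.length ≤ 2 → ∀ s, ∀ t > 0,
      Tendsto (fun τ => Graphene.pair ψ (Graphene.monoMom l (Graphene.field (g τ) s)) t) (𝓝[>] 0)
        (𝓝 (Graphene.pair ψ (Graphene.monoMom l (Graphene.field glim s)) t)) := by
    intro ψ hψ l hl s t ht
    -- At a fixed time the degenerate window `[t, t]` suffices.
    obtain ⟨B, hB⟩ := hmom t t ht
    obtain ⟨K, m, hK⟩ := hξ t ht
    exact Graphene.tendsto_pair_equilibrium hε.ne' hτ₀ ht hg (fun τ hτ => heq τ hτ t ht)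
      (fun τ hτ => (hB τ hτ t (by simp)).2) hK hglim (heqlim t ht) (hn₀ t ht) (hn t ht) (hJ t ht)
      hψ.continuous hψ.supp hl s
  refine hglim.solvesHydrodynamic hpos (fun t ht r => ((heqlim t ht).density_eq r).symm)
    (fun t ht r => ((heqlim t ht).spin_eq r).symm) (fun t ht r => ((heqlim t ht).flow_eq r).symm)
    (fun s t ht r => ?_) fun i t ht r => ?_
  · refine Graphene.momentDefect_limit_eq_zero hε.ne' hτ₀ hV hw hg hsol hmom hglim hconv (by simp) s
      (fun τ hτ t ht r => ?_) ht r
    refine Fin.cases ?_ (fun j => ?_) s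
    · rw [← Graphene.density_eq_monoMom, ← Graphene.density_eq_monoMom,
        (heq τ hτ t ht).density_eq r]
    · rw [← Graphene.spin_eq_monoMom, ← Graphene.spin_eq_monoMom, (heq τ hτ t ht).spin_eq r]
  · refine Graphene.momentDefect_limit_eq_zero hε.ne' hτ₀ hV hw hg hsol hmom hglim hconv (by simp) 0
      (fun τ hτ t ht r => ?_) ht r
    rw [← Graphene.flow_eq_monoMom, ← Graphene.flow_eq_monoMom, (heq τ hτ t ht).flow_eq r]
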